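/- Let $\Omega(2,2)$ be the space of polynomial mappings $f=(g,h):\mathbb C^2\to\mathbb C^2$ with $\deg g\le 2$ and $\deg h\le 2$, identified with $\mathbb C^{12}$ through the coefficients. Let $GA(2,2)$ be the group of affine transformations (invertible affine maps) of $\mathbb C^2$, and let $GA(2,2)\times GA(2,2)$ act on $\Omega(2,2)$ by $(L,R)f=L\circ f\circ R$. Denote by $O(f)$ the orbit and by $\operatorname{Stab}(f)=\{(L,R): L\circ f\circ R=f\}$ the stabilizer of $f$, and by $C(f)=\{p\in\mathbb C^2:\det Df(p)=0\}$ the set of critical points of $f$. A hyperbola in $\mathbb C^2$ is a smooth conic with two distinct points at infinity, i.e. a set which is mapped onto $\{xy=1\}$ by an affine transformation. Let $f_1=(x^2+y,\,y^2+x)$. Theorem. For $f\in\Omega(2,2)$ the following conditions are equivalent: 1. $C(f)$ is a hyperbola; 2. $O(f)$ is an open dense subset of $\Omega(2,2)$ in the Zariski topology; 3. $O(f)$ is an open dense subset of $\Omega(2,2)$ in the Euclidean topology; 4. $O(f)=O(f_1)$; 5. $f\in O(f_1)$, i.e. $f=L\circ f_1\circ R$ for some affine transformations $L,R$ of $\mathbb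 C^2$. Moreover, the orbit $O(f_1)$ is (the set of closed points of) an open subscheme of the affine space $\mathbb A^{12}_{\mathbb C}$ which is a smooth affine variety of dimension $12$; with the Euclidean topology, $O(f_1)$ has finite-dimensional total rational singular homology and its Euler characteristic is $0$; and $\operatorname{Stab}(f_1)$ has exactly $6$ elements. -/

import Mathlib

open CategoryTheory AlgebraicGeometry

noncomputable section

/-- The space `Ω(2,2)` of polynomial mappings `f = (f 0, f 1) : ℂ² → ℂ²` with both components
of degree at most `2`. -/
def QuadMap : Type :=
  {f : Fin 2 → MvPolynomial (Fin 2) ℂ // ∀ i, (f i).totalDegree ≤ 2}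

namespace QuadMap

/-- The mapping `ℂ² → ℂ²` given by `f`. -/
def toFun (f : QuadMap) (x : Fin 2 → ℂ) : Fin 2 → ℂ :=
  fun i => MvPolynomial.eval x (f.1 i)

/-- The group `GA(2,2)` of affine transformations of `ℂ²`. -/
abbrev GA : Type := (Fin 2 → ℂ) ≃ᵃ[ℂ] (Fin 2 → ℂ)

/-- The orbit `O(f)` under the action `(L, R) f = L ∘ f ∘ R` of `GA(2,2) × GA(2,2)`. -/
def orbit (f : QuadMap) : Set QuadMap :=
  {g | ∃ L R : GA, g.toFun = L ∘ f.toFun ∘ R}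

/-- The stabilizer of `f` in `GA(2,2) × GA(2,2)`. -/
def stab (f : QuadMap) : Set (GA × GA) :=
  {p | p.1 ∘ f.toFun ∘ p.2 = f.toFun}

/-- The Jacobian matrix of `f` at `x`. -/
def jacobian (f : QuadMap) (x : Fin 2 → ℂ) : Matrix (Fin 2) (Fin 2) ℂ :=
  Matrix.of fun i j => MvPolynomial.eval x (MvPolynomial.pderiv j (f.1 i))

/-- The set `C(f)` of critical points of `f`. -/
def critSet (f : QuadMap) : Set (Fin 2 → ℂ) :=
  {x | (f.jacobian x).det = 0}

/-- Coordinates on `Ω(2,2)`: the coefficient of the monomial with exponent `d`, `|d| ≤ 2`,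
in the component `i`. -/
abbrev CoeffIndex : Type := Fin 2 × {d : Fin 2 →₀ ℕ // d.degree ≤ 2}

/-- The coordinate bijection from `Ω(2,2)` to `ℂ¹²`. -/
def coeffs (f : QuadMap) : CoeffIndex → ℂ :=
  fun k => MvPolynomial.coeff k.2.1 (f.1 k.1)

/-- The Euclidean topology of `Ω(2,2) = ℂ¹²`. -/
instance : TopologicalSpace QuadMap :=
  TopologicalSpace.induced coeffs inferInstance

/-- The affine space `𝔸¹²` over `ℂ`, as a scheme, whose closed points are the elements of
`Ω(2,2)`. -/
abbrev space : Scheme.{0} := Spec (CommRingCat.of (MvPolynomial CoeffIndex ℂ))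

/-- The structure morphism of the scheme `space`. -/
abbrev structureMap : space ⟶ Spec (CommRingCat.of ℂ) :=
  Spec.map (CommRingCat.ofHom (MvPolynomial.C (σ := CoeffIndex) (R := ℂ)))

/-- The closed point of the scheme `space` that corresponds to `f`: the maximal ideal of all
polynomials in the coefficients that vanish at `f`. -/
def toPoint (f : QuadMap) : space :=
  (MvPolynomial.pointToPoint f.coeffs : PrimeSpectrum (MvPolynomial CoeffIndex ℂ))

/-- The Zariski topology of `Ω(2,2)`. -/
abbrev zariski : TopologicalSpace QuadMap :=
  TopologicalSpace.induced toPoint inferInstance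

/-- The mapping `f₁ = (x² + y, y² + x)`. -/
def f₁ : QuadMap :=
  ⟨![MvPolynomial.X 0 ^ 2 + MvPolynomial.X 1, MvPolynomial.X 1 ^ 2 + MvPolynomial.X 0], by
    have h : ∀ i j : Fin 2,
        (MvPolynomial.X i ^ 2 + MvPolynomial.X j : MvPolynomial (Fin 2) ℂ).totalDegree ≤ 2 := by
      intro i j
      refine (MvPolynomial.totalDegree_add _ _).trans (max_le ?_ ?_)
      · exact (MvPolynomial.totalDegree_X_pow i 2).le
      · rw [MvPolynomial.totalDegree_X]
        norm_num
    intro i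
    fin_cases i
    · exact h 0 1
    · exact h 1 0⟩

end QuadMap

/-- A hyperbola in `ℂ²`: a subset that is affinely equivalent to `{x y = 1}`; over `ℂ` these are
the smooth conics with two distinct points at infinity. -/
def IsHyperbola (S : Set (Fin 2 → ℂ)) : Prop :=
  ∃ e : (Fin 2 → ℂ) ≃ᵃ[ℂ] (Fin 2 → ℂ), e '' S = {x | x 0 * x 1 = 1}

/-- A scheme over `ℂ` is a smooth affine variety: affine, integral and smooth over `ℂ` (hence of
finite type and separated). -/
structure IsSmoothAffineVariety {X : Scheme.{0}} (π : X ⟶ Spec (CommRingCat.of ℂ)) : Prop where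
  isAffine : IsAffine X
  isIntegral : IsIntegral X
  smooth : Smooth π

/-- The singular chain complex of a topological space with coefficients in `ℚ`. -/
abbrev singularChains (X : Type) [TopologicalSpace X] : ChainComplex (ModuleCat.{0} ℚ) ℕ :=
  ((AlgebraicTopology.singularChainComplexFunctor (ModuleCat.{0} ℚ)).obj
    (ModuleCat.of ℚ ℚ)).obj (TopCat.of X)

/-- The topological space `X` has a well-defined Euler characteristic, equal to `χ`: its rational
singular homology is finite-dimensional in each degree, vanishes in large degrees, and has the
alternating sum of dimensions `χ`. -/
structure HasEulerCharacteristic (X : Type) [TopologicalSpace X] (χ : ℤ) : Prop where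
  finite : ∀ n, Module.Finite ℚ ((singularChains X).homology n)
  bounded : ∃ N, ∀ n, N ≤ n → Subsingleton ((singularChains X).homology n)
  eq : (singularChains X).homologyEulerChar = χ

end

/-! The Jacobian determinant of `f` is a polynomial of degree at most 2, given by the coefficients
`ConicPair.jac`. Affine changes on either side transform it by substitution and nonzero factors, so
its discriminant `disc` and determinant `delta` change only by nonzero factors. For `f₁` it is `4xy
- 1`, where both are nonzero. Conversely, if both are nonzero, `exists_comp_eq` moves the conic to
`Bxy + F`. Relations between the 2×2 minors of the coefficient matrix then force `g = c₀(x² + εy) +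
c₂(y² + δx) + const`, and rescaling the variables gives `f₁` up to a left affine map
(`exists_eq_leftComp_of_jac`). Hence the orbit of `f₁` is the locus `disc * delta ≠ 0`
(`mem_orbit_f₁_iff`), a nonempty principal open subset of affine 12-space. This gives openness and
density in both topologies, smoothness, affineness and the dimension. Any other open orbit would
meet this dense one, so it would equal it. A polynomial of degree at most 2 vanishing exactly on `xy
= 1` is a nonzero multiple of `xy - 1`, which brings in the hyperbola.

For the Euler characteristic, scaling `f` by `c` multiplies `disc (jac f)` by `c⁴`. Continuous
fourth roots therefore trivialize this map to the punctured plane over two slit planes, which meet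
in two half-planes; Mayer–Vietoris gives `χ + χ - 2χ = 0` once the fibre has finite homology. That
fibre maps to the binary forms of discriminant 1, which two copies of `ℂ²` cover. Over each copy, a
continuous family of unimodular substitutions identifies all fibres with the one over `xy`, an
explicit product built from frames, `ℂ` and `ℂ*`. Finiteness is propagated in the form
"multiplication by `Z` preserves finite homology", which passes to products and to open covers and
so replaces a Künneth formula.

Mayer–Vietoris rests on barycentric subdivision: it is homotopic to the identity, commutes with
affine maps and shrinks simplices, so chains can be made subordinate to an open cover.

For the stabilizer, `R` determines `L`, because the image of `f₁` affinely spans the plane.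
Comparing coefficients leaves `R = diag(w, w²)` or its antidiagonal counterpart, with `w³ = 1`. -/

/-! ### Subdivision of formal chains of tuples -/

/-- Formal chains of tuples of `k` points of `E`: the augmented chain complex of affine simplices. -/
abbrev TupleChain (E : Type*) (k : ℕ) : Type _ := (Fin k → E) →₀ ℚ

namespace TupleChain

variable {E F : Type*}

/-- The boundary of a chain of tuples. -/
noncomputable def bd (k : ℕ) : TupleChain E (k + 1) →ₗ[ℚ] TupleChain E k :=
  Finsupp.linearCombination ℚ fun w =>
    ∑ i : Fin (k + 1), (-1 : ℚ) ^ (i : ℕ) • Finsupp.single (w ∘ i.succAbove) (1 : ℚ)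

/-- The cone with apex `b`. -/
noncomputable def cone (b : E) (k : ℕ) : TupleChain E k →ₗ[ℚ] TupleChain E (k + 1) :=
  Finsupp.lmapDomain ℚ ℚ (Fin.cons (α := fun _ => E) b)

/-- The chain map induced by a map of points. -/
noncomputable def map (f : E → F) (k : ℕ) : TupleChain E k →ₗ[ℚ] TupleChain F k :=
  Finsupp.lmapDomain ℚ ℚ (f ∘ ·)

@[simp]
lemma bd_single (k : ℕ) (w : Fin (k + 1) → E) :
    bd k (Finsupp.single w 1) =
      ∑ i : Fin (k + 1), (-1 : ℚ) ^ (i : ℕ) • Finsupp.single (w ∘ i.succAbove) (1 : ℚ) := by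
  simp [bd]

@[simp]
lemma cone_single (b : E) (k : ℕ) (w : Fin k → E) :
    cone b k (Finsupp.single w 1) = Finsupp.single (Fin.cons (α := fun _ => E) b w) 1 := by
  simp [cone]

@[simp]
lemma map_single (f : E → F) (k : ℕ) (w : Fin k → E) :
    map f k (Finsupp.single w 1) = Finsupp.single (f ∘ w) 1 := by
  simp [map]

lemma hom_ext {M : Type*} [AddCommGroup M] [Module ℚ M] {k : ℕ} {f g : TupleChain E k →ₗ[ℚ] M}
    (h : ∀ w, f (Finsupp.single w 1) = g (Finsupp.single w 1)) : f = g := by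
  refine Finsupp.lhom_ext' fun w => LinearMap.ext_ring ?_
  simpa using h w

lemma bd_cone_zero (b : E) (c : TupleChain E 0) : bd 0 (cone b 0 c) = c := by
  have : bd 0 ∘ₗ cone b 0 = LinearMap.id (R := ℚ) (M := TupleChain E 0) :=
    hom_ext fun w => by
      simp [Subsingleton.elim _ w]
  exact LinearMap.congr_fun this c

/-- The face opposite the apex is the base; every other face is a cone over a face of the base, with
its sign reversed by the index shift. -/
lemma bd_cone_succ (b : E) (k : ℕ) (c : TupleChain E (k + 1)) :
    bd (k + 1) (cone b (k + 1) c) = c - cone b k (bd k c) := by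
  have : bd (k + 1) ∘ₗ cone b (k + 1) = LinearMap.id - cone b k ∘ₗ bd k :=
    hom_ext fun w => by
      have h : ∀ i : Fin (k + 1), (Fin.cons (α := fun _ => E) b w) ∘ i.succ.succAbove =
          Fin.cons (α := fun _ => E) b (w ∘ i.succAbove) := by
        intro i
        funext j
        refine Fin.cases ?_ (fun j => ?_) j <;> simp
      have h0 : (Fin.cons (α := fun _ => E) b w) ∘ (0 : Fin (k + 2)).succAbove = w := by
        funext j; simp
      simp only [LinearMap.comp_apply, LinearMap.sub_apply, LinearMap.id_apply, cone_single,
        bd_single, Fin.sum_univ_succ (n := k + 1), h, h0, map_sum, map_smul, Fin.val_zero, pow_zero,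
        one_smul, Fin.val_succ, pow_succ, mul_neg, mul_one, neg_smul, Finset.sum_neg_distrib,
        ← sub_eq_add_neg]
  exact LinearMap.congr_fun this c

/-- A nonempty tuple is the cone over its tail, so the cone formula reduces the claim to the tail,
one degree lower. -/
lemma bd_bd (k : ℕ) (c : TupleChain E (k + 2)) : bd k (bd (k + 1) c) = 0 := by
  suffices bd k ∘ₗ bd (k + 1) = (0 : TupleChain E (k + 2) →ₗ[ℚ] TupleChain E k) from
    LinearMap.congr_fun this c
  clear c
  induction k with
  | zero =>
    refine hom_ext fun w => ?_
    rw [← Fin.cons_self_tail w, ← cone_single]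
    simp only [LinearMap.comp_apply, bd_cone_succ, map_sub, bd_cone_zero, sub_self,
      LinearMap.zero_apply]
  | succ k ih =>
    refine hom_ext fun w => ?_
    rw [← Fin.cons_self_tail w, ← cone_single]
    have := LinearMap.congr_fun ih (Finsupp.single (Fin.tail w) 1)
    simp only [LinearMap.comp_apply, LinearMap.zero_apply] at this
    simp only [LinearMap.comp_apply, bd_cone_succ, map_sub, this, map_zero, sub_zero, sub_self,
      LinearMap.zero_apply]

lemma map_bd (f : E → F) (k : ℕ) (c : TupleChain E (k + 1)) :
    map f k (bd k c) = bd k (map f (k + 1) c) := by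
  have : map f k ∘ₗ bd k = bd k ∘ₗ map f (k + 1) := hom_ext fun w => by
    simp only [LinearMap.comp_apply, bd_single, map_single, map_sum, map_smul, Function.comp_assoc]
  exact LinearMap.congr_fun this c

lemma map_cone (f : E → F) (b : E) (k : ℕ) (c : TupleChain E k) :
    map f (k + 1) (cone b k c) = cone (f b) k (map f k c) := by
  have : map f (k + 1) ∘ₗ cone b k = cone (f b) k ∘ₗ map f k := hom_ext fun w => by
    simp [Fin.comp_cons]
  exact LinearMap.congr_fun this c

section Subdivision

variable (β : ∀ k : ℕ, (Fin (k + 1) → E) → E)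

/-- The subdivision of chains whose apices are given by `β`. -/
noncomputable def sd : ∀ k : ℕ, TupleChain E k →ₗ[ℚ] TupleChain E k
  | 0 => LinearMap.id
  | k + 1 => Finsupp.linearCombination ℚ fun w =>
      cone (β k w) k (sd k (bd k (Finsupp.single w 1)))

/-- The chain homotopy between the identity and the subdivision. -/
noncomputable def sdHomotopy : ∀ k : ℕ, TupleChain E k →ₗ[ℚ] TupleChain E (k + 1)
  | 0 => 0
  | k + 1 => Finsupp.linearCombination ℚ fun w =>
      cone (β k w) (k + 1) (Finsupp.single w 1 - sdHomotopy k (bd k (Finsupp.single w 1)))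

lemma sd_single (k : ℕ) (w : Fin (k + 1) → E) :
    sd β (k + 1) (Finsupp.single w 1) =
      cone (β k w) k (sd β k (bd k (Finsupp.single w 1))) := by
  rw [sd, Finsupp.linearCombination_single, one_smul]

lemma sdHomotopy_single (k : ℕ) (w : Fin (k + 1) → E) :
    sdHomotopy β (k + 1) (Finsupp.single w 1) =
      cone (β k w) (k + 1)
        (Finsupp.single w 1 - sdHomotopy β k (bd k (Finsupp.single w 1))) := by
  rw [sdHomotopy, Finsupp.linearCombination_single, one_smul]

/-- By the cone formula the defect is a cone over `∂ sd ∂w`, which is `sd ∂∂w = 0` by induction. -/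
lemma bd_sd (k : ℕ) (c : TupleChain E (k + 1)) : bd k (sd β (k + 1) c) = sd β k (bd k c) := by
  suffices bd k ∘ₗ sd β (k + 1) = sd β k ∘ₗ bd k from LinearMap.congr_fun this c
  clear c
  induction k with
  | zero =>
    refine hom_ext fun w => ?_
    simp only [LinearMap.comp_apply, sd_single, bd_cone_zero]
  | succ k ih =>
    refine hom_ext fun w => ?_
    have := LinearMap.congr_fun ih (bd (k + 1) (Finsupp.single w 1))
    simp only [LinearMap.comp_apply, bd_bd, map_zero] at this
    simp only [LinearMap.comp_apply, sd_single, bd_cone_succ, this, map_zero, sub_zero]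

/-- Writing `T` for the homotopy, induction gives `∂(w - T∂w) = sd ∂w`, and the cone over this is
`sd w`; the cone formula does the rest. -/
lemma bd_sdHomotopy (k : ℕ) (c : TupleChain E (k + 1)) :
    bd (k + 1) (sdHomotopy β (k + 1) c) = c - sd β (k + 1) c - sdHomotopy β k (bd k c) := by
  suffices bd (k + 1) ∘ₗ sdHomotopy β (k + 1) =
    LinearMap.id - sd β (k + 1) - sdHomotopy β k ∘ₗ bd k from LinearMap.congr_fun this c
  clear c
  induction k with
  | zero =>
    refine hom_ext fun w => ?_
    have h : ∀ c, sdHomotopy β 0 c = 0 := fun _ => rfl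
    have h' : ∀ c, sd β 0 c = c := fun _ => rfl
    simp only [LinearMap.comp_apply, LinearMap.sub_apply, LinearMap.id_apply, sdHomotopy_single,
      bd_cone_succ, sd_single, h, h', sub_zero]
  | succ k ih =>
    refine hom_ext fun w => ?_
    have := LinearMap.congr_fun ih (bd (k + 1) (Finsupp.single w 1))
    simp only [LinearMap.comp_apply, LinearMap.sub_apply, LinearMap.id_apply, bd_bd, map_zero,
      sub_zero] at this
    simp only [LinearMap.comp_apply, LinearMap.sub_apply, LinearMap.id_apply, sdHomotopy_single,
      bd_cone_succ, sd_single _ (k + 1), map_sub, this]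
    abel

variable {β} {γ : ∀ k : ℕ, (Fin (k + 1) → F) → F} {f : E → F}

/-- Naturality needs only that `f` carries apices to apices; it is applied to affine maps, which
preserve barycenters. -/
lemma map_sd (hf : ∀ k w, f (β k w) = γ k (f ∘ w)) (k : ℕ) (c : TupleChain E k) :
    map f k (sd β k c) = sd γ k (map f k c) := by
  suffices map f k ∘ₗ sd β k = sd γ k ∘ₗ map f k from LinearMap.congr_fun this c
  clear c
  induction k with
  | zero => rfl
  | succ k ih =>
    refine hom_ext fun w => ?_
    have := LinearMap.congr_fun ih (bd k (Finsupp.single w 1))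
    simp only [LinearMap.comp_apply] at this
    simp only [LinearMap.comp_apply, map_single, sd_single, map_cone, this, hf, map_bd]

lemma map_sdHomotopy (hf : ∀ k w, f (β k w) = γ k (f ∘ w)) (k : ℕ) (c : TupleChain E k) :
    map f (k + 1) (sdHomotopy β k c) = sdHomotopy γ k (map f k c) := by
  suffices map f (k + 1) ∘ₗ sdHomotopy β k = sdHomotopy γ k ∘ₗ map f k from
    LinearMap.congr_fun this c
  clear c
  induction k with
  | zero => simp [sdHomotopy]
  | succ k ih =>
    refine hom_ext fun w => ?_
    have := LinearMap.congr_fun ih (bd k (Finsupp.single w 1))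
    simp only [LinearMap.comp_apply] at this
    simp only [LinearMap.comp_apply, map_single, sdHomotopy_single, map_cone, map_sub, this, hf,
      map_bd]

end Subdivision

end TupleChain

/-! ### Convex combinations in standard simplices -/

namespace stdSimplex

variable {ι κ l : Type*} [Fintype ι] [Fintype κ] [Fintype l]

/-- The convex combination of the points `w i` with weights `t i`. -/
noncomputable def comb (w : ι → stdSimplex ℝ κ) (t : stdSimplex ℝ ι) : stdSimplex ℝ κ :=
  ⟨∑ i, t i • (w i : κ → ℝ), (convex_stdSimplex ℝ κ).sum_mem (fun i _ => t.2.1 i) t.2.2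
    fun i _ => (w i).2⟩

lemma comb_apply (w : ι → stdSimplex ℝ κ) (t : stdSimplex ℝ ι) (j : κ) :
    comb w t j = ∑ i, t i * w i j := by
  change (∑ i, t i • (w i : κ → ℝ)) j = _
  simp

lemma comb_vertex [DecidableEq ι] (w : ι → stdSimplex ℝ κ) (i : ι) :
    comb w (vertex i) = w i := by
  ext j
  simp [comb_apply, Pi.single_apply]

lemma comb_vertex_comp [DecidableEq κ] (f : ι → κ) (t : stdSimplex ℝ ι) :
    comb (fun i => vertex (f i)) t = map f t := by
  ext j
  simp [comb_apply, FunOnFinite.linearMap_apply_apply, Pi.single_apply, Finset.sum_filter, eq_comm]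

lemma comb_vertex_self [DecidableEq ι] (t : stdSimplex ℝ ι) :
    comb (fun i => vertex i) t = t := by
  ext j
  simp [comb_apply, Pi.single_apply]

lemma comb_comb (w : ι → stdSimplex ℝ κ) (v : l → stdSimplex ℝ ι) (t : stdSimplex ℝ l) :
    comb w (comb v t) = comb (fun i => comb w (v i)) t := by
  ext j
  simp only [comb_apply, Finset.sum_mul, Finset.mul_sum]
  rw [Finset.sum_comm]
  simp only [mul_assoc]

lemma continuous_comb (w : ι → stdSimplex ℝ κ) : Continuous (comb w) := by
  refine Continuous.subtype_mk (continuous_finsetSum _ fun i _ => ?_) _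
  exact ((continuous_apply i).comp continuous_subtype_val).smul continuous_const

lemma dist_comb_le {w : ι → stdSimplex ℝ κ} {x : stdSimplex ℝ κ} {r : ℝ}
    (h : ∀ i, dist (w i) x ≤ r) (t : stdSimplex ℝ ι) : dist (comb w t) x ≤ r := by
  have := (convex_closedBall (x : κ → ℝ) r).sum_mem (t := Finset.univ) (fun i _ => t.2.1 i) t.2.2
    (z := fun i => (w i : κ → ℝ)) fun i _ => h i
  exact this

/-- The difference is the mean of the vectors `w i - w j`; the term `i = j` vanishes, which leaves
`N - 1` terms of norm at most `r / N`, where `N` is the number of points. -/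
lemma dist_comb_barycenter_le [Nonempty ι] {w : ι → stdSimplex ℝ κ} {r ρ : ℝ}
    (h : ∀ i j, dist (w i) (w j) ≤ r) (hr : 0 ≤ r)
    (hρ : 1 - (Fintype.card ι : ℝ)⁻¹ ≤ ρ) (j : ι) :
    dist (w j) (comb w barycenter) ≤ ρ * r := by
  classical
  have hN : (Fintype.card ι : ℝ) ≠ 0 := by simp
  refine le_trans ?_ (mul_le_mul_of_nonneg_right hρ hr)
  rw [dist_comm, Subtype.dist_eq, dist_eq_norm]
  have e : ((comb w barycenter : stdSimplex ℝ κ) : κ → ℝ) - (w j : κ → ℝ) =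
      ∑ i ∈ Finset.univ.erase j, (Fintype.card ι : ℝ)⁻¹ • ((w i : κ → ℝ) - (w j : κ → ℝ)) := by
    rw [Finset.sum_erase _ (by simp)]
    simp only [smul_sub, Finset.sum_sub_distrib, Finset.sum_const, Finset.card_univ]
    rw [← Nat.cast_smul_eq_nsmul ℝ, smul_smul, mul_inv_cancel₀ hN, one_smul]
    rfl
  refine (congrArg norm e).trans_le ?_
  refine (norm_sum_le _ _).trans ?_
  have : ∀ i ∈ Finset.univ.erase j,
      ‖(Fintype.card ι : ℝ)⁻¹ • ((w i : κ → ℝ) - (w j : κ → ℝ))‖ ≤ (Fintype.card ι : ℝ)⁻¹ * r := by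
    intro i _
    rw [norm_smul, Real.norm_of_nonneg (by positivity)]
    exact mul_le_mul_of_nonneg_left (by rw [← dist_eq_norm]; exact h i j) (by positivity)
  refine (Finset.sum_le_card_nsmul _ _ _ this).trans (le_of_eq ?_)
  rw [Finset.card_erase_of_mem (Finset.mem_univ j), Finset.card_univ, nsmul_eq_mul,
    Nat.cast_sub Fintype.card_pos]
  field_simp
  push_cast
  ring

end stdSimplex

/-! ### Size of the simplices of a subdivision -/

namespace TupleChain

section

variable {E F : Type*} {k : ℕ}

lemma apply_mem_of_mem_supported {M : Type*} [AddCommGroup M] [Module ℚ M] {A : Set (Fin k → E)}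
    {N : Submodule ℚ M} {f : TupleChain E k →ₗ[ℚ] M}
    (h : ∀ w ∈ A, f (Finsupp.single w 1) ∈ N) {c : TupleChain E k}
    (hc : c ∈ Finsupp.supported ℚ ℚ A) : f c ∈ N := by
  suffices Finsupp.supported ℚ ℚ A ≤ N.comap f from this hc
  rw [Finsupp.supported_eq_span_single, Submodule.span_le]
  rintro _ ⟨w, hw, rfl⟩
  exact h w hw

lemma single_mem_supported {A : Set (Fin k → E)} {w : Fin k → E} (h : w ∈ A) :
    (Finsupp.single w 1 : TupleChain E k) ∈ Finsupp.supported ℚ ℚ A :=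
  Finsupp.single_mem_supported ℚ 1 h

lemma bd_mem_supported {A : Set (Fin (k + 1) → E)} {B : Set (Fin k → E)}
    (h : ∀ w ∈ A, ∀ i : Fin (k + 1), w ∘ i.succAbove ∈ B) {c : TupleChain E (k + 1)}
    (hc : c ∈ Finsupp.supported ℚ ℚ A) : bd k c ∈ Finsupp.supported ℚ ℚ B := by
  refine apply_mem_of_mem_supported (fun w hw => ?_) hc
  rw [bd_single]
  exact Submodule.sum_mem _ fun i _ => Submodule.smul_mem _ _ (single_mem_supported (h w hw i))

lemma cone_mem_supported {b : E} {A : Set (Fin k → E)} {B : Set (Fin (k + 1) → E)}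
    (h : ∀ w ∈ A, Fin.cons (α := fun _ => E) b w ∈ B) {c : TupleChain E k}
    (hc : c ∈ Finsupp.supported ℚ ℚ A) : cone b k c ∈ Finsupp.supported ℚ ℚ B := by
  refine apply_mem_of_mem_supported (fun w hw => ?_) hc
  rw [cone_single]
  exact single_mem_supported (h w hw)

/-- Used with `A` a closed ball around an apex, to bound the distance from that apex to the vertices
of the subdivided faces. -/
lemma sd_mem_supported {β : ∀ k : ℕ, (Fin (k + 1) → E) → E} {A : Set E}
    (hβ : ∀ k w, (∀ i, w i ∈ A) → β k w ∈ A) (k : ℕ) {c : TupleChain E k}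
    (hc : c ∈ Finsupp.supported ℚ ℚ {w : Fin k → E | ∀ i, w i ∈ A}) :
    sd β k c ∈ Finsupp.supported ℚ ℚ {w : Fin k → E | ∀ i, w i ∈ A} := by
  induction k with
  | zero => exact hc
  | succ k ih =>
    refine apply_mem_of_mem_supported (fun w hw => ?_) hc
    rw [sd_single]
    refine cone_mem_supported (A := {w : Fin k → E | ∀ i, w i ∈ A}) ?_
      (ih (bd_mem_supported (A := {w : Fin (k + 1) → E | ∀ i, w i ∈ A}) ?_
        (single_mem_supported hw)))
    · intro v hv i
      refine Fin.cases ?_ (fun i => ?_) i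
      · exact hβ k w hw
      · exact hv i
    · intro v hv i j
      exact hv _

end

section

open stdSimplex

variable {κ : Type*} [Fintype κ]

/-- The barycenter of a tuple of points of a standard simplex. -/
noncomputable def bary (k : ℕ) (w : Fin (k + 1) → stdSimplex ℝ κ) : stdSimplex ℝ κ :=
  comb w barycenter

/-- A pair of vertices of a subdivided simplex either contains the apex, where the barycenter
estimate applies, or lies in a subdivided face, where induction applies. The factor depends only on
`N`, so it is the same for all faces. -/
lemma sd_bary_mem_supported (N : ℕ) {r : ℝ} (hr : 0 ≤ r) (k : ℕ) (hk : k ≤ N + 1)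
    {c : TupleChain (stdSimplex ℝ κ) k}
    (hc : c ∈ Finsupp.supported ℚ ℚ {w : Fin k → stdSimplex ℝ κ | ∀ i j, dist (w i) (w j) ≤ r}) :
    sd bary k c ∈ Finsupp.supported ℚ ℚ
      {w : Fin k → stdSimplex ℝ κ | ∀ i j, dist (w i) (w j) ≤ (N / (N + 1) : ℝ) * r} := by
  have hρ : 0 ≤ (N / (N + 1) : ℝ) * r := by positivity
  induction k with
  | zero =>
    refine apply_mem_of_mem_supported (fun w _ => ?_) hc
    exact single_mem_supported fun i => i.elim0
  | succ k ih =>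
    refine apply_mem_of_mem_supported (fun w hw => ?_) hc
    rw [sd_single]
    have hw' : ∀ j, dist (w j) (bary k w) ≤ (N / (N + 1) : ℝ) * r := by
      refine dist_comb_barycenter_le hw hr ?_
      rw [Fintype.card_fin]
      have hkN : ((k + 1 : ℕ) : ℝ) ≤ N + 1 := by exact_mod_cast hk
      have h1 : ((N : ℝ) + 1)⁻¹ ≤ ((k + 1 : ℕ) : ℝ)⁻¹ := inv_anti₀ (by positivity) hkN
      have h2 : (N / (N + 1) : ℝ) = 1 - ((N : ℝ) + 1)⁻¹ := by field_simp; ring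
      rw [h2]
      linarith
    -- Besides the size of the faces, their position in a ball around the apex is recorded; this
    -- controls the new edges.
    refine cone_mem_supported
      (A := {v : Fin k → stdSimplex ℝ κ | ∀ i j, dist (v i) (v j) ≤ (N / (N + 1) : ℝ) * r} ∩
        {v | ∀ i, v i ∈ Metric.closedBall (bary k w) ((N / (N + 1) : ℝ) * r)}) ?_ ?_
    · rintro v ⟨hv, hv'⟩ i j
      refine Fin.cases ?_ (fun i => ?_) i <;> refine Fin.cases ?_ (fun j => ?_) j
      · simpa using hρ
      · simpa [dist_comm] using hv' j
      · simpa using hv' i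
      · simpa using hv i j
    · rw [Finsupp.supported_inter]
      refine ⟨ih (by omega) (bd_mem_supported
        (A := {w : Fin (k + 1) → stdSimplex ℝ κ | ∀ i j, dist (w i) (w j) ≤ r}) ?_
          (single_mem_supported hw)), sd_mem_supported ?_ k (bd_mem_supported
        (A := {v | ∀ i, v i ∈ Metric.closedBall (bary k w) ((N / (N + 1) : ℝ) * r)}) ?_
          (single_mem_supported hw'))⟩
      · intro v hv i j j'
        exact hv _ _
      · intro k v hv
        exact dist_comb_le hv _
      · intro v hv i j
        exact hv _

lemma iterate_sd_bary_mem_supported (k m : ℕ) {r : ℝ} (hr : 0 ≤ r)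
    {c : TupleChain (stdSimplex ℝ κ) (k + 1)}
    (hc : c ∈ Finsupp.supported ℚ ℚ
      {w : Fin (k + 1) → stdSimplex ℝ κ | ∀ i j, dist (w i) (w j) ≤ r}) :
    (sd bary (k + 1))^[m] c ∈ Finsupp.supported ℚ ℚ
      {w : Fin (k + 1) → stdSimplex ℝ κ | ∀ i j, dist (w i) (w j) ≤ (k / (k + 1) : ℝ) ^ m * r} := by
  induction m with
  | zero => simpa using hc
  | succ m ih =>
    rw [Function.iterate_succ_apply', pow_succ', mul_assoc]
    exact sd_bary_mem_supported k (by positivity) (k + 1) le_rfl ih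

end

end TupleChain

/-! ### Singular chains, their subdivision, and small chains -/

namespace SingularChain

open Opposite Simplicial

variable {X Y : Type} [TopologicalSpace X] [TopologicalSpace Y]

/-- The chain consisting of one singular simplex. -/
noncomputable def of {n : ℕ} (σ : C(stdSimplex ℝ (Fin (n + 1)), X)) : (singularChains X).X n :=
  (SSet.ιChainComplex (X := TopCat.toSSet.obj (TopCat.of X)) (R := ModuleCat.of ℚ ℚ) (n := n)
    ((TopCat.toSSetObjEquiv (TopCat.of X) (op ⦋n⦌)).symm σ)).hom (1 : ℚ)

/-- The differential of the singular chain complex as a linear map. -/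
noncomputable def d (X : Type) [TopologicalSpace X] (i j : ℕ) :
    (singularChains X).X i →ₗ[ℚ] (singularChains X).X j :=
  ((singularChains X).d i j).hom

/-- The linear map from singular chains with given values on singular simplices. -/
noncomputable def lift {M : Type} [AddCommGroup M] [Module ℚ M] {n : ℕ}
    (f : C(stdSimplex ℝ (Fin (n + 1)), X) → M) : (singularChains X).X n →ₗ[ℚ] M :=
  (Limits.Cofan.IsColimit.desc
    ((TopCat.toSSet.obj (TopCat.of X)).isColimitChainComplexXCofan (ModuleCat.of ℚ ℚ) n)
    (A := ModuleCat.of ℚ M)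
    fun x => ModuleCat.ofHom (LinearMap.toSpanSingleton ℚ M
      (f (TopCat.toSSetObjEquiv (TopCat.of X) (op ⦋n⦌) x)))).hom

lemma lift_of {M : Type} [AddCommGroup M] [Module ℚ M] {n : ℕ}
    (f : C(stdSimplex ℝ (Fin (n + 1)), X) → M) (σ : C(stdSimplex ℝ (Fin (n + 1)), X)) :
    lift f (of σ) = f σ := by
  have := Limits.Cofan.IsColimit.fac
    ((TopCat.toSSet.obj (TopCat.of X)).isColimitChainComplexXCofan (ModuleCat.of ℚ ℚ) n)
    (A := ModuleCat.of ℚ M)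
    (fun x => ModuleCat.ofHom (LinearMap.toSpanSingleton ℚ M
      (f (TopCat.toSSetObjEquiv (TopCat.of X) (op ⦋n⦌) x))))
    ((TopCat.toSSetObjEquiv (TopCat.of X) (op ⦋n⦌)).symm σ)
  have h := congrArg (fun g => g.hom (1 : ℚ)) this
  refine h.trans ?_
  simp

lemma hom_ext {M : Type} [AddCommGroup M] [Module ℚ M] {n : ℕ}
    {f g : (singularChains X).X n →ₗ[ℚ] M} (h : ∀ σ, f (of σ) = g (of σ)) : f = g := by
  have : ModuleCat.ofHom f = ModuleCat.ofHom (Y := M) g := by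
    refine SSet.chainComplex_hom_ext (X := TopCat.toSSet.obj (TopCat.of X))
      (R := ModuleCat.of ℚ ℚ) fun x => ?_
    refine ModuleCat.hom_ext (LinearMap.ext_ring ?_)
    have := h (TopCat.toSSetObjEquiv (TopCat.of X) (op ⦋n⦌) x)
    simp only [of, Equiv.symm_apply_apply] at this
    exact this
  exact congrArg ModuleCat.Hom.hom this

lemma span_of (n : ℕ) : Submodule.span ℚ (Set.range (of (X := X) (n := n))) = ⊤ := by
  have : (Submodule.span ℚ (Set.range (of (X := X) (n := n)))).mkQ = 0 := hom_ext fun σ => by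
    rw [LinearMap.zero_apply, Submodule.mkQ_apply, Submodule.Quotient.mk_eq_zero]
    exact Submodule.subset_span (Set.mem_range_self σ)
  rw [← Submodule.ker_mkQ (Submodule.span ℚ _), this, LinearMap.ker_zero]

lemma d_of {n : ℕ} (σ : C(stdSimplex ℝ (Fin (n + 2)), X)) :
    d X (n + 1) n (of σ) = ∑ i : Fin (n + 2), (-1 : ℚ) ^ (i : ℕ) •
      of (σ.comp ⟨stdSimplex.map i.succAbove, stdSimplex.continuous_map _⟩) := by
  have := SSet.ιChainComplex_d (TopCat.toSSet.obj (TopCat.of X)) (ModuleCat.of ℚ ℚ)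
    ((TopCat.toSSetObjEquiv (TopCat.of X) (op ⦋n + 1⦌)).symm σ)
  have h := congrArg (fun g => g.hom (1 : ℚ)) this
  refine h.trans ?_
  simp only [ModuleCat.hom_sum, LinearMap.sum_apply]
  refine Finset.sum_congr rfl fun i _ => ?_
  rcases Nat.even_or_odd (i : ℕ) with hi | hi
  · simp only [hi.neg_one_pow, one_smul]; rfl
  · simp only [hi.neg_one_pow, neg_smul, one_smul]; rfl

lemma d_eq_zero {i j : ℕ} (h : j + 1 ≠ i) : d X i j = 0 :=
  congrArg ModuleCat.Hom.hom ((singularChains X).shape i j h)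

/-- The map induced by a continuous map on singular chains. -/
noncomputable def map (f : C(X, Y)) (n : ℕ) : (singularChains X).X n →ₗ[ℚ] (singularChains Y).X n :=
  ((((AlgebraicTopology.singularChainComplexFunctor (ModuleCat.{0} ℚ)).obj
    (ModuleCat.of ℚ ℚ)).map (TopCat.ofHom f)).f n).hom

lemma map_of (f : C(X, Y)) {n : ℕ} (σ : C(stdSimplex ℝ (Fin (n + 1)), X)) :
    map f n (of σ) = of (f.comp σ) := by
  have := SSet.ι_chainComplexMap_f (f := TopCat.toSSet.map (TopCat.ofHom f))
    (R := ModuleCat.of ℚ ℚ)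
    (x := (TopCat.toSSetObjEquiv (TopCat.of X) (op ⦋n⦌)).symm σ)
  exact congrArg (fun g => g.hom (1 : ℚ)) this

section Affine

/-- The singular simplex obtained from `σ` and a tuple of points of its domain. -/
noncomputable def affineComp {n k : ℕ} (σ : C(stdSimplex ℝ (Fin (n + 1)), X))
    (w : Fin (k + 1) → stdSimplex ℝ (Fin (n + 1))) : C(stdSimplex ℝ (Fin (k + 1)), X) :=
  σ.comp ⟨stdSimplex.comb w, stdSimplex.continuous_comb w⟩

/-- The chain map from affine chains in the domain of `σ` to singular chains. -/
noncomputable def affine {n : ℕ} (σ : C(stdSimplex ℝ (Fin (n + 1)), X)) (k : ℕ) :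
    TupleChain (stdSimplex ℝ (Fin (n + 1))) (k + 1) →ₗ[ℚ] (singularChains X).X k :=
  Finsupp.linearCombination ℚ fun w => of (affineComp σ w)

lemma affine_single {n k : ℕ} (σ : C(stdSimplex ℝ (Fin (n + 1)), X))
    (w : Fin (k + 1) → stdSimplex ℝ (Fin (n + 1))) :
    affine σ k (Finsupp.single w 1) = of (affineComp σ w) := by
  simp [affine]

/-- The affine chain consisting of the standard simplex itself. -/
noncomputable def vertices (n : ℕ) : TupleChain (stdSimplex ℝ (Fin (n + 1))) (n + 1) :=
  Finsupp.single (fun i => stdSimplex.vertex i) 1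

lemma affine_vertices {n : ℕ} (σ : C(stdSimplex ℝ (Fin (n + 1)), X)) :
    affine σ n (vertices n) = of σ := by
  rw [vertices, affine_single]
  congr 1
  ext t
  simp [affineComp, stdSimplex.comb_vertex_self]

lemma d_affine {n k : ℕ} (σ : C(stdSimplex ℝ (Fin (n + 1)), X))
    (c : TupleChain (stdSimplex ℝ (Fin (n + 1))) (k + 2)) :
    d X (k + 1) k (affine σ (k + 1) c) = affine σ k (TupleChain.bd (k + 1) c) := by
  suffices d X (k + 1) k ∘ₗ affine σ (k + 1) = affine σ k ∘ₗ TupleChain.bd (k + 1) from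
    LinearMap.congr_fun this c
  refine TupleChain.hom_ext fun w => ?_
  simp only [LinearMap.comp_apply, affine_single, d_of, TupleChain.bd_single, map_sum, map_smul]
  refine Finset.sum_congr rfl fun i _ => ?_
  congr 2
  ext t
  simp only [affineComp, ContinuousMap.comp_apply, ContinuousMap.coe_mk]
  rw [← stdSimplex.comb_vertex_comp, stdSimplex.comb_comb]
  simp only [stdSimplex.comb_vertex]
  rfl

lemma affine_map {n m : ℕ} (σ : C(stdSimplex ℝ (Fin (n + 1)), X))
    (w : Fin (m + 1) → stdSimplex ℝ (Fin (n + 1))) (k : ℕ)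
    (c : TupleChain (stdSimplex ℝ (Fin (m + 1))) (k + 1)) :
    affine (affineComp σ w) k c = affine σ k (TupleChain.map (stdSimplex.comb w) (k + 1) c) := by
  suffices affine (affineComp σ w) k = affine σ k ∘ₗ TupleChain.map (stdSimplex.comb w) (k + 1) from
    LinearMap.congr_fun this c
  refine TupleChain.hom_ext fun v => ?_
  simp only [LinearMap.comp_apply, affine_single, TupleChain.map_single]
  congr 1
  ext t
  simp only [affineComp, ContinuousMap.comp_apply, ContinuousMap.coe_mk, stdSimplex.comb_comb]
  rfl

/-- This is the hypothesis of `TupleChain.map_sd` and `TupleChain.map_sdHomotopy`. -/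
lemma comb_bary {n m : ℕ} (w : Fin (m + 1) → stdSimplex ℝ (Fin (n + 1))) (k : ℕ)
    (v : Fin (k + 1) → stdSimplex ℝ (Fin (m + 1))) :
    stdSimplex.comb w (TupleChain.bary k v) = TupleChain.bary k (stdSimplex.comb w ∘ v) :=
  stdSimplex.comb_comb _ _ _

lemma map_comb_vertices {n m : ℕ} (w : Fin (m + 1) → stdSimplex ℝ (Fin (n + 1))) :
    TupleChain.map (stdSimplex.comb w) (m + 1) (vertices m) = Finsupp.single w 1 := by
  rw [vertices, TupleChain.map_single]
  congr 1
  funext i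
  exact stdSimplex.comb_vertex w i

end Affine

section Subdivision

open TupleChain (bary)

/-- Barycentric subdivision of singular chains. -/
noncomputable def sd (X : Type) [TopologicalSpace X] (n : ℕ) :
    (singularChains X).X n →ₗ[ℚ] (singularChains X).X n :=
  lift fun σ => affine σ n (TupleChain.sd bary (n + 1) (vertices n))

/-- The homotopy between the identity and barycentric subdivision. -/
noncomputable def sdHomotopy (X : Type) [TopologicalSpace X] (n : ℕ) :
    (singularChains X).X n →ₗ[ℚ] (singularChains X).X (n + 1) :=
  lift fun σ => affine σ (n + 1) (TupleChain.sdHomotopy bary (n + 1) (vertices n))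

/-- With `affine_vertices`, which writes a simplex as the image of the standard one, this transfers
identities of tuple chains to singular chains. -/
lemma sd_affine {n k : ℕ} (σ : C(stdSimplex ℝ (Fin (n + 1)), X))
    (c : TupleChain (stdSimplex ℝ (Fin (n + 1))) (k + 1)) :
    sd X k (affine σ k c) = affine σ k (TupleChain.sd bary (k + 1) c) := by
  suffices sd X k ∘ₗ affine σ k = affine σ k ∘ₗ TupleChain.sd bary (k + 1) from
    LinearMap.congr_fun this c
  refine TupleChain.hom_ext fun w => ?_
  simp only [LinearMap.comp_apply, affine_single, sd, lift_of, affine_map]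
  rw [TupleChain.map_sd (comb_bary w), map_comb_vertices]

lemma sdHomotopy_affine {n k : ℕ} (σ : C(stdSimplex ℝ (Fin (n + 1)), X))
    (c : TupleChain (stdSimplex ℝ (Fin (n + 1))) (k + 1)) :
    sdHomotopy X k (affine σ k c) =
      affine σ (k + 1) (TupleChain.sdHomotopy bary (k + 1) c) := by
  suffices sdHomotopy X k ∘ₗ affine σ k =
      affine σ (k + 1) ∘ₗ TupleChain.sdHomotopy bary (k + 1) from LinearMap.congr_fun this c
  refine TupleChain.hom_ext fun w => ?_
  simp only [LinearMap.comp_apply, affine_single, sdHomotopy, lift_of, affine_map]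
  rw [TupleChain.map_sdHomotopy (comb_bary w), map_comb_vertices]

lemma d_sd (i j : ℕ) (c : (singularChains X).X i) : d X i j (sd X i c) = sd X j (d X i j c) := by
  by_cases h : j + 1 = i
  · subst h
    suffices d X (j + 1) j ∘ₗ sd X (j + 1) = sd X j ∘ₗ d X (j + 1) j from LinearMap.congr_fun this c
    refine hom_ext fun σ => ?_
    simp only [LinearMap.comp_apply]
    rw [← affine_vertices σ, sd_affine, d_affine, d_affine, sd_affine, TupleChain.bd_sd]
  · simp [d_eq_zero h]

lemma d_sdHomotopy_zero (c : (singularChains X).X 0) :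
    d X 1 0 (sdHomotopy X 0 c) = c - sd X 0 c := by
  suffices d X 1 0 ∘ₗ sdHomotopy X 0 = LinearMap.id - sd X 0 from LinearMap.congr_fun this c
  refine hom_ext fun σ => ?_
  simp only [LinearMap.comp_apply, LinearMap.sub_apply, LinearMap.id_apply]
  rw [← affine_vertices σ, sdHomotopy_affine, d_affine, sd_affine, TupleChain.bd_sdHomotopy,
    TupleChain.sdHomotopy, LinearMap.zero_apply, sub_zero, map_sub]

lemma d_sdHomotopy_succ (n : ℕ) (c : (singularChains X).X (n + 1)) :
    d X (n + 2) (n + 1) (sdHomotopy X (n + 1) c) =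
      c - sd X (n + 1) c - sdHomotopy X n (d X (n + 1) n c) := by
  suffices d X (n + 2) (n + 1) ∘ₗ sdHomotopy X (n + 1) =
    LinearMap.id - sd X (n + 1) - sdHomotopy X n ∘ₗ d X (n + 1) n from LinearMap.congr_fun this c
  refine hom_ext fun σ => ?_
  simp only [LinearMap.comp_apply, LinearMap.sub_apply, LinearMap.id_apply]
  rw [← affine_vertices σ, sdHomotopy_affine, d_affine, sd_affine, TupleChain.bd_sdHomotopy,
    d_affine, sdHomotopy_affine, map_sub, map_sub]

end Subdivision

section Small

variable (𝒰 : Set (Set X))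

/-- The chains of singular simplices each of which lies in a member of the family `𝒰`. -/
noncomputable def small (n : ℕ) : Submodule ℚ ((singularChains X).X n) :=
  Submodule.span ℚ {c | ∃ σ : C(stdSimplex ℝ (Fin (n + 1)), X),
    (∃ U ∈ 𝒰, Set.range σ ⊆ U) ∧ of σ = c}

variable {𝒰}

lemma of_mem_small {n : ℕ} {σ : C(stdSimplex ℝ (Fin (n + 1)), X)} {U : Set X} (hU : U ∈ 𝒰)
    (h : Set.range σ ⊆ U) : of σ ∈ small 𝒰 n :=
  Submodule.subset_span ⟨σ, ⟨U, hU, h⟩, rfl⟩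

lemma affine_mem_small {n k : ℕ} {σ : C(stdSimplex ℝ (Fin (n + 1)), X)} {U : Set X} (hU : U ∈ 𝒰)
    (h : Set.range σ ⊆ U) (c : TupleChain (stdSimplex ℝ (Fin (n + 1))) (k + 1)) :
    affine σ k c ∈ small 𝒰 k := by
  have hc : c ∈ Finsupp.supported ℚ ℚ Set.univ := by simp
  refine TupleChain.apply_mem_of_mem_supported (fun w _ => ?_) hc
  rw [affine_single]
  refine of_mem_small hU ?_
  rintro _ ⟨t, rfl⟩
  exact h ⟨_, rfl⟩

lemma sd_mem_small {n : ℕ} {c : (singularChains X).X n} (hc : c ∈ small 𝒰 n) :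
    sd X n c ∈ small 𝒰 n := by
  suffices small 𝒰 n ≤ (small 𝒰 n).comap (sd X n) from this hc
  refine Submodule.span_le.2 ?_
  rintro _ ⟨σ, ⟨U, hU, h⟩, rfl⟩
  simp only [SetLike.mem_coe, Submodule.mem_comap, sd, lift_of]
  exact affine_mem_small hU h _

lemma sdHomotopy_mem_small {n : ℕ} {c : (singularChains X).X n} (hc : c ∈ small 𝒰 n) :
    sdHomotopy X n c ∈ small 𝒰 (n + 1) := by
  suffices small 𝒰 n ≤ (small 𝒰 (n + 1)).comap (sdHomotopy X n) from this hc
  refine Submodule.span_le.2 ?_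
  rintro _ ⟨σ, ⟨U, hU, h⟩, rfl⟩
  simp only [SetLike.mem_coe, Submodule.mem_comap, sdHomotopy, lift_of]
  exact affine_mem_small hU h _

lemma iterate_sd_mem_small_of_le {n : ℕ} {c : (singularChains X).X n} {m m' : ℕ} (h : m ≤ m')
    (hc : (sd X n)^[m] c ∈ small 𝒰 n) : (sd X n)^[m'] c ∈ small 𝒰 n := by
  induction h with
  | refl => exact hc
  | step _ ih => rw [Function.iterate_succ_apply']; exact sd_mem_small ih

/-- The pulled-back cover of the compact simplex has a Lebesgue number, and the diameters after `m`
subdivisions are at most `(n / (n + 1)) ^ m` times the original one. -/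
lemma exists_iterate_sd_of_mem_small (hopen : ∀ U ∈ 𝒰, IsOpen U) (hcover : ⋃₀ 𝒰 = Set.univ)
    {n : ℕ} (σ : C(stdSimplex ℝ (Fin (n + 1)), X)) :
    ∃ m, (sd X n)^[m] (of σ) ∈ small 𝒰 n := by
  obtain ⟨δ, hδ, h⟩ := lebesgue_number_lemma_of_metric_sUnion
    (s := (Set.univ : Set (stdSimplex ℝ (Fin (n + 1))))) (c := (σ ⁻¹' ·) '' 𝒰) isCompact_univ
    (by rintro _ ⟨U, hU, rfl⟩; exact (hopen U hU).preimage σ.continuous)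
    (by
      intro x _
      obtain ⟨U, hU, hx⟩ : σ x ∈ ⋃₀ 𝒰 := by rw [hcover]; trivial
      exact ⟨_, ⟨U, hU, rfl⟩, hx⟩)
  have hdiam : vertices n ∈ Finsupp.supported ℚ ℚ {w | ∀ i j, dist (w i) (w j) ≤
      Metric.diam (Set.univ : Set (stdSimplex ℝ (Fin (n + 1))))} :=
    TupleChain.single_mem_supported fun i j => Metric.dist_le_diam_of_mem
      isCompact_univ.isBounded trivial trivial
  have hlim : Filter.Tendsto (fun m : ℕ => (n / (n + 1) : ℝ) ^ m *
      Metric.diam (Set.univ : Set (stdSimplex ℝ (Fin (n + 1))))) Filter.atTop (nhds 0) := by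
    have := (tendsto_pow_atTop_nhds_zero_of_lt_one (r := (n / (n + 1) : ℝ)) (by positivity)
      (by rw [div_lt_one (by positivity)]; linarith)).mul_const
        (Metric.diam (Set.univ : Set (stdSimplex ℝ (Fin (n + 1)))))
    simpa using this
  obtain ⟨m, hm⟩ := (hlim.eventually (gt_mem_nhds hδ)).exists
  have hsd := TupleChain.iterate_sd_bary_mem_supported n m Metric.diam_nonneg hdiam
  have hiter : (sd X n)^[m] (of σ) =
      affine σ n ((TupleChain.sd TupleChain.bary (n + 1))^[m] (vertices n)) := by
    clear hsd hm
    induction m with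
    | zero => exact (affine_vertices σ).symm
    | succ m ih => rw [Function.iterate_succ_apply', ih, sd_affine, Function.iterate_succ_apply']
  refine ⟨m, hiter ▸ TupleChain.apply_mem_of_mem_supported (fun w hw => ?_) hsd⟩
  obtain ⟨_, ⟨U, hU, rfl⟩, hball⟩ := h (w 0) trivial
  rw [affine_single]
  refine of_mem_small hU ?_
  rintro _ ⟨t, rfl⟩
  exact hball ((stdSimplex.dist_comb_le (fun i => hw i 0) t).trans_lt hm)

lemma exists_iterate_sd_mem_small (hopen : ∀ U ∈ 𝒰, IsOpen U) (hcover : ⋃₀ 𝒰 = Set.univ)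
    {n : ℕ} (c : (singularChains X).X n) : ∃ m, (sd X n)^[m] c ∈ small 𝒰 n := by
  have hc : c ∈ Submodule.span ℚ (Set.range (of (X := X) (n := n))) := by
    rw [span_of]; trivial
  induction hc using Submodule.span_induction with
  | mem c hc =>
    obtain ⟨σ, rfl⟩ := hc
    exact exists_iterate_sd_of_mem_small hopen hcover σ
  | zero => exact ⟨0, Submodule.zero_mem _⟩
  | add a b _ _ ha hb =>
    obtain ⟨m, hm⟩ := ha
    obtain ⟨m', hm'⟩ := hb
    refine ⟨max m m', ?_⟩
    rw [iterate_map_add]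
    exact Submodule.add_mem _ (iterate_sd_mem_small_of_le (le_max_left _ _) hm)
      (iterate_sd_mem_small_of_le (le_max_right _ _) hm')
  | smul r a _ ha =>
    obtain ⟨m, hm⟩ := ha
    refine ⟨m, ?_⟩
    rw [← Module.End.pow_apply, map_smul, Module.End.pow_apply]
    exact Submodule.smul_mem _ _ hm

/-- Every relative cycle modulo small chains is homologous to a small chain. -/
lemma mem_small_sup_range_d (hopen : ∀ U ∈ 𝒰, IsOpen U) (hcover : ⋃₀ 𝒰 = Set.univ)
    {n : ℕ} (c : (singularChains X).X n) (hc : ∀ j, d X n j c ∈ small 𝒰 j) :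
    c ∈ small 𝒰 n ⊔ LinearMap.range (d X (n + 1) n) := by
  -- With `T` the homotopy, `c - sd c = T∂c + ∂Tc`, and `T` preserves small chains.
  have key : ∀ c : (singularChains X).X n, (∀ j, d X n j c ∈ small 𝒰 j) →
      c - sd X n c ∈ small 𝒰 n ⊔ LinearMap.range (d X (n + 1) n) := by
    intro c hc
    cases n with
    | zero =>
      rw [← d_sdHomotopy_zero]
      exact Submodule.mem_sup_right ⟨_, rfl⟩
    | succ n =>
      have h : c - sd X (n + 1) c = sdHomotopy X n (d X (n + 1) n c) +
          d X (n + 2) (n + 1) (sdHomotopy X (n + 1) c) := by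
        rw [d_sdHomotopy_succ]; abel
      exact h ▸ Submodule.add_mem_sup (sdHomotopy_mem_small (hc n)) ⟨_, rfl⟩
  obtain ⟨m, hm⟩ := exists_iterate_sd_mem_small hopen hcover c
  induction m generalizing c with
  | zero => exact Submodule.mem_sup_left hm
  | succ m ih =>
    -- The chain `sd c` is again a relative cycle and needs one subdivision fewer.
    rw [← sub_add_cancel c (sd X n c)]
    refine Submodule.add_mem _ (key c hc) (ih _ (fun j => ?_) hm)
    rw [d_sd]
    exact sd_mem_small (hc j)

end Small

end SingularChain

/-! ### Euler characteristics in long exact sequences -/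

/-- The graded vector space `H` has finite total dimension and Euler characteristic `χ`. -/
structure HasGradedEulerChar (H : ℕ → ModuleCat.{0} ℚ) (χ : ℤ) : Prop where
  finite : ∀ n, Module.Finite ℚ (H n)
  sum_eq : ∃ N, ∀ n, N ≤ n → Subsingleton (H n) ∧
    ∑ i ∈ Finset.range n, (-1) ^ i * (Module.finrank ℚ (H i) : ℤ) = χ

namespace HasGradedEulerChar

variable {A B C : ℕ → ModuleCat.{0} ℚ}

lemma of_iso {χ : ℤ} (h : HasGradedEulerChar A χ) (e : ∀ n, A n ≅ B n) :
    HasGradedEulerChar B χ where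
  finite n := by
    have := h.finite n
    exact Module.Finite.equiv (e n).toLinearEquiv
  sum_eq := by
    obtain ⟨N, hN⟩ := h.sum_eq
    refine ⟨N, fun n hn => ⟨?_, ?_⟩⟩
    · have := (hN n hn).1
      exact (e n).toLinearEquiv.symm.toEquiv.subsingleton
    · rw [← (hN n hn).2]
      exact Finset.sum_congr rfl fun i _ => by rw [(e i).toLinearEquiv.finrank_eq]

lemma of_subsingleton (h : ∀ n, Subsingleton (A n)) : HasGradedEulerChar A 0 where
  finite n := by have := h n; infer_instance
  sum_eq := ⟨0, fun n _ => ⟨h n, Finset.sum_eq_zero fun i _ => by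
    have := h i; simp [Module.finrank_zero_of_subsingleton]⟩⟩

end HasGradedEulerChar

lemma Function.Exact.finrank_eq {A B C : Type} [AddCommGroup A] [Module ℚ A] [AddCommGroup B]
    [Module ℚ B] [AddCommGroup C] [Module ℚ C] [Module.Finite ℚ B] {f : A →ₗ[ℚ] B} {g : B →ₗ[ℚ] C}
    (h : Function.Exact f g) :
    Module.finrank ℚ B = Module.finrank ℚ (LinearMap.range f) +
      Module.finrank ℚ (LinearMap.range g) := by
  rw [← LinearMap.finrank_range_add_finrank_ker g, LinearMap.exact_iff.1 h, add_comm]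

lemma Function.Exact.subsingleton {A B C : Type} [AddCommGroup A] [AddCommGroup B]
    [AddCommGroup C] [Subsingleton A] [Subsingleton C] {f : A →+ B} {g : B →+ C}
    (h : Function.Exact f g) : Subsingleton B := by
  refine subsingleton_of_forall_eq 0 fun b => ?_
  obtain ⟨a, rfl⟩ := (h b).1 (Subsingleton.elim _ _)
  rw [Subsingleton.elim a 0, map_zero]

lemma Function.Exact.finite {A B C : Type} [AddCommGroup A] [Module ℚ A] [AddCommGroup B]
    [Module ℚ B] [AddCommGroup C] [Module ℚ C] [Module.Finite ℚ A] [Module.Finite ℚ C]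
    {f : A →ₗ[ℚ] B} {g : B →ₗ[ℚ] C} (h : Function.Exact f g) : Module.Finite ℚ B := by
  refine Module.Finite.of_exact (f := f) (g := g.rangeRestrict) ?_ g.surjective_rangeRestrict
  rw [LinearMap.exact_iff, LinearMap.ker_rangeRestrict, LinearMap.exact_iff.1 h]

/-- A long exact sequence of vector spaces. -/
structure LongExact (A B C : ℕ → ModuleCat.{0} ℚ) where
  /-- the maps `A n → B n` -/
  f : ∀ n, A n →ₗ[ℚ] B n
  /-- the maps `B n → C n` -/
  g : ∀ n, B n →ₗ[ℚ] C n
  /-- the connecting maps -/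
  δ : ∀ n, C (n + 1) →ₗ[ℚ] A n
  exact_δ_f : ∀ n, Function.Exact (δ n) (f n)
  exact_f_g : ∀ n, Function.Exact (f n) (g n)
  exact_g_δ : ∀ n, Function.Exact (g (n + 1)) (δ n)
  surjective : Function.Surjective (g 0)

namespace LongExact

variable {A B C : ℕ → ModuleCat.{0} ℚ}

/-- Each dimension is the sum of the ranks of the incoming and outgoing maps; the alternating sums
cancel except for the last connecting map, cut off by the truncation. -/
lemma sum_finrank (L : LongExact A B C) (hA : ∀ n, Module.Finite ℚ (A n))
    (hB : ∀ n, Module.Finite ℚ (B n)) (hC : ∀ n, Module.Finite ℚ (C n)) (n : ℕ) :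
    ∑ i ∈ Finset.range (n + 1), (-1) ^ i * (Module.finrank ℚ (B i) : ℤ) =
      ∑ i ∈ Finset.range (n + 1), (-1) ^ i * (Module.finrank ℚ (A i) : ℤ) +
      ∑ i ∈ Finset.range (n + 1), (-1) ^ i * (Module.finrank ℚ (C i) : ℤ) -
      (-1) ^ n * (Module.finrank ℚ (LinearMap.range (L.δ n)) : ℤ) := by
  have eA := fun i => (L.exact_δ_f i).finrank_eq
  have eB := fun i => (L.exact_f_g i).finrank_eq
  have eC := fun i => (L.exact_g_δ i).finrank_eq
  have e0 : Module.finrank ℚ (LinearMap.range (L.g 0)) = Module.finrank ℚ (C 0) := by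
    rw [LinearMap.range_eq_top.2 L.surjective, finrank_top]
  induction n with
  | zero =>
    simp only [zero_add, Finset.range_one, Finset.sum_singleton, pow_zero, one_mul, eA, eB, ← e0]
    push_cast
    ring
  | succ n ih =>
    rw [Finset.sum_range_succ, ih, Finset.sum_range_succ _ (n + 1),
      Finset.sum_range_succ (fun i => (-1) ^ i * (Module.finrank ℚ (C i) : ℤ)) (n + 1),
      eA (n + 1), eB (n + 1), eC n]
    push_cast
    ring

lemma hasGradedEulerChar_right (L : LongExact A B C) {a b : ℤ} (hA : HasGradedEulerChar A a)
    (hB : HasGradedEulerChar B b) : HasGradedEulerChar C (b - a) := by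
  have := hA.finite
  have := hB.finite
  have hC : ∀ n, Module.Finite ℚ (C n)
    | 0 => Module.Finite.of_surjective (L.g 0) L.surjective
    | n + 1 => (L.exact_g_δ n).finite
  refine ⟨hC, ?_⟩
  obtain ⟨N, hN⟩ := hA.sum_eq
  obtain ⟨M, hM⟩ := hB.sum_eq
  -- The extra one is needed because `C (n + 1)` lies between `B (n + 1)` and `A n`; vanishing of `A
  -- n` also kills the rank of `δ n`.
  refine ⟨max N M + 1, fun n hn => ?_⟩
  obtain ⟨n, rfl⟩ : ∃ m, n = m + 1 := ⟨n - 1, by omega⟩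
  have h1 := hN n (by omega)
  have h2 := hM (n + 1) (by omega)
  have h3 := hN (n + 1) (by omega)
  have := h1.1
  have := h2.1
  refine ⟨Function.Exact.subsingleton (f := (L.g (n + 1)).toAddMonoidHom)
    (g := (L.δ n).toAddMonoidHom) (L.exact_g_δ n), ?_⟩
  have h := L.sum_finrank hA.finite hB.finite hC n
  rw [h2.2, h3.2, Module.finrank_zero_of_subsingleton] at h
  rw [h]
  simp

lemma hasGradedEulerChar_middle (L : LongExact A B C) {a c : ℤ} (hA : HasGradedEulerChar A a)
    (hC : HasGradedEulerChar C c) : HasGradedEulerChar B (a + c) := by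
  have := hA.finite
  have := hC.finite
  have hB : ∀ n, Module.Finite ℚ (B n) := fun n => (L.exact_f_g n).finite
  refine ⟨hB, ?_⟩
  obtain ⟨N, hN⟩ := hA.sum_eq
  obtain ⟨M, hM⟩ := hC.sum_eq
  refine ⟨max N M + 1, fun n hn => ?_⟩
  obtain ⟨n, rfl⟩ : ∃ m, n = m + 1 := ⟨n - 1, by omega⟩
  have h1 := hN n (by omega)
  have h2 := hM (n + 1) (by omega)
  have h3 := hN (n + 1) (by omega)
  have := h1.1
  have := h2.1
  have := h3.1
  refine ⟨Function.Exact.subsingleton (f := (L.f (n + 1)).toAddMonoidHom)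
    (g := (L.g (n + 1)).toAddMonoidHom) (L.exact_f_g (n + 1)), ?_⟩
  rw [L.sum_finrank hA.finite hB hC.finite n, h2.2, h3.2, Module.finrank_zero_of_subsingleton]
  simp

end LongExact

/-- The long exact homology sequence of a short exact sequence of chain complexes. -/
noncomputable def CategoryTheory.ShortComplex.ShortExact.longExact
    {S : ShortComplex (ChainComplex (ModuleCat.{0} ℚ) ℕ)} (hS : S.ShortExact) :
    LongExact (fun n => S.X₁.homology n) (fun n => S.X₂.homology n) (fun n => S.X₃.homology n) where
  f n := (HomologicalComplex.homologyMap S.f n).hom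
  g n := (HomologicalComplex.homologyMap S.g n).hom
  δ n := (hS.δ (n + 1) n rfl).hom
  exact_δ_f n := (ShortComplex.ShortExact.moduleCat_exact_iff_function_exact _).1
    (hS.homology_exact₁ (n + 1) n rfl)
  exact_f_g n := (ShortComplex.ShortExact.moduleCat_exact_iff_function_exact _).1
    (hS.homology_exact₂ n)
  exact_g_δ n := (ShortComplex.ShortExact.moduleCat_exact_iff_function_exact _).1
    (hS.homology_exact₃ (n + 1) n rfl)
  surjective := by
    have := hS.epi_g
    have : Epi (HomologicalComplex.homologyMap S.g 0) :=
      HomologicalComplex.epi_homologyMap_of_epi_of_not_rel S.g 0 (by simp)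
    exact (ModuleCat.epi_iff_surjective _).1 this

/-- Replaces the sum over the support by all sufficiently long partial sums, the form that truncated
exact sequences can handle. -/
lemma hasEulerCharacteristic_iff {X : Type} [TopologicalSpace X] {χ : ℤ} :
    HasEulerCharacteristic X χ ↔
      HasGradedEulerChar (fun n => (singularChains X).homology n) χ := by
  have sum : ∀ n, (∀ m, n ≤ m → Subsingleton ((singularChains X).homology m)) →
      (singularChains X).homologyEulerChar = ∑ i ∈ Finset.range n,
        (-1) ^ i * (Module.finrank ℚ ((singularChains X).homology i) : ℤ) := by
    intro n hn
    rw [HomologicalComplex.homologyEulerChar_eq_sum_finSet_of_finrankSupport_subset _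
      (Finset.range n)]
    · refine Finset.sum_congr rfl fun i _ => ?_
      simp
    · rw [GradedObject.finrankSupport_subset_iff]
      intro i hi
      have := hn i (by simpa using hi)
      exact Module.finrank_zero_of_subsingleton
  constructor
  · intro h
    obtain ⟨N, hN⟩ := h.bounded
    exact ⟨h.finite, N, fun n hn =>
      ⟨hN n hn, by rw [← h.eq, sum n fun m hm => hN m (hn.trans hm)]⟩⟩
  · intro h
    obtain ⟨N, hN⟩ := h.sum_eq
    exact ⟨h.finite, ⟨N, fun n hn => (hN n hn).1⟩, by
      rw [sum N fun n hn => (hN n hn).1, (hN N le_rfl).2]⟩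

/-! ### Quotients of chain complexes and chains of subspaces -/

section Cokernel

open Limits

variable {K L : ChainComplex (ModuleCat.{0} ℚ) ℕ} (f : K ⟶ L)

lemma cokernel_shortExact [Mono f] :
    (ShortComplex.mk f (cokernel.π f) (cokernel.condition f)).ShortExact where
  exact := ShortComplex.exact_cokernel f

lemma cokernel_π_surjective (n : ℕ) : Function.Surjective ((cokernel.π f).f n).hom :=
  (ModuleCat.epi_iff_surjective _).1 inferInstance

lemma cokernel_π_eq_zero_iff (n : ℕ) (x : L.X n) :
    ((cokernel.π f).f n).hom x = 0 ↔ ∃ y, (f.f n).hom y = x := by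
  have h := (HomologicalComplex.exact_iff_degreewise_exact _).1 (ShortComplex.exact_cokernel f) n
  exact ((ShortComplex.ShortExact.moduleCat_exact_iff_function_exact _).1 h) x

end Cokernel

namespace SingularChain

section Restrict

open Classical in
/-- The linear map that discards the singular simplices that are not contained in `A`. -/
noncomputable def restrict {X : Type} [TopologicalSpace X] (A : Set X) (n : ℕ) :
    (singularChains X).X n →ₗ[ℚ] (singularChains A).X n :=
  lift fun σ => if h : ∀ t, σ t ∈ A then of ⟨fun t => ⟨σ t, h t⟩, by fun_prop⟩ else 0

variable {X : Type} [TopologicalSpace X]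

/-- The inclusion of a subspace. -/
def incl (A : Set X) : C(A, X) := ⟨Subtype.val, continuous_subtype_val⟩

lemma restrict_map_incl (A : Set X) (n : ℕ) (c : (singularChains A).X n) :
    restrict A n (map (incl A) n c) = c := by
  suffices restrict A n ∘ₗ map (incl A) n = LinearMap.id from LinearMap.congr_fun this c
  refine hom_ext fun σ => ?_
  have h : ∀ t, (incl A).comp σ t ∈ A := fun t => (σ t).2
  simp only [LinearMap.comp_apply, map_of, restrict, lift_of, LinearMap.id_apply, dif_pos h]
  rfl

lemma map_incl_injective (A : Set X) (n : ℕ) : Function.Injective (map (incl A) n) :=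
  Function.LeftInverse.injective (restrict_map_incl A n)

/-- The inclusion of a subspace in a larger one. -/
def inclusion {A B : Set X} (h : A ⊆ B) : C(A, B) := ⟨Set.inclusion h, continuous_inclusion h⟩

lemma map_comp_apply {Y Z : Type} [TopologicalSpace Y] [TopologicalSpace Z] (f : C(X, Y))
    (g : C(Y, Z)) (n : ℕ) (c : (singularChains X).X n) :
    map g n (map f n c) = map (g.comp f) n c := by
  suffices map g n ∘ₗ map f n = map (g.comp f) n from LinearMap.congr_fun this c
  refine hom_ext fun σ => ?_
  simp only [LinearMap.comp_apply, map_of, ContinuousMap.comp_assoc]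

lemma map_incl_inclusion {A B : Set X} (h : A ⊆ B) (n : ℕ) (c : (singularChains A).X n) :
    map (incl B) n (map (inclusion h) n c) = map (incl A) n c :=
  map_comp_apply _ _ _ _

lemma map_inclusion_injective {A B : Set X} (h : A ⊆ B) (n : ℕ) :
    Function.Injective (map (inclusion h) n) := by
  intro a b hab
  refine map_incl_injective A n ?_
  rw [← map_incl_inclusion h, hab, map_incl_inclusion]

lemma map_inclusion_restrict (U V : Set X) (n : ℕ) (c : (singularChains U).X n) :
    map (inclusion (Set.inter_subset_right : U ∩ V ⊆ V)) n
      (restrict (U ∩ V) n (map (incl U) n c)) = restrict V n (map (incl U) n c) := by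
  suffices map (inclusion (Set.inter_subset_right : U ∩ V ⊆ V)) n ∘ₗ restrict (U ∩ V) n ∘ₗ
    map (incl U) n = restrict V n ∘ₗ map (incl U) n from LinearMap.congr_fun this c
  refine hom_ext fun σ => ?_
  simp only [LinearMap.comp_apply, map_of, restrict, lift_of]
  by_cases h : ∀ t, (incl U).comp σ t ∈ V
  · have h' : ∀ t, (incl U).comp σ t ∈ U ∩ V := fun t => ⟨(σ t).2, h t⟩
    rw [dif_pos h, dif_pos h', map_of]
    rfl
  · have h' : ¬ ∀ t, (incl U).comp σ t ∈ U ∩ V := fun h' => h fun t => (h' t).2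
    rw [dif_neg h, dif_neg h', map_zero]

/-- Discarding the simplices outside `V` fixes a chain of `V` and sends a chain of `U` to a chain of
`U ∩ V`. Only a degreewise retraction is needed, so it does not matter that `restrict` need not
commute with the differential. -/
lemma exists_map_inclusion_eq {U V : Set X} {n : ℕ} {a : (singularChains U).X n}
    {b : (singularChains V).X n} (h : map (incl U) n a = map (incl V) n b) :
    ∃ c, map (inclusion (Set.inter_subset_right : U ∩ V ⊆ V)) n c = b :=
  ⟨restrict (U ∩ V) n (map (incl U) n a), by
    rw [map_inclusion_restrict, h, restrict_map_incl]⟩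

lemma exists_of_mem_small {U V : Set X} {n : ℕ} {c : (singularChains X).X n}
    (hc : c ∈ small {U, V} n) : ∃ a b, map (incl U) n a + map (incl V) n b = c := by
  suffices small {U, V} n ≤ LinearMap.range (map (incl U) n) ⊔ LinearMap.range (map (incl V) n) by
    obtain ⟨_, ⟨a, rfl⟩, _, ⟨b, rfl⟩, h⟩ := Submodule.mem_sup.1 (this hc)
    exact ⟨a, b, h⟩
  have key : ∀ (A : Set X) (σ : C(stdSimplex ℝ (Fin (n + 1)), X)), Set.range σ ⊆ A →
      of σ ∈ LinearMap.range (map (incl A) n) := fun A σ h =>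
    ⟨of ⟨fun t => ⟨σ t, h ⟨t, rfl⟩⟩, by fun_prop⟩, by rw [map_of]; rfl⟩
  refine Submodule.span_le.2 ?_
  rintro _ ⟨σ, ⟨W, hW | hW, h⟩, rfl⟩
  · subst hW
    exact Submodule.mem_sup_left (key _ σ h)
  · obtain rfl : W = V := hW
    exact Submodule.mem_sup_right (key _ σ h)

lemma map_incl_mem_small {A : Set X} {𝒰 : Set (Set X)} (hA : A ∈ 𝒰) (n : ℕ)
    (c : (singularChains A).X n) : map (incl A) n c ∈ small 𝒰 n := by
  have hc : c ∈ Submodule.span ℚ (Set.range (of (X := A) (n := n))) := by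
    rw [span_of]; trivial
  suffices Submodule.span ℚ (Set.range (of (X := A) (n := n))) ≤
    (small 𝒰 n).comap (map (incl A) n) from this hc
  refine Submodule.span_le.2 ?_
  rintro _ ⟨σ, rfl⟩
  simp only [SetLike.mem_coe, Submodule.mem_comap, map_of]
  refine of_mem_small hA ?_
  rintro _ ⟨t, rfl⟩
  exact (σ t).2

end Restrict

section Complex

variable {X Y Z : Type} [TopologicalSpace X] [TopologicalSpace Y] [TopologicalSpace Z]

/-- The chain map induced by a continuous map. -/
noncomputable abbrev chainMap (f : C(X, Y)) : singularChains X ⟶ singularChains Y :=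
  ((AlgebraicTopology.singularChainComplexFunctor (ModuleCat.{0} ℚ)).obj
    (ModuleCat.of ℚ ℚ)).map (TopCat.ofHom f)

lemma mono_chainMap {f : C(X, Y)} (h : ∀ n, Function.Injective (map f n)) : Mono (chainMap f) :=
  HomologicalComplex.mono_of_mono_f _ fun n => (ModuleCat.mono_iff_injective _).2 (h n)

lemma chainMap_comp (f : C(X, Y)) (g : C(Y, Z)) :
    chainMap f ≫ chainMap g = chainMap (g.comp f) :=
  (((AlgebraicTopology.singularChainComplexFunctor (ModuleCat.{0} ℚ)).obj
    (ModuleCat.of ℚ ℚ)).map_comp (TopCat.ofHom f) (TopCat.ofHom g)).symm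

end Complex

end SingularChain

open SingularChain Limits

/-! ### Excision and Mayer–Vietoris -/

section MayerVietoris

variable {X : Type} [TopologicalSpace X] (U V : Set X)

/-- The map `C(V) / C(U ∩ V) ⟶ C(X) / C(U)` of relative singular chain complexes. -/
noncomputable def excisionMap :
    cokernel (chainMap (inclusion (Set.inter_subset_right : U ∩ V ⊆ V))) ⟶
      cokernel (chainMap (incl U)) :=
  cokernel.map _ _ (chainMap (inclusion (Set.inter_subset_left : U ∩ V ⊆ U)))
    (chainMap (incl V)) (by rw [chainMap_comp, chainMap_comp]; rfl)

lemma excisionMap_π (n : ℕ) (b : (singularChains V).X n) :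
    ((excisionMap U V).f n).hom (((cokernel.π (chainMap (inclusion
      (Set.inter_subset_right : U ∩ V ⊆ V)))).f n).hom b) =
    ((cokernel.π (chainMap (incl U))).f n).hom (map (incl V) n b) := by
  have h : cokernel.π (chainMap (inclusion (Set.inter_subset_right : U ∩ V ⊆ V))) ≫
      excisionMap U V = chainMap (incl V) ≫ cokernel.π (chainMap (incl U)) := cokernel.π_desc _ _ _
  exact congrArg (fun φ => (φ.f n).hom b) h

/-- A chain of `V` that is also a chain of `U` comes from `U ∩ V`. -/
instance : Mono (excisionMap U V) := by
  refine HomologicalComplex.mono_of_mono_f _ fun n => (ModuleCat.mono_iff_injective _).2 ?_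
  refine (injective_iff_map_eq_zero ((excisionMap U V).f n).hom).2 fun x hx => ?_
  obtain ⟨b, rfl⟩ := cokernel_π_surjective _ n x
  rw [excisionMap_π, cokernel_π_eq_zero_iff] at hx
  obtain ⟨a, ha⟩ := hx
  exact (cokernel_π_eq_zero_iff _ n b).2 (exists_map_inclusion_eq ha)

variable {U V}

/-- The cokernel is the complex of all chains modulo small chains: `q` is the quotient map and
`hker` computes its kernel. Exactness is then `mem_small_sup_range_d`. -/
lemma exactAt_cokernel_excisionMap (hU : IsOpen U) (hV : IsOpen V) (h : U ∪ V = Set.univ) (n : ℕ) :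
    (cokernel (excisionMap U V)).ExactAt n := by
  have hcover : ⋃₀ {U, V} = Set.univ := by rw [Set.sUnion_pair, h]
  have hopen : ∀ W ∈ ({U, V} : Set (Set X)), IsOpen W := by
    rintro W (rfl | rfl) <;> assumption
  let q := fun n => ((cokernel.π (excisionMap U V)).f n).hom ∘ₗ
    ((cokernel.π (chainMap (incl U))).f n).hom
  have hq : ∀ n, Function.Surjective (q n) := fun n =>
    (cokernel_π_surjective _ n).comp (cokernel_π_surjective _ n)
  have hker : ∀ n c, q n c = 0 ↔ c ∈ small {U, V} n := by
    intro n c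
    simp only [q, LinearMap.comp_apply, cokernel_π_eq_zero_iff]
    constructor
    · rintro ⟨y, hy⟩
      obtain ⟨b, rfl⟩ := cokernel_π_surjective _ n y
      rw [excisionMap_π, eq_comm, ← sub_eq_zero, ← map_sub, cokernel_π_eq_zero_iff] at hy
      obtain ⟨a, ha⟩ := hy
      have : c = map (incl U) n a + map (incl V) n b := by
        change map (incl U) n a = _ at ha
        rw [ha]; abel
      rw [this]
      exact Submodule.add_mem _ (map_incl_mem_small (by simp) _ _)
        (map_incl_mem_small (by simp) _ _)
    · intro hc
      obtain ⟨a, b, rfl⟩ := exists_of_mem_small hc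
      refine ⟨((cokernel.π (chainMap (inclusion
        (Set.inter_subset_right : U ∩ V ⊆ V)))).f n).hom b, ?_⟩
      have ha := (cokernel_π_eq_zero_iff (chainMap (incl U)) n (map (incl U) n a)).2 ⟨a, rfl⟩
      rw [excisionMap_π, map_add, ha, zero_add]
  have hd : ∀ i j c, ((cokernel (excisionMap U V)).d i j).hom (q i c) = q j (d X i j c) := by
    intro i j c
    have := congrArg (fun φ => φ.hom c)
      ((cokernel.π (chainMap (incl U)) ≫ cokernel.π (excisionMap U V)).comm i j)
    exact this
  rw [HomologicalComplex.exactAt_iff' _ (n + 1) n ((ComplexShape.down ℕ).next n) (by simp) rfl,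
    ShortComplex.moduleCat_exact_iff]
  intro x hx
  obtain ⟨c, rfl⟩ := hq n x
  have hx' : q _ (d X n ((ComplexShape.down ℕ).next n) c) = 0 := (hd _ _ c).symm.trans hx
  have hc : ∀ j, d X n j c ∈ small {U, V} j := by
    intro j
    by_cases hj : j + 1 = n
    · have : (ComplexShape.down ℕ).next n = j := (ComplexShape.down ℕ).next_eq' hj
      rw [this] at hx'
      exact (hker _ _).1 hx'
    · rw [d_eq_zero hj]
      exact Submodule.zero_mem _
  obtain ⟨s, hs, _, ⟨b, rfl⟩, rfl⟩ := Submodule.mem_sup.1 (mem_small_sup_range_d hopen hcover c hc)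
  refine ⟨q _ b, ?_⟩
  rw [map_add, (hker _ _).2 hs, zero_add]
  exact hd _ _ b

/-- The Euler characteristic of the union of two open subspaces. -/
theorem HasEulerCharacteristic.of_isOpen_cover (hU : IsOpen U) (hV : IsOpen V)
    (h : U ∪ V = Set.univ) {a b c : ℤ} (ha : HasEulerCharacteristic U a)
    (hb : HasEulerCharacteristic V b) (hc : HasEulerCharacteristic ↥(U ∩ V) c) :
    HasEulerCharacteristic X (a + b - c) := by
  rw [hasEulerCharacteristic_iff] at *
  have := mono_chainMap (map_inclusion_injective (Set.inter_subset_right : U ∩ V ⊆ V))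
  have := mono_chainMap (map_incl_injective U)
  -- The Euler characteristic is `b - c` for `C(V) / C(U ∩ V)`, the same for `C(X) / C(U)` because
  -- the excision map has acyclic cokernel, and hence `a + (b - c)` for `C(X)`.
  have h1 := (cokernel_shortExact (chainMap (inclusion
    (Set.inter_subset_right : U ∩ V ⊆ V)))).longExact.hasGradedEulerChar_right hc hb
  have h3 : HasGradedEulerChar (fun n => (cokernel (excisionMap U V)).homology n) 0 :=
    HasGradedEulerChar.of_subsingleton fun n => ModuleCat.subsingleton_of_isZero
      (exactAt_cokernel_excisionMap hU hV h n).isZero_homology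
  have h2 := (cokernel_shortExact (excisionMap U V)).longExact.hasGradedEulerChar_middle h1 h3
  have h4 := (cokernel_shortExact (chainMap (incl U))).longExact.hasGradedEulerChar_middle ha h2
  convert h4 using 1
  ring

end MayerVietoris

/-! ### Homotopy invariance, the empty space and the point -/

section HomotopyInvariance

variable {X Y : Type} [TopologicalSpace X] [TopologicalSpace Y]

/-- Homotopic maps induce homotopic chain maps. -/
noncomputable def chainHomotopy {f g : C(X, Y)} (H : f.Homotopy g) :
    Homotopy (chainMap f) (chainMap g) :=
  TopCat.Homotopy.singularChainComplexFunctorObjMap (f := TopCat.ofHom f) (g := TopCat.ofHom g) H _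

lemma chainMap_id : chainMap (ContinuousMap.id X) = 𝟙 (singularChains X) :=
  ((AlgebraicTopology.singularChainComplexFunctor (ModuleCat.{0} ℚ)).obj
    (ModuleCat.of ℚ ℚ)).map_id (TopCat.of X)

open ContinuousMap in
/-- Homotopy equivalent spaces have the same singular homology. -/
noncomputable def homologyIsoOfHomotopyEquiv (e : X ≃ₕ Y) (n : ℕ) :
    (singularChains X).homology n ≅ (singularChains Y).homology n :=
  HomotopyEquiv.toHomologyIso
    { hom := chainMap e.toFun
      inv := chainMap e.invFun
      homotopyHomInvId := (Homotopy.ofEq (chainMap_comp _ _)).trans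
        ((chainHomotopy e.left_inv.some).trans (Homotopy.ofEq chainMap_id))
      homotopyInvHomId := (Homotopy.ofEq (chainMap_comp _ _)).trans
        ((chainHomotopy e.right_inv.some).trans (Homotopy.ofEq chainMap_id)) } n

open ContinuousMap in
lemma HasEulerCharacteristic.of_homotopyEquiv {χ : ℤ} (h : HasEulerCharacteristic X χ)
    (e : X ≃ₕ Y) : HasEulerCharacteristic Y χ := by
  rw [hasEulerCharacteristic_iff] at *
  exact h.of_iso (homologyIsoOfHomotopyEquiv e)

lemma HasEulerCharacteristic.of_homeomorph {χ : ℤ} (h : HasEulerCharacteristic X χ)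
    (e : X ≃ₜ Y) : HasEulerCharacteristic Y χ :=
  h.of_homotopyEquiv e.toHomotopyEquiv

lemma hasEulerCharacteristic_of_isEmpty [IsEmpty X] : HasEulerCharacteristic X 0 := by
  rw [hasEulerCharacteristic_iff]
  refine HasGradedEulerChar.of_subsingleton fun n => ModuleCat.subsingleton_of_isZero ?_
  have : Subsingleton ((singularChains X).X n) := by
    have h : (LinearMap.id : (singularChains X).X n →ₗ[ℚ] _) = 0 :=
      SingularChain.hom_ext fun σ => isEmptyElim (σ (stdSimplex.vertex 0))
    exact subsingleton_of_forall_eq 0 fun c => LinearMap.congr_fun h c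
  have hz : IsZero ((singularChains X).X n) := ModuleCat.isZero_of_subsingleton _
  exact ((HomologicalComplex.exactAt_iff (singularChains X) n).2
    (ShortComplex.exact_of_isZero_X₂ _ hz)).isZero_homology

lemma hasEulerCharacteristic_unit : HasEulerCharacteristic Unit 1 := by
  rw [hasEulerCharacteristic_iff]
  have h0 : Nonempty ((singularChains Unit).homology 0 ≅ ModuleCat.of ℚ ℚ) :=
    ⟨AlgebraicTopology.singularHomologyFunctorZeroOfTotallyDisconnectedSpace
      (ModuleCat.{0} ℚ) (ModuleCat.of ℚ ℚ) (TopCat.of Unit) ≪≫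
        coproductUniqueIso (β := TopCat.of Unit) (fun _ => ModuleCat.of ℚ ℚ)⟩
  have h1 : ∀ n, n ≠ 0 → Subsingleton ((singularChains Unit).homology n) := fun n hn =>
    ModuleCat.subsingleton_of_isZero
      (AlgebraicTopology.isZero_singularHomologyFunctor_of_totallyDisconnectedSpace
        (ModuleCat.{0} ℚ) n (ModuleCat.of ℚ ℚ) (TopCat.of Unit) hn)
  obtain ⟨e⟩ := h0
  refine ⟨fun n => ?_, 1, fun n hn => ⟨h1 n (by omega), ?_⟩⟩
  · rcases eq_or_ne n 0 with rfl | hn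
    · exact Module.Finite.equiv (M := ℚ) e.symm.toLinearEquiv
    · have := h1 n hn
      infer_instance
  · rw [Finset.sum_eq_single 0]
    · rw [e.toLinearEquiv.finrank_eq]
      simp
    · intro i _ hi
      have := h1 i hi
      simp [Module.finrank_zero_of_subsingleton]
    · intro h
      simp at h
      omega

end HomotopyInvariance

/-! ### Finiteness of homology under products and covers -/

/-- The space `X` has a well-defined Euler characteristic. -/
def FiniteHomology (X : Type) [TopologicalSpace X] : Prop :=
  ∃ χ, HasEulerCharacteristic X χ

/-- Products with the space `Z` preserve finiteness of the homology. -/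
def StablyFiniteHomology (Z : Type) [TopologicalSpace Z] : Prop :=
  ∀ (Y : Type) [TopologicalSpace Y], FiniteHomology Y → FiniteHomology (Z × Y)

section Finite

variable {X Y Z : Type} [TopologicalSpace X] [TopologicalSpace Y] [TopologicalSpace Z]

lemma FiniteHomology.of_homeomorph (h : FiniteHomology X) (e : X ≃ₜ Y) : FiniteHomology Y :=
  h.imp fun _ h => h.of_homeomorph e

lemma FiniteHomology.of_isOpen_cover {U V : Set X} (hU : IsOpen U) (hV : IsOpen V)
    (h : U ∪ V = Set.univ) (ha : FiniteHomology U) (hb : FiniteHomology V)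
    (hc : FiniteHomology ↥(U ∩ V)) : FiniteHomology X := by
  obtain ⟨a, ha⟩ := ha
  obtain ⟨b, hb⟩ := hb
  obtain ⟨c, hc⟩ := hc
  exact ⟨_, HasEulerCharacteristic.of_isOpen_cover hU hV h ha hb hc⟩

open ContinuousMap in
lemma exists_homotopyEquiv_prod_of_contractible [ContractibleSpace Z] : Nonempty (Y ≃ₕ Z × Y) := by
  obtain ⟨e⟩ := ContractibleSpace.hequiv_unit Z
  exact ⟨(Homeomorph.punitProd Y).symm.toHomotopyEquiv.trans
    (e.symm.prodCongr (ContinuousMap.HomotopyEquiv.refl Y))⟩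

lemma HasEulerCharacteristic.prod_of_contractible [ContractibleSpace Z] {χ : ℤ}
    (h : HasEulerCharacteristic Y χ) : HasEulerCharacteristic (Z × Y) χ :=
  h.of_homotopyEquiv exists_homotopyEquiv_prod_of_contractible.some

namespace StablyFiniteHomology

lemma finiteHomology (h : StablyFiniteHomology Z) : FiniteHomology Z :=
  (h Unit ⟨1, hasEulerCharacteristic_unit⟩).of_homeomorph (Homeomorph.prodPUnit Z)

lemma of_homeomorph (h : StablyFiniteHomology X) (e : X ≃ₜ Y) : StablyFiniteHomology Y :=
  fun W _ hW => (h W hW).of_homeomorph (e.prodCongr (Homeomorph.refl W))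

lemma prod (hX : StablyFiniteHomology X) (hY : StablyFiniteHomology Y) :
    StablyFiniteHomology (X × Y) :=
  fun W _ hW => (hX _ (hY W hW)).of_homeomorph (Homeomorph.prodAssoc X Y W).symm

lemma of_contractible [ContractibleSpace Z] : StablyFiniteHomology Z :=
  fun _ _ ⟨χ, h⟩ => ⟨χ, h.prod_of_contractible⟩

/-- The part of a product over a subset of the first factor. -/
def preimageFstHomeomorph (U : Set Z) (Y : Type) [TopologicalSpace Y] :
    U × Y ≃ₜ ↥(Prod.fst ⁻¹' U : Set (Z × Y)) where
  toFun p := ⟨(p.1, p.2), p.1.2⟩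
  invFun p := (⟨p.1.1, p.2⟩, p.1.2)
  left_inv _ := rfl
  right_inv _ := rfl
  continuous_toFun := by fun_prop
  continuous_invFun := by fun_prop

lemma of_isOpen_cover {U V : Set Z} (hU : IsOpen U) (hV : IsOpen V)
    (h : U ∪ V = Set.univ) (ha : StablyFiniteHomology U) (hb : StablyFiniteHomology V)
    (hc : StablyFiniteHomology ↥(U ∩ V)) : StablyFiniteHomology Z := by
  intro Y _ hY
  refine FiniteHomology.of_isOpen_cover (hU.preimage continuous_fst) (hV.preimage continuous_fst)
    (by rw [← Set.preimage_union, h, Set.preimage_univ])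
    ((ha Y hY).of_homeomorph (preimageFstHomeomorph U Y))
    ((hb Y hY).of_homeomorph (preimageFstHomeomorph V Y))
    ((hc Y hY).of_homeomorph (preimageFstHomeomorph (U ∩ V) Y))

end StablyFiniteHomology

end Finite

/-! ### Trivial bundles over subsets of the base -/

section Trivialization

variable {X B F : Type} [TopologicalSpace X] [TopologicalSpace B] [TopologicalSpace F]

/-- The map `φ` is a trivial bundle with fibre `F` over `W`. -/
def TrivialOver (φ : X → B) (F : Type) [TopologicalSpace F] (W : Set B) : Prop :=
  ∃ e : ↥(φ ⁻¹' W) ≃ₜ W × F, ∀ x, ((e x).1 : B) = φ x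

lemma TrivialOver.mono {φ : X → B} {W W' : Set B} (h : TrivialOver φ F W) (hW : W' ⊆ W) :
    TrivialOver φ F W' := by
  obtain ⟨e, he⟩ := h
  have he' : ∀ p, φ (e.symm p) = p.1 := fun p => by rw [← he, e.apply_symm_apply]
  exact ⟨{
    toFun := fun x => (⟨φ x, x.2⟩, (e ⟨x, hW x.2⟩).2)
    invFun := fun p => ⟨e.symm (⟨p.1, hW p.1.2⟩, p.2), by
      change φ _ ∈ W'
      rw [he']
      exact p.1.2⟩
    left_inv := fun x => by
      apply Subtype.ext
      have : ((⟨φ x, hW x.2⟩ : W), (e ⟨x, hW x.2⟩).2) = e ⟨x, hW x.2⟩ :=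
        Prod.ext (Subtype.ext (he ⟨x.1, hW x.2⟩).symm) rfl
      simp [this]
    right_inv := fun p => by
      refine Prod.ext (Subtype.ext ?_) ?_
      · exact he' _
      · simp
    continuous_toFun := by
      have : Continuous fun x : ↥(φ ⁻¹' W') => φ x := by
        have h : (fun x : ↥(φ ⁻¹' W') => φ x) =
            fun x : ↥(φ ⁻¹' W') => ((e ⟨x.1, hW x.2⟩).1 : B) :=
          funext fun x => (he ⟨x.1, hW x.2⟩).symm
        rw [h]
        fun_prop
      exact (this.subtype_mk _).prodMk (by fun_prop)
    continuous_invFun := by fun_prop }, fun _ => rfl⟩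

/-- The mutually inverse maps `α w` and `β w` of the total space exchange the fibres over `w` and
`b`; their joint continuity makes the resulting bijection a homeomorphism. -/
lemma TrivialOver.of_maps {φ : X → B} (hφ : Continuous φ) {W : Set B} {b : B}
    (α β : W → X → X) (hα : Continuous fun p : W × X => α p.1 p.2)
    (hβ : Continuous fun p : W × X => β p.1 p.2) (hαφ : ∀ (w : W) (x : X), φ x = w → φ (α w x) = b)
    (hβφ : ∀ (w : W) (x : X), φ x = b → φ (β w x) = w) (hαβ : ∀ w x, α w (β w x) = x)
    (hβα : ∀ w x, β w (α w x) = x) : TrivialOver φ ↥(φ ⁻¹' {b}) W :=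
  ⟨{
    toFun := fun x => (⟨φ x, x.2⟩, ⟨α ⟨φ x, x.2⟩ x, hαφ _ _ rfl⟩)
    invFun := fun p => ⟨β p.1 p.2, by
      change φ _ ∈ W
      rw [hβφ _ _ p.2.2]
      exact p.1.2⟩
    left_inv := fun x => Subtype.ext (hβα _ _)
    right_inv := fun p => by
      have h : (⟨φ (β p.1 p.2), by rw [hβφ _ _ p.2.2]; exact p.1.2⟩ : W) = p.1 :=
        Subtype.ext (hβφ _ _ p.2.2)
      refine Prod.ext h (Subtype.ext ?_)
      simp only [h, hαβ]
    continuous_toFun := by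
      refine Continuous.prodMk (by fun_prop) (Continuous.subtype_mk ?_ _)
      exact hα.comp (f := fun x : ↥(φ ⁻¹' W) => ((⟨φ x, x.2⟩ : W), (x : X))) (by fun_prop)
    continuous_invFun := by
      refine Continuous.subtype_mk ?_ _
      exact hβ.comp (f := fun p : W × ↥(φ ⁻¹' {b}) => (p.1, (p.2 : X))) (by fun_prop) },
    fun _ => rfl⟩

lemma TrivialOver.stablyFiniteHomology {φ : X → B} {W : Set B} (h : TrivialOver φ F W)
    (hW : StablyFiniteHomology W) (hF : StablyFiniteHomology F) :
    StablyFiniteHomology ↥(φ ⁻¹' W) := by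
  obtain ⟨e, -⟩ := h
  exact (hW.prod hF).of_homeomorph e.symm

lemma TrivialOver.hasEulerCharacteristic {φ : X → B} {W : Set B} (h : TrivialOver φ F W)
    [ContractibleSpace W] {χ : ℤ} (hF : HasEulerCharacteristic F χ) :
    HasEulerCharacteristic ↥(φ ⁻¹' W) χ := by
  obtain ⟨e, -⟩ := h
  exact (hF.prod_of_contractible (Z := W)).of_homeomorph e.symm

end Trivialization

/-! ### Bundles over the punctured plane -/

section PuncturedPlane

open Complex

lemma contractibleSpace_slitPlane : ContractibleSpace slitPlane :=
  starConvex_one_slitPlane.contractibleSpace ⟨1, one_mem_slitPlane⟩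

lemma contractibleSpace_neg_slitPlane : ContractibleSpace ↥{z : ℂ | -z ∈ slitPlane} := by
  have : StarConvex ℝ (-1) {z : ℂ | -z ∈ slitPlane} := by
    intro z hz a b ha hb hab
    have := starConvex_one_slitPlane hz ha hb hab
    simpa [neg_add, add_comm] using this
  exact this.contractibleSpace ⟨-1, by simp⟩

lemma contractibleSpace_im_pos : ContractibleSpace ↥{z : ℂ | 0 < z.im} :=
  (convex_halfSpace_im_gt 0).contractibleSpace ⟨I, by simp⟩

lemma contractibleSpace_im_neg : ContractibleSpace ↥{z : ℂ | z.im < 0} :=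
  (convex_halfSpace_im_lt 0).contractibleSpace ⟨-I, by simp⟩

lemma isOpen_neg_slitPlane : IsOpen {z : ℂ | -z ∈ slitPlane} :=
  isOpen_slitPlane.preimage continuous_neg

lemma slitPlane_inter_neg_slitPlane :
    slitPlane ∩ {z : ℂ | -z ∈ slitPlane} = {z | 0 < z.im} ∪ {z | z.im < 0} := by
  ext z
  simp only [Set.mem_inter_iff, Set.mem_ofPred_eq, mem_slitPlane_iff, neg_re, neg_im, Set.mem_union]
  constructor
  · rintro ⟨h1 | h1, h2 | h2⟩
    · linarith
    · rcases lt_or_gt_of_ne h2 with h | h <;> [left; right] <;> linarith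
    · rcases lt_or_gt_of_ne h1 with h | h <;> [right; left] <;> linarith
    · rcases lt_or_gt_of_ne h1 with h | h <;> [right; left] <;> linarith
  · rintro (h | h)
    · exact ⟨Or.inr h.ne', Or.inr (by simpa using h.ne')⟩
    · exact ⟨Or.inr h.ne, Or.inr (by simpa using h.ne)⟩

variable {X F : Type} [TopologicalSpace X] [TopologicalSpace F]

/-- A bundle over the punctured plane that is trivial over the slit planes has Euler
characteristic `0`. -/
lemma hasEulerCharacteristic_zero_of_trivialOver {φ : X → ℂ} (hφ : Continuous φ)
    (h0 : ∀ x, φ x ≠ 0) (h1 : TrivialOver φ F slitPlane)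
    (h2 : TrivialOver φ F {z | -z ∈ slitPlane}) (hF : FiniteHomology F) :
    HasEulerCharacteristic X 0 := by
  obtain ⟨χ, hF⟩ := hF
  have := contractibleSpace_slitPlane
  have := contractibleSpace_neg_slitPlane
  have := contractibleSpace_im_pos
  have := contractibleSpace_im_neg
  have hpos : {z : ℂ | 0 < z.im} ⊆ slitPlane := fun z hz =>
    mem_slitPlane_iff.2 (Or.inr (ne_of_gt hz))
  have hneg : {z : ℂ | z.im < 0} ⊆ slitPlane := fun z hz =>
    mem_slitPlane_iff.2 (Or.inr (ne_of_lt hz))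
  -- The two slit planes meet in two disjoint half-planes, each contributing `χ`; the total is `χ +
  -- χ - 2χ`.
  have h3 : HasEulerCharacteristic ↥(φ ⁻¹' slitPlane ∩ φ ⁻¹' {z | -z ∈ slitPlane}) (2 * χ) := by
    rw [← Set.preimage_inter, slitPlane_inter_neg_slitPlane]
    let i : ↥(φ ⁻¹' ({z : ℂ | 0 < z.im} ∪ {z | z.im < 0})) → X := Subtype.val
    have hi : Continuous i := continuous_subtype_val
    let U : Set ↥(φ ⁻¹' ({z : ℂ | 0 < z.im} ∪ {z | z.im < 0})) := {x | 0 < (φ x).im}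
    let V : Set ↥(φ ⁻¹' ({z : ℂ | 0 < z.im} ∪ {z | z.im < 0})) := {x | (φ x).im < 0}
    let eU : ↥(φ ⁻¹' {z : ℂ | 0 < z.im}) ≃ₜ U :=
      { toFun := fun x => ⟨⟨x, Or.inl x.2⟩, x.2⟩
        invFun := fun x => ⟨x, x.2⟩
        left_inv := fun _ => rfl
        right_inv := fun _ => rfl
        continuous_toFun := by fun_prop
        continuous_invFun := by fun_prop }
    let eV : ↥(φ ⁻¹' {z : ℂ | z.im < 0}) ≃ₜ V :=
      { toFun := fun x => ⟨⟨x, Or.inr x.2⟩, x.2⟩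
        invFun := fun x => ⟨x, x.2⟩
        left_inv := fun _ => rfl
        right_inv := fun _ => rfl
        continuous_toFun := by fun_prop
        continuous_invFun := by fun_prop }
    have hU := ((h1.mono hpos).hasEulerCharacteristic hF).of_homeomorph eU
    have hV := ((h1.mono hneg).hasEulerCharacteristic hF).of_homeomorph eV
    have : IsEmpty ↥(U ∩ V) := ⟨fun x => lt_asymm (show 0 < (φ x).im from x.2.1) x.2.2⟩
    have := HasEulerCharacteristic.of_isOpen_cover (U := U) (V := V)
      (isOpen_lt continuous_const (by fun_prop)) (isOpen_lt (by fun_prop) continuous_const)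
      (Set.eq_univ_of_forall fun x => x.2) hU hV hasEulerCharacteristic_of_isEmpty
    convert this using 1
    ring
  have := HasEulerCharacteristic.of_isOpen_cover (isOpen_slitPlane.preimage hφ)
    (isOpen_neg_slitPlane.preimage hφ)
    (Set.eq_univ_of_forall fun x => mem_slitPlane_or_neg_mem_slitPlane (h0 x))
    (h1.hasEulerCharacteristic hF) (h2.hasEulerCharacteristic hF) h3
  convert this using 1
  ring

/-- The product with `Y` is itself a trivial bundle over the punctured plane, so the preceding
computation applies. -/
lemma stablyFiniteHomology_ne_zero : StablyFiniteHomology {z : ℂ // z ≠ 0} := by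
  intro Y _ hY
  have triv : ∀ W : Set ℂ, 0 ∉ W → TrivialOver (fun p : {z : ℂ // z ≠ 0} × Y => (p.1 : ℂ)) Y W :=
    fun W hW => ⟨{
      toFun := fun p => (⟨p.1.1, p.2⟩, p.1.2)
      invFun := fun p => ⟨(⟨p.1, fun h => hW (h ▸ p.1.2)⟩, p.2), p.1.2⟩
      left_inv := fun _ => rfl
      right_inv := fun _ => rfl
      continuous_toFun := by fun_prop
      continuous_invFun := by fun_prop }, fun _ => rfl⟩
  exact ⟨0, hasEulerCharacteristic_zero_of_trivialOver (by fun_prop) (fun p => p.1.2)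
    (triv _ zero_notMem_slitPlane) (triv _ (by simp)) hY⟩

end PuncturedPlane

/-! ### Conics, pairs of conics and their Jacobian -/

/-- The coefficients of `x²`, `x y`, `y²`, `x`, `y`, `1` in a polynomial of degree at most `2`. -/
abbrev Conic : Type := Fin 6 → ℂ

namespace Conic

/-- The discriminant of the quadratic part. -/
def disc (q : Conic) : ℂ := q 1 ^ 2 - 4 * q 0 * q 2

/-- The determinant of the conic, up to a constant factor. -/
def delta (q : Conic) : ℂ :=
  4 * q 0 * q 2 * q 5 + q 1 * q 3 * q 4 - q 0 * q 4 ^ 2 - q 2 * q 3 ^ 2 - q 1 ^ 2 * q 5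

/-- The substitution `(x, y) ↦ (m 0 x + m 1 y, m 2 x + m 3 y)`. -/
def subst (m : Fin 4 → ℂ) (q : Conic) : Conic :=
  ![q 0 * m 0 ^ 2 + q 1 * m 0 * m 2 + q 2 * m 2 ^ 2,
    2 * q 0 * m 0 * m 1 + q 1 * (m 0 * m 3 + m 1 * m 2) + 2 * q 2 * m 2 * m 3,
    q 0 * m 1 ^ 2 + q 1 * m 1 * m 3 + q 2 * m 3 ^ 2,
    q 3 * m 0 + q 4 * m 2, q 3 * m 1 + q 4 * m 3, q 5]

/-- The determinant of a substitution. -/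
def substDet (m : Fin 4 → ℂ) : ℂ := m 0 * m 3 - m 1 * m 2

/-- The adjugate of a substitution. -/
def substAdj (m : Fin 4 → ℂ) : Fin 4 → ℂ := ![m 3, -m 1, -m 2, m 0]

lemma disc_subst (m : Fin 4 → ℂ) (q : Conic) : disc (subst m q) = substDet m ^ 2 * disc q := by
  simp [disc, subst, substDet]; ring

lemma delta_subst (m : Fin 4 → ℂ) (q : Conic) : delta (subst m q) = substDet m ^ 2 * delta q := by
  simp [delta, subst, substDet]; ring

lemma disc_smul (c : ℂ) (q : Conic) : disc (c • q) = c ^ 2 * disc q := by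
  simp [disc]; ring

lemma delta_smul (c : ℂ) (q : Conic) : delta (c • q) = c ^ 3 * delta q := by
  simp [delta]; ring

lemma subst_subst_adj {m : Fin 4 → ℂ} (hm : substDet m = 1) (q : Conic) :
    subst m (subst (substAdj m) q) = q := by
  simp only [substDet] at hm
  have h1 : m 1 * m 2 = m 0 * m 3 - 1 := by linear_combination -hm
  ext i
  fin_cases i <;> simp [subst, substAdj] <;> grind

lemma substDet_adj (m : Fin 4 → ℂ) : substDet (substAdj m) = substDet m := by
  simp [substDet, substAdj]; ring

lemma substAdj_adj (m : Fin 4 → ℂ) : substAdj (substAdj m) = m := by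
  ext i
  fin_cases i <;> simp [substAdj]

lemma subst_adj_subst {m : Fin 4 → ℂ} (hm : substDet m = 1) (q : Conic) :
    subst (substAdj m) (subst m q) = q := by
  have := subst_subst_adj (m := substAdj m) (by rw [substDet_adj, hm]) q
  rwa [substAdj_adj] at this

lemma continuous_subst : Continuous fun p : (Fin 4 → ℂ) × Conic => subst p.1 p.2 := by
  refine continuous_pi fun i => ?_
  fin_cases i <;> simp [subst] <;> fun_prop

lemma continuous_substAdj : Continuous substAdj := by
  refine continuous_pi fun i => ?_
  fin_cases i <;> simp [substAdj] <;> fun_prop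

end Conic

/-- The coefficients of a pair of polynomials of degree at most `2`. -/
abbrev ConicPair : Type := Fin 2 → Conic

namespace ConicPair

open Conic

/-- The minors of the coefficient matrix. -/
def minor (f : ConicPair) (i j : Fin 6) : ℂ := f 0 i * f 1 j - f 1 i * f 0 j

/-- The coefficients of the Jacobian determinant. -/
def jac (f : ConicPair) : Conic :=
  ![2 * f.minor 0 1, 4 * f.minor 0 2, 2 * f.minor 1 2, 2 * f.minor 0 4 + f.minor 3 1,
    f.minor 1 4 + 2 * f.minor 3 2, f.minor 3 4]

lemma jac_smul (c : ℂ) (f : ConicPair) : jac (c • f) = c ^ 2 • jac f := by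
  ext i
  fin_cases i <;> simp [jac, minor] <;> ring

/-- The chain rule for Jacobian determinants. -/
lemma jac_subst (m : Fin 4 → ℂ) (f : ConicPair) :
    jac (fun i => subst m (f i)) = substDet m • subst m (jac f) := by
  ext i
  fin_cases i <;> simp [jac, minor, subst, substDet] <;> ring

lemma continuous_jac : Continuous jac := by
  refine continuous_pi fun i => ?_
  fin_cases i <;> simp [jac, minor] <;> fun_prop

lemma continuous_disc_jac : Continuous fun f : ConicPair => disc (jac f) := by
  have := continuous_jac
  unfold disc
  fun_prop

/-- The pairs whose Jacobian determinant defines a smooth conic with two points at infinity. -/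
def regular : Set ConicPair := {f | disc (jac f) ≠ 0 ∧ delta (jac f) ≠ 0}

/-- The regular pairs for which the discriminant of the Jacobian determinant is `1`. -/
def regularOne : Set ConicPair := {f | disc (jac f) = 1 ∧ delta (jac f) ≠ 0}

lemma disc_jac_smul (c : ℂ) (f : ConicPair) : disc (jac (c • f)) = c ^ 4 * disc (jac f) := by
  rw [jac_smul, disc_smul]; ring

lemma smul_mem_regular {c : ℂ} (hc : c ≠ 0) {f : ConicPair} (hf : f ∈ regular) :
    c • f ∈ regular := by
  refine ⟨?_, ?_⟩
  · rw [disc_jac_smul]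
    exact mul_ne_zero (pow_ne_zero _ hc) hf.1
  · rw [jac_smul, delta_smul]
    exact mul_ne_zero (pow_ne_zero _ (pow_ne_zero _ hc)) hf.2

/-- The discriminant as a map to the punctured plane. -/
def regularDisc (f : regular) : ℂ := disc (jac f)

lemma continuous_regularDisc : Continuous regularDisc :=
  continuous_disc_jac.comp continuous_subtype_val

/-- Scaling by `c` multiplies the discriminant by `c⁴`, so `(r w)⁻¹` moves the fibre over `w` to the
fibre over `1`. -/
lemma trivialOver_of_root {W : Set ℂ} (r : W → ℂ) (hr : Continuous r) (hr4 : ∀ w, r w ^ 4 = w)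
    (h0 : (0 : ℂ) ∉ W) : TrivialOver regularDisc ↥(regularDisc ⁻¹' {1}) W := by
  have hne : ∀ w, r w ≠ 0 := fun w h => h0 (by
    have := hr4 w
    rw [h, zero_pow (by norm_num)] at this
    exact this ▸ w.2)
  refine TrivialOver.of_maps continuous_regularDisc
    (fun w f => ⟨(r w)⁻¹ • f.1, smul_mem_regular (inv_ne_zero (hne w)) f.2⟩)
    (fun w f => ⟨r w • f.1, smul_mem_regular (hne w) f.2⟩) ?_ ?_ ?_ ?_ ?_ ?_
  · refine Continuous.subtype_mk ?_ _
    have : Continuous fun w => (r w)⁻¹ := hr.inv₀ hne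
    exact (this.comp continuous_fst).smul (continuous_subtype_val.comp continuous_snd)
  · refine Continuous.subtype_mk ?_ _
    exact (hr.comp continuous_fst).smul (continuous_subtype_val.comp continuous_snd)
  · intro w f hf
    simp only [regularDisc] at hf ⊢
    rw [disc_jac_smul, hf, inv_pow, hr4, inv_mul_cancel₀]
    exact fun h => h0 (h ▸ w.2)
  · intro w f hf
    simp only [regularDisc] at hf ⊢
    rw [disc_jac_smul, hf, mul_one, hr4]
  · intro w f
    exact Subtype.ext (inv_smul_smul₀ (hne w) _)
  · intro w f
    exact Subtype.ext (smul_inv_smul₀ (hne w) _)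

lemma hasEulerCharacteristic_regular (h : FiniteHomology ↥(regularDisc ⁻¹' {1})) :
    HasEulerCharacteristic regular 0 := by
  have hroot : ∀ z : ℂ, (z ^ (1 / 4 : ℂ)) ^ 4 = z := fun z => by
    have := Complex.cpow_nat_inv_pow z (n := 4) (by norm_num)
    simpa only [Nat.cast_ofNat, one_div] using this
  refine hasEulerCharacteristic_zero_of_trivialOver continuous_regularDisc (fun f => f.2.1)
    (trivialOver_of_root (fun w => (w : ℂ) ^ (1 / 4 : ℂ)) ?_ (fun w => hroot w)
      Complex.zero_notMem_slitPlane)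
    -- The principal root is continuous at `-w` here, so a root of `w = (-1)(-w)` is taken factor by
    -- factor.
    (trivialOver_of_root (fun w => (-1 : ℂ) ^ (1 / 4 : ℂ) * (-(w : ℂ)) ^ (1 / 4 : ℂ)) ?_
      (fun w => by rw [mul_pow, hroot, hroot]; ring) (by simp)) h
  · exact continuous_iff_continuousAt.2 fun w =>
      continuous_subtype_val.continuousAt.cpow continuousAt_const w.2
  · exact continuous_iff_continuousAt.2 fun w =>
      continuousAt_const.mul (continuous_subtype_val.neg.continuousAt.cpow continuousAt_const w.2)

/-! ### The bundle over binary quadratic forms of discriminant 1 -/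

section Chart

/-- The quadratic part of the Jacobian determinant. -/
def quad (f : regularOne) : ℂ × ℂ × ℂ := (jac f.1 0, jac f.1 1, jac f.1 2)

lemma continuous_quad : Continuous quad := by
  have h : Continuous fun f : regularOne => jac f.1 := continuous_jac.comp continuous_subtype_val
  unfold quad
  fun_prop

/-- The regular pairs for which the Jacobian determinant has quadratic part `x y`. -/
abbrev Fibre : Type := ↥(quad ⁻¹' {((0 : ℂ), (1 : ℂ), (0 : ℂ))})

lemma subst_mem_regularOne {m : Fin 4 → ℂ} (hm : substDet m = 1) {f : ConicPair}
    (hf : f ∈ regularOne) : (fun i => subst m (f i)) ∈ regularOne := by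
  refine ⟨?_, ?_⟩
  · rw [jac_subst, hm, one_smul, disc_subst, hm, hf.1]; norm_num
  · rw [jac_subst, hm, one_smul, delta_subst, hm, one_pow, one_mul]
    exact hf.2

/-- Hypothesis `hw` says that the form `w` factors as `(m 0 x + m 1 y)(m 2 x + m 3 y)`, so the
unimodular substitution `m w` carries `xy` to `w`. -/
lemma trivialOver_of_subst {W : Set (ℂ × ℂ × ℂ)} (m : W → Fin 4 → ℂ) (hm : Continuous m)
    (hdet : ∀ w, substDet (m w) = 1)
    (hw : ∀ w : W, (w : ℂ × ℂ × ℂ) =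
      (m w 0 * m w 2, m w 0 * m w 3 + m w 1 * m w 2, m w 1 * m w 3)) :
    TrivialOver quad Fibre W := by
  have hsub : Continuous fun p : W × regularOne => (m p.1, p.2.1) := by fun_prop
  have hadj : Continuous fun p : W × regularOne => (substAdj (m p.1), p.2.1) :=
    ((continuous_substAdj.comp hm).comp continuous_fst).prodMk
      (continuous_subtype_val.comp continuous_snd)
  have hdet' : ∀ w, substDet (substAdj (m w)) = 1 := fun w => by rw [substDet_adj, hdet]
  refine TrivialOver.of_maps continuous_quad
    (fun w f => ⟨fun i => subst (substAdj (m w)) (f.1 i), subst_mem_regularOne (hdet' w) f.2⟩)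
    (fun w f => ⟨fun i => subst (m w) (f.1 i), subst_mem_regularOne (hdet w) f.2⟩)
    ?_ ?_ ?_ ?_ ?_ ?_
  · refine Continuous.subtype_mk (continuous_pi fun i => ?_) _
    exact continuous_subst.comp
      (hadj.fst.prodMk ((continuous_apply i).comp hadj.snd))
  · refine Continuous.subtype_mk (continuous_pi fun i => ?_) _
    exact continuous_subst.comp
      (hsub.fst.prodMk ((continuous_apply i).comp hsub.snd))
  · intro w f hf
    have hd := hdet w
    rw [hw w] at hf
    simp only [quad, Prod.mk.injEq] at hf
    obtain ⟨h0, h1, h2⟩ := hf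
    simp only [quad, jac_subst, hdet', one_smul]
    simp only [substDet] at hd
    simp [subst, substAdj, h0, h1, h2]
    refine ⟨?_, ?_, ?_⟩
    · ring
    · linear_combination (m w 0 * m w 3 - m w 1 * m w 2 + 1) * hd
    · ring
  · intro w f hf
    simp only [quad, Prod.mk.injEq] at hf
    obtain ⟨h0, h1, h2⟩ := hf
    rw [hw w]
    simp only [quad, jac_subst, hdet, one_smul]
    simp [subst, h0, h1, h2]
  · intro w f
    exact Subtype.ext (funext fun i => subst_adj_subst (hdet w) _)
  · intro w f
    exact Subtype.ext (funext fun i => subst_subst_adj (hdet w) _)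

end Chart

section Charts

/-- The binary quadratic forms `w` of discriminant `1` whose first root is not infinite. -/
def chartOne : Set (ℂ × ℂ × ℂ) :=
  {w | w.2.1 ^ 2 - 4 * w.1 * w.2.2 = 1 ∧ (w.2.1 + 1 ≠ 0 ∨ w.2.2 ≠ 0)}

/-- The binary quadratic forms `w` of discriminant `1` whose first root is not zero. -/
def chartTwo : Set (ℂ × ℂ × ℂ) :=
  {w | w.2.1 ^ 2 - 4 * w.1 * w.2.2 = 1 ∧ (w.2.1 - 1 ≠ 0 ∨ w.1 ≠ 0)}

open ComplexConjugate in
/-- The common quotient of two proportional pairs of complex numbers. -/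
noncomputable def quotient (a b c d : ℂ) : ℂ :=
  (a * conj c + b * conj d) / (c * conj c + d * conj d)

lemma quotient_denom_ne_zero {c d : ℂ} (h : c ≠ 0 ∨ d ≠ 0) :
    c * (starRingEnd ℂ) c + d * (starRingEnd ℂ) d ≠ 0 := by
  rw [Complex.mul_conj, Complex.mul_conj, ← Complex.ofReal_add, Complex.ofReal_ne_zero]
  rcases h with h | h
  · exact (add_pos_of_pos_of_nonneg (Complex.normSq_pos.2 h) (Complex.normSq_nonneg d)).ne'
  · exact (add_pos_of_nonneg_of_pos (Complex.normSq_nonneg c) (Complex.normSq_pos.2 h)).ne'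

lemma quotient_mul {a b c d : ℂ} (h : c ≠ 0 ∨ d ≠ 0) (hab : a * d = b * c) :
    quotient a b c d * c = a ∧ quotient a b c d * d = b := by
  have := quotient_denom_ne_zero h
  unfold quotient
  constructor
  · rw [div_mul_eq_mul_div, div_eq_iff this]
    linear_combination (-(starRingEnd ℂ) d) * hab
  · rw [div_mul_eq_mul_div, div_eq_iff this]
    linear_combination ((starRingEnd ℂ) c) * hab

lemma quotient_eq {t c d : ℂ} (h : c ≠ 0 ∨ d ≠ 0) : quotient (t * c) (t * d) c d = t := by
  have := quotient_denom_ne_zero h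
  unfold quotient
  rw [div_eq_iff this]
  ring

lemma continuous_quotient {T : Type*} [TopologicalSpace T] {a b c d : T → ℂ} (ha : Continuous a)
    (hb : Continuous b) (hc : Continuous c) (hd : Continuous d) (h : ∀ x, c x ≠ 0 ∨ d x ≠ 0) :
    Continuous fun x => quotient (a x) (b x) (c x) (d x) := by
  have hc' := Complex.continuous_conj.comp hc
  have hd' := Complex.continuous_conj.comp hd
  exact ((ha.mul hc').add (hb.mul hd')).div ((hc.mul hc').add (hd.mul hd'))
    fun x => quotient_denom_ne_zero (h x)

/-- Coordinates on `chartOne`. -/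
noncomputable def chartOneHomeomorph : chartOne ≃ₜ ℂ × ℂ where
  -- For `w = (A, B, C)` the second coordinate is `2A / (B + 1) = (B - 1) / (2C)`; the two
  -- expressions agree because `B² - 4AC = 1`, and `quotient` is continuous wherever either
  -- denominator is nonzero.
  toFun w := (w.1.2.2, quotient (2 * w.1.1) (w.1.2.1 - 1) (w.1.2.1 + 1) (2 * w.1.2.2))
  invFun p := ⟨(p.2 * (1 + p.1 * p.2), 1 + 2 * (p.1 * p.2), p.1), by
    refine ⟨by ring, ?_⟩
    by_contra! h
    simp only at h
    rw [h.2] at h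
    norm_num at h⟩
  left_inv w := by
    obtain ⟨⟨A, B, C⟩, h, h'⟩ := w
    simp only at h h'
    have h'' : B + 1 ≠ 0 ∨ 2 * C ≠ 0 := by simpa using h'
    obtain ⟨h1, h2⟩ := quotient_mul (a := 2 * A) (b := B - 1) h'' (by linear_combination -h)
    refine Subtype.ext (Prod.ext ?_ (Prod.ext ?_ rfl))
    · change quotient (2 * A) (B - 1) (B + 1) (2 * C) *
        (1 + C * quotient (2 * A) (B - 1) (B + 1) (2 * C)) = A
      generalize quotient (2 * A) (B - 1) (B + 1) (2 * C) = t at h1 h2 ⊢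
      linear_combination h1 / 2 + t * h2 / 2
    · change 1 + 2 * (C * quotient (2 * A) (B - 1) (B + 1) (2 * C)) = B
      linear_combination h2
  right_inv p := by
    obtain ⟨s, t⟩ := p
    refine Prod.ext rfl ?_
    change quotient (2 * (t * (1 + s * t))) (1 + 2 * (s * t) - 1) (1 + 2 * (s * t) + 1) (2 * s) = t
    have : quotient (t * (1 + 2 * (s * t) + 1)) (t * (2 * s)) (1 + 2 * (s * t) + 1) (2 * s) = t := by
      refine quotient_eq ?_
      by_contra! h
      have hs : s = 0 := by simpa using h.2
      rw [hs] at h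
      norm_num at h
    convert this using 2 <;> ring
  continuous_toFun := by
    refine Continuous.prodMk (by fun_prop) (continuous_quotient (by fun_prop) (by fun_prop)
      (by fun_prop) (by fun_prop) fun w => ?_)
    simpa using w.2.2
  continuous_invFun := by fun_prop

/-- Coordinates on `chartTwo`. -/
noncomputable def chartTwoHomeomorph : chartTwo ≃ₜ ℂ × ℂ where
  toFun w := (w.1.1, quotient (2 * w.1.2.2) (-1 - w.1.2.1) (1 - w.1.2.1) (2 * w.1.1))
  invFun p := ⟨(p.1, -(1 + 2 * (p.1 * p.2)), p.2 * (1 + p.1 * p.2)), by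
    refine ⟨by ring, ?_⟩
    by_contra! h
    simp only at h
    rw [h.2] at h
    norm_num at h⟩
  left_inv w := by
    obtain ⟨⟨A, B, C⟩, h, h'⟩ := w
    simp only at h h'
    have h'' : 1 - B ≠ 0 ∨ 2 * A ≠ 0 := by
      refine h'.imp (fun h => ?_) (by simp)
      rwa [← neg_sub, neg_ne_zero]
    obtain ⟨h1, h2⟩ := quotient_mul (a := 2 * C) (b := -1 - B) h'' (by linear_combination -h)
    refine Subtype.ext (Prod.ext rfl (Prod.ext ?_ ?_))
    · change -(1 + 2 * (A * quotient (2 * C) (-1 - B) (1 - B) (2 * A))) = B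
      linear_combination -h2
    · change quotient (2 * C) (-1 - B) (1 - B) (2 * A) *
        (1 + A * quotient (2 * C) (-1 - B) (1 - B) (2 * A)) = C
      generalize quotient (2 * C) (-1 - B) (1 - B) (2 * A) = t at h1 h2 ⊢
      linear_combination h1 / 2 + t * h2 / 2
  right_inv p := by
    obtain ⟨s, t⟩ := p
    refine Prod.ext rfl ?_
    change quotient (2 * (t * (1 + s * t))) (-1 - -(1 + 2 * (s * t))) (1 - -(1 + 2 * (s * t)))
      (2 * s) = t
    have : quotient (t * (1 - -(1 + 2 * (s * t)))) (t * (2 * s)) (1 - -(1 + 2 * (s * t)))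
        (2 * s) = t := by
      refine quotient_eq ?_
      by_contra! h
      have hs : s = 0 := by simpa using h.2
      rw [hs] at h
      norm_num at h
    convert this using 2 <;> ring
  continuous_toFun := by
    refine Continuous.prodMk (by fun_prop) (continuous_quotient (by fun_prop) (by fun_prop)
      (by fun_prop) (by fun_prop) fun w => ?_)
    refine w.2.2.imp (fun h => ?_) (by simp)
    rwa [← neg_sub, neg_ne_zero]
  continuous_invFun := by fun_prop

/-- Inside `chartOne`, the forms outside `chartTwo` are those with `A = 0` and `B = 1`, that is `t =
0`. -/
lemma mem_chartTwo_iff (w : chartOne) : w.1 ∈ chartTwo ↔ (chartOneHomeomorph w).2 ≠ 0 := by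
  obtain ⟨⟨s, t⟩, rfl⟩ := chartOneHomeomorph.symm.surjective w
  rw [Homeomorph.apply_symm_apply]
  change (_ ∧ (1 + 2 * (s * t) - 1 ≠ 0 ∨ t * (1 + s * t) ≠ 0)) ↔ t ≠ 0
  constructor
  · rintro ⟨-, h⟩ rfl
    simp at h
  · intro ht
    refine ⟨(chartOneHomeomorph.symm (s, t)).2.1, ?_⟩
    by_contra! h
    have : s * t = 0 := by linear_combination h.1 / 2
    rw [this] at h
    exact ht (by simpa using h.2)

lemma continuous_vecCons_four {T : Type*} [TopologicalSpace T] {a b c d : T → ℂ}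
    (ha : Continuous a) (hb : Continuous b) (hc : Continuous c) (hd : Continuous d) :
    Continuous fun x => ![a x, b x, c x, d x] := by
  refine continuous_pi fun i => ?_
  fin_cases i <;> simpa

lemma trivialOver_chartOne : TrivialOver quad Fibre chartOne := by
  have h := chartOneHomeomorph.continuous
  -- The form with coordinates `(s, t)` factors as `((1 + st)x + sy)(tx + y)`, of determinant 1.
  refine trivialOver_of_subst (fun w => ![1 + (chartOneHomeomorph w).1 * (chartOneHomeomorph w).2,
    (chartOneHomeomorph w).1, (chartOneHomeomorph w).2, 1]) ?_ ?_ ?_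
  · exact continuous_vecCons_four (continuous_const.add (h.fst.mul h.snd)) h.fst h.snd
      continuous_const
  · intro w
    simp [substDet]
  · intro w
    obtain ⟨⟨s, t⟩, rfl⟩ := chartOneHomeomorph.symm.surjective w
    rw [Homeomorph.apply_symm_apply]
    change (t * (1 + s * t), 1 + 2 * (s * t), s) = _
    simp
    constructor <;> ring

lemma trivialOver_chartTwo : TrivialOver quad Fibre chartTwo := by
  have h := chartTwoHomeomorph.continuous
  -- Here the factorization is `(sx - (1 + st)y)(x - ty)`, again of determinant 1.
  refine trivialOver_of_subst (fun w => ![(chartTwoHomeomorph w).1,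
    -(1 + (chartTwoHomeomorph w).1 * (chartTwoHomeomorph w).2), 1, -(chartTwoHomeomorph w).2])
    ?_ ?_ ?_
  · exact continuous_vecCons_four h.fst (continuous_const.add (h.fst.mul h.snd)).neg
      continuous_const h.snd.neg
  · intro w
    simp [substDet]
  · intro w
    obtain ⟨⟨s, t⟩, rfl⟩ := chartTwoHomeomorph.symm.surjective w
    rw [Homeomorph.apply_symm_apply]
    change (s, -(1 + 2 * (s * t)), t * (1 + s * t)) = _
    simp
    constructor <;> ring

/-- Coordinates on the intersection of the two charts. -/
noncomputable def chartInterHomeomorph :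
    ↥(chartOne ∩ chartTwo) ≃ₜ ℂ × {z : ℂ // z ≠ 0} where
  toFun w := ((chartOneHomeomorph ⟨w.1, w.2.1⟩).1, ⟨(chartOneHomeomorph ⟨w.1, w.2.1⟩).2,
    (mem_chartTwo_iff ⟨w.1, w.2.1⟩).1 w.2.2⟩)
  invFun p := ⟨chartOneHomeomorph.symm (p.1, p.2.1), (chartOneHomeomorph.symm (p.1, p.2.1)).2,
    (mem_chartTwo_iff _).2 (by rw [Homeomorph.apply_symm_apply]; exact p.2.2)⟩
  left_inv w := Subtype.ext (by
    change (chartOneHomeomorph.symm (chartOneHomeomorph ⟨w.1, w.2.1⟩)).1 = _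
    rw [Homeomorph.symm_apply_apply])
  right_inv p := by
    change ((chartOneHomeomorph (chartOneHomeomorph.symm (p.1, p.2.1))).1, _) = _
    refine Prod.ext ?_ (Subtype.ext ?_)
    · simp
    · change (chartOneHomeomorph (chartOneHomeomorph.symm (p.1, p.2.1))).2 = _
      simp
  continuous_toFun := by
    have : Continuous fun w : ↥(chartOne ∩ chartTwo) => chartOneHomeomorph ⟨w.1, w.2.1⟩ :=
      chartOneHomeomorph.continuous.comp (by fun_prop)
    exact this.fst.prodMk (this.snd.subtype_mk _)
  continuous_invFun := by fun_prop

lemma quad_mem (f : regularOne) : quad f ∈ chartOne ∪ chartTwo := by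
  have h : (quad f).2.1 ^ 2 - 4 * (quad f).1 * (quad f).2.2 = 1 := f.2.1
  by_cases h1 : (quad f).2.1 + 1 = 0
  · refine Or.inr ⟨h, Or.inl fun h2 => ?_⟩
    have : (2 : ℂ) = 0 := by linear_combination h1 - h2
    norm_num at this
  · exact Or.inl ⟨h, Or.inl h1⟩

/-- The charts are copies of `ℂ²` meeting in `ℂ × ℂ*`, and the bundle is trivial over each of the
three pieces. -/
lemma stablyFiniteHomology_regularOne (h : StablyFiniteHomology Fibre) :
    StablyFiniteHomology regularOne := by
  have h1 : StablyFiniteHomology chartOne :=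
    StablyFiniteHomology.of_contractible.of_homeomorph chartOneHomeomorph.symm
  have h2 : StablyFiniteHomology chartTwo :=
    StablyFiniteHomology.of_contractible.of_homeomorph chartTwoHomeomorph.symm
  have h3 : StablyFiniteHomology ↥(chartOne ∩ chartTwo) :=
    (StablyFiniteHomology.of_contractible.prod stablyFiniteHomology_ne_zero).of_homeomorph
      chartInterHomeomorph.symm
  have hc := continuous_quad
  have e1 : quad ⁻¹' chartOne = {f | (quad f).2.1 + 1 ≠ 0} ∪ {f | (quad f).2.2 ≠ 0} := by
    ext f
    exact and_iff_right (f.2.1 : (quad f).2.1 ^ 2 - 4 * (quad f).1 * (quad f).2.2 = 1)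
  have e2 : quad ⁻¹' chartTwo = {f | (quad f).2.1 - 1 ≠ 0} ∪ {f | (quad f).1 ≠ 0} := by
    ext f
    exact and_iff_right (f.2.1 : (quad f).2.1 ^ 2 - 4 * (quad f).1 * (quad f).2.2 = 1)
  refine StablyFiniteHomology.of_isOpen_cover (U := quad ⁻¹' chartOne) (V := quad ⁻¹' chartTwo)
    ?_ ?_ (Set.eq_univ_of_forall quad_mem) (trivialOver_chartOne.stablyFiniteHomology h1 h)
    (trivialOver_chartTwo.stablyFiniteHomology h2 h)
    ((trivialOver_chartOne.mono Set.inter_subset_left).stablyFiniteHomology h3 h)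
  · rw [e1]
    exact (isOpen_ne_fun (hc.snd.fst.add continuous_const) continuous_const).union
      (isOpen_ne_fun hc.snd.snd continuous_const)
  · rw [e2]
    exact (isOpen_ne_fun (hc.snd.fst.sub continuous_const) continuous_const).union
      (isOpen_ne_fun hc.fst continuous_const)

end Charts

/-! ### The fibre over `xy` as an explicit product -/

section Fibre

/-- Pairs of plane vectors of determinant `1 / 4`. -/
abbrev Frame : Type := {v : (ℂ × ℂ) × (ℂ × ℂ) // 4 * (v.1.1 * v.2.2 - v.1.2 * v.2.1) = 1}

/-- Coordinates on the frames whose first coordinate does not vanish. -/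
noncomputable def frameOneHomeomorph :
    {z : ℂ // z ≠ 0} × (ℂ × ℂ) ≃ₜ ↥{v : Frame | v.1.1.1 ≠ 0} where
  toFun p := ⟨⟨((p.1, p.2.1), (p.2.2, (1 / 4 + p.2.1 * p.2.2) / p.1)), by
    have := p.1.2
    field_simp
    ring⟩, p.1.2⟩
  invFun v := (⟨v.1.1.1.1, v.2⟩, (v.1.1.1.2, v.1.1.2.1))
  left_inv _ := rfl
  right_inv v := by
    obtain ⟨⟨⟨⟨a, b⟩, c, d⟩, h⟩, h0⟩ := v
    refine Subtype.ext (Subtype.ext (Prod.ext rfl (Prod.ext rfl ?_)))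
    change (1 / 4 + b * c) / a = d
    rw [div_eq_iff h0]
    simp only at h
    linear_combination -h / 4
  continuous_toFun := by
    have : Continuous fun p : {z : ℂ // z ≠ 0} × (ℂ × ℂ) =>
      (1 / 4 + p.2.1 * p.2.2) / (p.1 : ℂ) :=
      Continuous.div (by fun_prop) (by fun_prop) fun p => p.1.2
    fun_prop
  continuous_invFun := by fun_prop

/-- Coordinates on the frames whose second coordinate does not vanish. -/
noncomputable def frameTwoHomeomorph :
    {z : ℂ // z ≠ 0} × (ℂ × ℂ) ≃ₜ ↥{v : Frame | v.1.1.2 ≠ 0} where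
  toFun p := ⟨⟨((p.2.1, p.1), ((p.2.1 * p.2.2 - 1 / 4) / p.1, p.2.2)), by
    have := p.1.2
    field_simp
    ring⟩, p.1.2⟩
  invFun v := (⟨v.1.1.1.2, v.2⟩, (v.1.1.1.1, v.1.1.2.2))
  left_inv _ := rfl
  right_inv v := by
    obtain ⟨⟨⟨⟨a, b⟩, c, d⟩, h⟩, h0⟩ := v
    refine Subtype.ext (Subtype.ext (Prod.ext rfl (Prod.ext ?_ rfl)))
    change (a * d - 1 / 4) / b = c
    rw [div_eq_iff h0]
    simp only at h
    linear_combination h / 4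
  continuous_toFun := by
    have : Continuous fun p : {z : ℂ // z ≠ 0} × (ℂ × ℂ) =>
      (p.2.1 * p.2.2 - 1 / 4) / (p.1 : ℂ) :=
      Continuous.div (by fun_prop) (by fun_prop) fun p => p.1.2
    fun_prop
  continuous_invFun := by fun_prop

/-- Coordinates on the frames whose first two coordinates do not vanish. -/
noncomputable def frameInterHomeomorph : {z : ℂ // z ≠ 0} × ({z : ℂ // z ≠ 0} × ℂ) ≃ₜ
    ↥({v : Frame | v.1.1.1 ≠ 0} ∩ {v : Frame | v.1.1.2 ≠ 0}) where
  toFun p := ⟨(frameOneHomeomorph (p.1, (p.2.1, p.2.2))).1, p.1.2, p.2.1.2⟩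
  invFun v := (⟨v.1.1.1.1, v.2.1⟩, (⟨v.1.1.1.2, v.2.2⟩, v.1.1.2.1))
  left_inv _ := rfl
  right_inv v := Subtype.ext (by
    have := congrArg Subtype.val (frameOneHomeomorph.apply_symm_apply ⟨v.1, v.2.1⟩)
    exact this)
  continuous_toFun := by
    have := frameOneHomeomorph.continuous.comp
      (show Continuous fun p : {z : ℂ // z ≠ 0} × ({z : ℂ // z ≠ 0} × ℂ) =>
        (p.1, ((p.2.1 : ℂ), p.2.2)) by fun_prop)
    exact (continuous_subtype_val.comp this).subtype_mk _
  continuous_invFun := by fun_prop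

lemma stablyFiniteHomology_frame : StablyFiniteHomology Frame := by
  refine StablyFiniteHomology.of_isOpen_cover (U := {v : Frame | v.1.1.1 ≠ 0})
    (V := {v : Frame | v.1.1.2 ≠ 0}) (isOpen_ne_fun (by fun_prop) (by fun_prop))
    (isOpen_ne_fun (by fun_prop) (by fun_prop)) (Set.eq_univ_of_forall fun v => ?_)
    ((stablyFiniteHomology_ne_zero.prod .of_contractible).of_homeomorph frameOneHomeomorph)
    ((stablyFiniteHomology_ne_zero.prod .of_contractible).of_homeomorph frameTwoHomeomorph)
    ((stablyFiniteHomology_ne_zero.prod (stablyFiniteHomology_ne_zero.prod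
      .of_contractible)).of_homeomorph frameInterHomeomorph)
  by_contra h
  simp only [Set.mem_union, Set.mem_ofPred_eq, not_or, not_not] at h
  have := v.2
  rw [h.1, h.2] at this
  norm_num at this

/-- With `cᵢ` the columns of the coefficient matrix, Cramer's rule gives `minor 0 2 • c₁ = minor 1 2
• c₀ + minor 0 1 • c₂`, whose right side vanishes. Once the `xy`-terms are gone, `delta` factors
into the last two minors. -/
lemma fibre_iff (f : ConicPair) :
    (f ∈ regularOne ∧ (jac f 0, jac f 1, jac f 2) = ((0 : ℂ), (1 : ℂ), (0 : ℂ))) ↔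
      4 * f.minor 0 2 = 1 ∧ f 0 1 = 0 ∧ f 1 1 = 0 ∧ f.minor 0 3 ≠ 0 ∧ f.minor 2 4 ≠ 0 := by
  have e0 : jac f 0 = 2 * f.minor 0 1 := rfl
  have e1 : jac f 1 = 4 * f.minor 0 2 := rfl
  have e2 : jac f 2 = 2 * f.minor 1 2 := rfl
  have e3 : jac f 3 = 2 * f.minor 0 4 + f.minor 3 1 := rfl
  have e4 : jac f 4 = f.minor 1 4 + 2 * f.minor 3 2 := rfl
  have e5 : jac f 5 = f.minor 3 4 := rfl
  have hdelta : 4 * f.minor 0 2 = 1 → f 0 1 = 0 → f 1 1 = 0 →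
      delta (jac f) = -4 * (f.minor 0 3 * f.minor 2 4) := by
    intro h1 h2 h3
    simp only [delta, e0, e1, e2, e3, e4, e5, h1]
    simp only [minor, h2, h3] at h1 ⊢
    linear_combination (f 0 3 * f 1 4 - f 1 3 * f 0 4) * h1
  rw [Prod.mk.injEq, Prod.mk.injEq, e0, e1, e2]
  constructor
  · rintro ⟨⟨-, hd⟩, h0, h1, h2⟩
    have hb0 : f 0 1 = 0 := by
      simp only [minor] at h0 h1 h2
      linear_combination -f 0 1 * h1 + 2 * f 0 0 * h2 + 2 * f 0 2 * h0
    have hb1 : f 1 1 = 0 := by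
      simp only [minor] at h0 h1 h2
      linear_combination -f 1 1 * h1 + 2 * f 1 0 * h2 + 2 * f 1 2 * h0
    rw [hdelta h1 hb0 hb1] at hd
    exact ⟨h1, hb0, hb1, left_ne_zero_of_mul (right_ne_zero_of_mul hd),
      right_ne_zero_of_mul (right_ne_zero_of_mul hd)⟩
  · rintro ⟨h1, hb0, hb1, h3, h4⟩
    refine ⟨⟨?_, ?_⟩, ?_, h1, ?_⟩
    · rw [disc, e0, e1, e2, h1]
      simp [minor, hb0, hb1]
    · rw [hdelta h1 hb0 hb1]
      exact mul_ne_zero (by norm_num) (mul_ne_zero h3 h4)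
    · simp [minor, hb0, hb1]
    · simp [minor, hb0, hb1]

/-- Coordinates on the fibre: the frame, the linear part with respect to the frame, and the
constant part. -/
noncomputable def fibreHomeomorph :
    Frame × ((ℂ × {z : ℂ // z ≠ 0}) × ({z : ℂ // z ≠ 0} × ℂ)) × (ℂ × ℂ) ≃ₜ
    {f : ConicPair //
      4 * f.minor 0 2 = 1 ∧ f 0 1 = 0 ∧ f 1 1 = 0 ∧ f.minor 0 3 ≠ 0 ∧ f.minor 2 4 ≠ 0} where
  toFun p := ⟨![![p.1.1.1.1, 0, p.1.1.2.1,
      p.2.1.1.1 * p.1.1.1.1 + p.2.1.1.2 * p.1.1.2.1,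
      p.2.1.2.1 * p.1.1.1.1 + p.2.1.2.2 * p.1.1.2.1, p.2.2.1],
    ![p.1.1.1.2, 0, p.1.1.2.2,
      p.2.1.1.1 * p.1.1.1.2 + p.2.1.1.2 * p.1.1.2.2,
      p.2.1.2.1 * p.1.1.1.2 + p.2.1.2.2 * p.1.1.2.2, p.2.2.2]], by
    have h := p.1.2
    refine ⟨?_, rfl, rfl, fun h' => p.2.1.1.2.2 ?_, fun h' => p.2.1.2.1.2 ?_⟩
    · simp [minor]
      linear_combination h
    · simp [minor] at h'
      linear_combination 4 * h' - p.2.1.1.2.1 * h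
    · simp [minor] at h'
      linear_combination -4 * h' - p.2.1.2.1.1 * h⟩
  -- Cramer's rule in the frame of columns 0 and 2, whose determinant is `1 / 4`: four times a
  -- minor, up to sign, is a coordinate of column 3 or 4. The two minors required to be nonzero give
  -- the `ℂ*` factors.
  invFun f := (⟨((f.1 0 0, f.1 1 0), (f.1 0 2, f.1 1 2)), by
      have := f.2.1
      simp only [minor] at this ⊢
      exact this⟩,
    ((4 * f.1.minor 3 2, ⟨4 * f.1.minor 0 3, mul_ne_zero (by norm_num) f.2.2.2.2.1⟩),
      (⟨-4 * f.1.minor 2 4, mul_ne_zero (by norm_num) f.2.2.2.2.2⟩, 4 * f.1.minor 0 4)),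
    (f.1 0 5, f.1 1 5))
  left_inv p := by
    have h := p.1.2
    refine Prod.ext rfl (Prod.ext (Prod.ext (Prod.ext ?_ (Subtype.ext ?_))
      (Prod.ext (Subtype.ext ?_) ?_)) rfl)
    · simp [minor]
      linear_combination p.2.1.1.1 * h
    · simp [minor]
      linear_combination p.2.1.1.2.1 * h
    · simp [minor]
      linear_combination p.2.1.2.1.1 * h
    · simp [minor]
      linear_combination p.2.1.2.2 * h
  right_inv f := by
    obtain ⟨f, h, h0, h1, -, -⟩ := f
    simp only [minor] at h
    refine Subtype.ext (funext fun i => funext fun j => ?_)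
    fin_cases i <;> fin_cases j <;> simp [minor, h0, h1]
    · linear_combination f 0 3 * h
    · linear_combination f 0 4 * h
    · linear_combination f 1 3 * h
    · linear_combination f 1 4 * h
  continuous_toFun := by
    refine Continuous.subtype_mk (continuous_pi fun i => continuous_pi fun j => ?_) _
    fin_cases i <;> fin_cases j <;> simp <;> fun_prop
  continuous_invFun := by
    have h : ∀ i j, Continuous fun f : {f : ConicPair // 4 * f.minor 0 2 = 1 ∧ f 0 1 = 0 ∧
        f 1 1 = 0 ∧ f.minor 0 3 ≠ 0 ∧ f.minor 2 4 ≠ 0} => f.1 i j := fun i j =>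
      (continuous_apply j).comp ((continuous_apply i).comp continuous_subtype_val)
    have hm : ∀ i j, Continuous fun f : {f : ConicPair // 4 * f.minor 0 2 = 1 ∧ f 0 1 = 0 ∧
        f 1 1 = 0 ∧ f.minor 0 3 ≠ 0 ∧ f.minor 2 4 ≠ 0} => f.1.minor i j := fun i j =>
      ((h 0 i).mul (h 1 j)).sub ((h 1 i).mul (h 0 j))
    refine Continuous.prodMk (Continuous.subtype_mk ?_ _) (Continuous.prodMk (Continuous.prodMk
      (Continuous.prodMk ?_ (Continuous.subtype_mk ?_ _))
      (Continuous.prodMk (Continuous.subtype_mk ?_ _) ?_)) ?_)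
    · exact ((h 0 0).prodMk (h 1 0)).prodMk ((h 0 2).prodMk (h 1 2))
    · exact continuous_const.mul (hm 3 2)
    · exact continuous_const.mul (hm 0 3)
    · exact continuous_const.mul (hm 2 4)
    · exact continuous_const.mul (hm 0 4)
    · exact (h 0 5).prodMk (h 1 5)

lemma stablyFiniteHomology_fibre : StablyFiniteHomology Fibre := by
  have h : StablyFiniteHomology {f : ConicPair //
      4 * f.minor 0 2 = 1 ∧ f 0 1 = 0 ∧ f 1 1 = 0 ∧ f.minor 0 3 ≠ 0 ∧ f.minor 2 4 ≠ 0} :=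
    (stablyFiniteHomology_frame.prod (((StablyFiniteHomology.of_contractible.prod
      stablyFiniteHomology_ne_zero).prod (stablyFiniteHomology_ne_zero.prod
        .of_contractible)).prod .of_contractible)).of_homeomorph fibreHomeomorph
  exact h.of_homeomorph
    { toFun := fun f => ⟨⟨f.1, ((fibre_iff f.1).2 f.2).1⟩, ((fibre_iff f.1).2 f.2).2⟩
      invFun := fun f => ⟨f.1.1, (fibre_iff f.1.1).1 ⟨f.1.2, f.2⟩⟩
      left_inv := fun _ => rfl
      right_inv := fun _ => rfl
      continuous_toFun := by fun_prop
      continuous_invFun := by fun_prop }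

end Fibre

theorem hasEulerCharacteristic_regular_zero : HasEulerCharacteristic regular 0 := by
  refine hasEulerCharacteristic_regular
    ((stablyFiniteHomology_regularOne stablyFiniteHomology_fibre).finiteHomology.of_homeomorph
    { toFun := fun f => ⟨⟨f.1, by rw [f.2.1]; exact one_ne_zero, f.2.2⟩, f.2.1⟩
      invFun := fun f => ⟨f.1.1, f.2, f.1.2.2⟩
      left_inv := fun _ => rfl
      right_inv := fun _ => rfl
      continuous_toFun := by fun_prop
      continuous_invFun := by fun_prop })

end ConicPair

/-! ### Conics as polynomials and their affine normal form -/

namespace Conic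

/-- The value of a conic at a point. -/
def eval (q : Conic) (x : Fin 2 → ℂ) : ℂ :=
  q 0 * x 0 ^ 2 + q 1 * (x 0 * x 1) + q 2 * x 1 ^ 2 + q 3 * x 0 + q 4 * x 1 + q 5

/-- The exponents of the monomials of degree at most `2` in two variables. -/
noncomputable def expo (k : Fin 6) : Fin 2 →₀ ℕ :=
  Finsupp.equivFunOnFinite.symm
    ((![![2, 0], ![1, 1], ![0, 2], ![1, 0], ![0, 1], ![0, 0]] : Fin 6 → Fin 2 → ℕ) k)

lemma expo_injective : Function.Injective expo := by
  refine Finsupp.equivFunOnFinite.symm.injective.comp ?_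
  decide

lemma degree_expo_le (k : Fin 6) : (expo k).degree ≤ 2 := by
  rw [Finsupp.degree_eq_sum, Fin.sum_univ_two]
  fin_cases k <;> simp [expo]

lemma exists_expo_eq {d : Fin 2 →₀ ℕ} (h : d.degree ≤ 2) : ∃ k, expo k = d := by
  rw [Finsupp.degree_eq_sum, Fin.sum_univ_two] at h
  have key : ∀ k, expo k 0 = d 0 → expo k 1 = d 1 → expo k = d := fun k h0 h1 =>
    Finsupp.ext fun i => by fin_cases i <;> assumption
  obtain ⟨a, ha⟩ : ∃ a, d 0 = a := ⟨_, rfl⟩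
  obtain ⟨b, hb⟩ : ∃ b, d 1 = b := ⟨_, rfl⟩
  rw [ha, hb] at h key
  have ha2 : a ≤ 2 := by omega
  interval_cases a
  · have hb2 : b ≤ 2 := by omega
    interval_cases b
    · exact ⟨5, key 5 rfl rfl⟩
    · exact ⟨4, key 4 rfl rfl⟩
    · exact ⟨2, key 2 rfl rfl⟩
  · have hb2 : b ≤ 1 := by omega
    interval_cases b
    · exact ⟨3, key 3 rfl rfl⟩
    · exact ⟨1, key 1 rfl rfl⟩
  · obtain rfl : b = 0 := by omega
    exact ⟨0, key 0 rfl rfl⟩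

/-- The polynomial with given coefficients. -/
noncomputable def toPoly (q : Conic) : MvPolynomial (Fin 2) ℂ :=
  ∑ k, MvPolynomial.monomial (expo k) (q k)

lemma coeff_expo_toPoly (q : Conic) (k : Fin 6) : (toPoly q).coeff (expo k) = q k := by
  simp [toPoly, MvPolynomial.coeff_sum, MvPolynomial.coeff_monomial, expo_injective.eq_iff]

lemma coeff_toPoly_of_degree {q : Conic} {d : Fin 2 →₀ ℕ} (h : ¬ d.degree ≤ 2) :
    (toPoly q).coeff d = 0 := by
  simp only [toPoly, MvPolynomial.coeff_sum, MvPolynomial.coeff_monomial]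
  refine Finset.sum_eq_zero fun k _ => if_neg fun hk => h ?_
  rw [← hk]
  exact degree_expo_le k

lemma totalDegree_toPoly (q : Conic) : (toPoly q).totalDegree ≤ 2 := by
  refine MvPolynomial.totalDegree_finsetSum_le fun k _ => ?_
  refine (MvPolynomial.totalDegree_monomial_le _ _).trans ?_
  exact degree_expo_le k

lemma toPoly_coeff {p : MvPolynomial (Fin 2) ℂ} (hp : p.totalDegree ≤ 2) :
    toPoly (fun k => p.coeff (expo k)) = p := by
  ext d
  by_cases h : d.degree ≤ 2
  · obtain ⟨k, rfl⟩ := exists_expo_eq h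
    exact coeff_expo_toPoly _ k
  · rw [coeff_toPoly_of_degree h, MvPolynomial.coeff_eq_zero_of_totalDegree_lt]
    refine hp.trans_lt ?_
    exact not_le.1 h

open MvPolynomial in
lemma toPoly_eq (q : Conic) : toPoly q = C (q 0) * X 0 ^ 2 + C (q 1) * (X 0 * X 1) +
    C (q 2) * X 1 ^ 2 + C (q 3) * X 0 + C (q 4) * X 1 + C (q 5) := by
  have h : ∀ k : Fin 6, monomial (expo k) (q k) =
      C (q k) * (X 0 ^ (expo k 0) * X 1 ^ (expo k 1) : MvPolynomial (Fin 2) ℂ) := by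
    intro k
    rw [monomial_eq, Finsupp.prod_fintype _ _ (by simp), Fin.prod_univ_two]
  simp only [toPoly, h, Fin.sum_univ_six]
  simp [expo]

lemma eval_toPoly (q : Conic) (x : Fin 2 → ℂ) : MvPolynomial.eval x (toPoly q) = eval q x := by
  simp [toPoly_eq, eval]

lemma eval_injective : Function.Injective eval := by
  intro q q' h
  have : toPoly q = toPoly q' := MvPolynomial.funext fun x => by
    rw [eval_toPoly, eval_toPoly, h]
  funext k
  rw [← coeff_expo_toPoly q, this, coeff_expo_toPoly]

/-- The substitution of an affine map, given by its matrix `m` and the image `v` of the origin. -/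
def comp (m : Fin 4 → ℂ) (v : Fin 2 → ℂ) (q : Conic) : Conic :=
  ![q 0 * m 0 ^ 2 + q 1 * m 0 * m 2 + q 2 * m 2 ^ 2,
    2 * q 0 * m 0 * m 1 + q 1 * (m 0 * m 3 + m 1 * m 2) + 2 * q 2 * m 2 * m 3,
    q 0 * m 1 ^ 2 + q 1 * m 1 * m 3 + q 2 * m 3 ^ 2,
    (2 * q 0 * v 0 + q 1 * v 1 + q 3) * m 0 + (q 1 * v 0 + 2 * q 2 * v 1 + q 4) * m 2,
    (2 * q 0 * v 0 + q 1 * v 1 + q 3) * m 1 + (q 1 * v 0 + 2 * q 2 * v 1 + q 4) * m 3,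
    eval q v]

lemma eval_comp (m : Fin 4 → ℂ) (v : Fin 2 → ℂ) (q : Conic) (x : Fin 2 → ℂ) :
    eval (comp m v q) x =
      eval q ![m 0 * x 0 + m 1 * x 1 + v 0, m 2 * x 0 + m 3 * x 1 + v 1] := by
  simp [eval, comp]; ring

lemma disc_comp (m : Fin 4 → ℂ) (v : Fin 2 → ℂ) (q : Conic) :
    disc (comp m v q) = substDet m ^ 2 * disc q := by
  simp [disc, comp, substDet]; ring

lemma delta_comp (m : Fin 4 → ℂ) (v : Fin 2 → ℂ) (q : Conic) :
    delta (comp m v q) = substDet m ^ 2 * delta q := by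
  simp [delta, comp, substDet, eval]; ring

/-- A conic that vanishes exactly on the hyperbola `x y = 1`. -/
lemma eq_of_eval_eq_zero_iff {q : Conic} (h : ∀ x, eval q x = 0 ↔ x 0 * x 1 = 1) :
    q 1 ≠ 0 ∧ q = ![0, q 1, 0, 0, 0, -q 1] := by
  -- Evaluation at `(t, t⁻¹)`, multiplied by `t²`, is a polynomial in `t` of degree at most 4. Its
  -- values at `±1, ±2, 3` suffice to kill all coefficients; the weights below are interpolation
  -- weights.
  have key : ∀ t : ℂ, t ≠ 0 → q 0 * t ^ 4 + q 3 * t ^ 3 + (q 1 + q 5) * t ^ 2 + q 4 * t + q 2 = 0 := by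
    intro t ht
    have := (h ![t, t⁻¹]).2 (by simp [ht])
    simp only [eval, Matrix.cons_val_zero, Matrix.cons_val_one] at this
    field_simp at this
    linear_combination this
  have h1 := key 1 one_ne_zero
  have h2 := key (-1) (by norm_num)
  have h3 := key 2 two_ne_zero
  have h4 := key (-2) (by norm_num)
  have h5 := key 3 (by norm_num)
  have e0 : q 0 = 0 := by linear_combination (1/12) * h1 + (-1/24) * h2 + (-1/12) * h3 + (1/60) * h4 + (1/40) * h5
  have e3 : q 3 = 0 := by linear_combination (-1/6) * h1 + (1/6) * h2 + (1/12) * h3 + (-1/12) * h4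
  have e5 : q 1 + q 5 = 0 := by linear_combination (-7/12) * h1 + (1/24) * h2 + (7/12) * h3 + (1/12) * h4 + (-1/8) * h5
  have e4 : q 4 = 0 := by linear_combination (2/3) * h1 + (-2/3) * h2 + (-1/12) * h3 + (1/12) * h4
  have e2 : q 2 = 0 := by linear_combination (1) * h1 + (1/2) * h2 + (-1/2) * h3 + (-1/10) * h4 + (1/10) * h5
  have hq : q = ![0, q 1, 0, 0, 0, -q 1] := by
    ext i
    fin_cases i
    · exact e0
    · rfl
    · exact e2
    · exact e3
    · exact e4
    · exact eq_neg_of_add_eq_zero_right e5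
  refine ⟨fun h0 => ?_, hq⟩
  have : eval q 0 = 0 := by
    rw [hq]
    simp [eval, h0]
  simpa using (h 0).1 this

/-- A conic of nonzero discriminant and determinant is equivalent to a hyperbola with center `0` and
the coordinate axes as asymptotes. -/
lemma exists_comp_eq {q : Conic} (h1 : disc q ≠ 0) (h2 : delta q ≠ 0) :
    ∃ m v, substDet m ≠ 0 ∧ comp m v q 1 ≠ 0 ∧ comp m v q 5 ≠ 0 ∧
      comp m v q = ![0, comp m v q 1, 0, 0, 0, comp m v q 5] := by
  suffices h : ∃ m, substDet m ≠ 0 ∧ q 0 * m 0 ^ 2 + q 1 * m 0 * m 2 + q 2 * m 2 ^ 2 = 0 ∧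
      q 0 * m 1 ^ 2 + q 1 * m 1 * m 3 + q 2 * m 3 ^ 2 = 0 by
    obtain ⟨m, hm, hm0, hm2⟩ := h
    -- The center of the conic, where the gradient vanishes, found by Cramer's rule.
    let v : Fin 2 → ℂ :=
      ![(2 * q 2 * q 3 - q 1 * q 4) / disc q, (2 * q 0 * q 4 - q 1 * q 3) / disc q]
    have hv0 : 2 * q 0 * v 0 + q 1 * v 1 + q 3 = 0 := by
      simp only [v, Matrix.cons_val_zero, Matrix.cons_val_one]
      field_simp
      simp only [disc]
      ring
    have hv1 : q 1 * v 0 + 2 * q 2 * v 1 + q 4 = 0 := by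
      simp only [v, Matrix.cons_val_zero, Matrix.cons_val_one]
      field_simp
      simp only [disc]
      ring
    have hq : comp m v q = ![0, comp m v q 1, 0, 0, 0, comp m v q 5] := by
      ext i
      fin_cases i
      · exact hm0
      · rfl
      · exact hm2
      · simp [comp, hv0, hv1]
      · simp [comp, hv0, hv1]
      · rfl
    have hd := delta_comp m v q
    rw [hq] at hd
    simp only [delta] at hd
    have hd' : -(comp m v q 1 ^ 2 * comp m v q 5) = substDet m ^ 2 * delta q := by
      rw [delta, ← hd]
      simp
    have hne : comp m v q 1 ^ 2 * comp m v q 5 ≠ 0 := by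
      rw [← neg_ne_zero, hd']
      exact mul_ne_zero (pow_ne_zero _ hm) h2
    exact ⟨m, v, hm, fun h => left_ne_zero_of_mul hne (by rw [h]; norm_num),
      right_ne_zero_of_mul hne, hq⟩
  by_cases h0 : q 0 = 0
  -- The columns of `m` have to be two independent isotropic vectors of the quadratic part, here
  -- `y(q₁x + q₂y)`.
  · refine ⟨![1, -q 2, 0, q 1], ?_, ?_, ?_⟩
    · simpa [substDet, disc, h0] using h1
    · simp [h0]
    · simp [h0]
      ring
  · obtain ⟨s, hs⟩ := IsAlgClosed.exists_pow_nat_eq (disc q) (n := 2) (by norm_num)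
    have hs0 : s ≠ 0 := by
      rintro rfl
      exact h1 (by rw [← hs]; norm_num)
    -- The isotropic vectors `(-q₁ ± s, 2q₀)` come from the quadratic formula.
    refine ⟨![-q 1 + s, -q 1 - s, 2 * q 0, 2 * q 0], ?_, ?_, ?_⟩
    · have : substDet ![-q 1 + s, -q 1 - s, 2 * q 0, 2 * q 0] = 4 * q 0 * s := by
        simp [substDet]; ring
      rw [this]
      exact mul_ne_zero (mul_ne_zero (by norm_num) h0) hs0
    · simp
      rw [disc] at hs
      linear_combination q 0 * hs
    · simp
      rw [disc] at hs
      linear_combination q 0 * hs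

end Conic

/-! ### Normal form of a pair with Jacobian `Bxy + F` -/

namespace ConicPair

open Conic

lemma jac_comp (m : Fin 4 → ℂ) (v : Fin 2 → ℂ) (f : ConicPair) :
    jac (fun i => comp m v (f i)) = substDet m • comp m v (jac f) := by
  ext i
  fin_cases i <;> simp [jac, minor, comp, substDet, Conic.eval] <;> ring

/-- The pair of conics of `f₁`. -/
def std : ConicPair := ![![1, 0, 0, 0, 1, 0], ![0, 0, 1, 1, 0, 0]]

/-- The composition of a pair of conics with an affine map on the left. -/
def leftComp (l : Fin 4 → ℂ) (t : Fin 2 → ℂ) (f : ConicPair) : ConicPair :=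
  fun i k => ![l 0, l 2] i * f 0 k + ![l 1, l 3] i * f 1 k +
    (![0, 0, 0, 0, 0, t i] : Fin 6 → ℂ) k

lemma jac_leftComp (l : Fin 4 → ℂ) (t : Fin 2 → ℂ) (f : ConicPair) :
    jac (leftComp l t f) = substDet l • jac f := by
  ext i
  fin_cases i <;> simp [jac, minor, leftComp, substDet] <;> ring

lemma jac_std : jac std = ![0, 4, 0, 0, 0, -1] := by
  simp [jac, minor, std]

lemma std_mem_regular : std ∈ regular := by
  refine ⟨?_, ?_⟩ <;> rw [jac_std] <;> simp [disc, delta]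

lemma comp_mem_regular {m : Fin 4 → ℂ} (v : Fin 2 → ℂ) (hm : substDet m ≠ 0) {f : ConicPair}
    (hf : f ∈ regular) : (fun i => comp m v (f i)) ∈ regular := by
  refine ⟨?_, ?_⟩
  · rw [jac_comp, disc_smul, disc_comp]
    exact mul_ne_zero (pow_ne_zero _ hm) (mul_ne_zero (pow_ne_zero _ hm) hf.1)
  · rw [jac_comp, delta_smul, delta_comp]
    exact mul_ne_zero (pow_ne_zero _ hm) (mul_ne_zero (pow_ne_zero _ hm) hf.2)

lemma leftComp_mem_regular {l : Fin 4 → ℂ} (t : Fin 2 → ℂ) (hl : substDet l ≠ 0) {f : ConicPair}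
    (hf : f ∈ regular) : leftComp l t f ∈ regular := by
  refine ⟨?_, ?_⟩
  · rw [jac_leftComp, disc_smul]
    exact mul_ne_zero (pow_ne_zero _ hl) hf.1
  · rw [jac_leftComp, delta_smul]
    exact mul_ne_zero (pow_ne_zero _ hl) hf.2

/-- The normal form of a pair whose Jacobian determinant is `B x y + F`. -/
lemma exists_eq_leftComp_of_jac {g : ConicPair} {B F : ℂ} (hB : B ≠ 0) (hF : F ≠ 0)
    (h : jac g = ![0, B, 0, 0, 0, F]) :
    ∃ a b : ℂ, a * b ≠ 0 ∧ ∃ l t, substDet l ≠ 0 ∧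
      (fun i => comp ![a, 0, 0, b] 0 (g i)) = leftComp l t std := by
  have h0 := congrFun h 0
  have h1 := congrFun h 1
  have h2 := congrFun h 2
  have h3 := congrFun h 3
  have h4 := congrFun h 4
  have h5 := congrFun h 5
  simp [jac, minor] at h0 h1 h2 h3 h4 h5
  -- The same Cramer relation as in `fibre_iff` eliminates the `xy`-terms.
  have hb0' : g 0 1 = 0 := by
    have : B * g 0 1 = 0 := by
      rw [← h1]; linear_combination 4 * g 0 0 * h2 + 4 * g 0 2 * h0
    simpa [hB] using this
  have hb1' : g 1 1 = 0 := by
    have : B * g 1 1 = 0 := by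
      rw [← h1]; linear_combination 4 * g 1 0 * h2 + 4 * g 1 2 * h0
    simpa [hB] using this
  rw [hb0', hb1'] at h3 h4
  simp at h3 h4
  -- Vanishing of the linear terms of the Jacobian makes the `y`-column a multiple `ε` of the
  -- `x²`-column and the `x`-column a multiple `δ` of the `y²`-column; Cramer's rule yields the
  -- factors.
  obtain ⟨ε, hε⟩ : ∃ ε, ε = 4 / B * (g 0 4 * g 1 2 - g 1 4 * g 0 2) := ⟨_, rfl⟩
  obtain ⟨δ, hδ⟩ : ∃ δ, δ = 4 / B * (g 0 0 * g 1 3 - g 1 0 * g 0 3) := ⟨_, rfl⟩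
  have hεB : ε * B = 4 * (g 0 4 * g 1 2 - g 1 4 * g 0 2) := by rw [hε]; field_simp
  have hδB : δ * B = 4 * (g 0 0 * g 1 3 - g 1 0 * g 0 3) := by rw [hδ]; field_simp
  have e0 : g 0 4 = ε * g 0 0 := mul_left_cancel₀ hB <| by
    linear_combination (-g 0 0) * hεB - g 0 4 * h1 + 4 * g 0 2 * h3
  have e1 : g 1 4 = ε * g 1 0 := mul_left_cancel₀ hB <| by
    linear_combination (-g 1 0) * hεB - g 1 4 * h1 + 4 * g 1 2 * h3
  have d0 : g 0 3 = δ * g 0 2 := mul_left_cancel₀ hB <| by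
    linear_combination (-g 0 2) * hδB - g 0 3 * h1 + 4 * g 0 0 * h4
  have d1 : g 1 3 = δ * g 1 2 := mul_left_cancel₀ hB <| by
    linear_combination (-g 1 2) * hδB - g 1 3 * h1 + 4 * g 1 0 * h4
  have hεδ : ε * δ ≠ 0 := fun h' => hF <| by
    rw [e0, e1, d0, d1] at h5
    rw [← h5]
    linear_combination (g 0 2 * g 1 0 - g 1 2 * g 0 0) * h'
  have hε0 := left_ne_zero_of_mul hεδ
  have hδ0 := right_ne_zero_of_mul hεδ
  -- After scaling by `(a, b)`, the expressions `a²x² + εby` and `b²y² + δax` must be proportional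
  -- to `x² + y` and `y² + x`: `εb = a²` and `δa = b²`. Eliminating `b` leaves `a³ = δε²`.
  obtain ⟨a, ha⟩ := IsAlgClosed.exists_pow_nat_eq (δ * ε ^ 2) (n := 3) (by norm_num)
  have ha0 : a ≠ 0 := by
    rintro rfl
    have : δ * ε ^ 2 ≠ 0 := by positivity
    exact this (by rw [← ha]; norm_num)
  have hb1 : ε * (a ^ 2 / ε) = a ^ 2 := by field_simp
  have hb2 : δ * a = (a ^ 2 / ε) ^ 2 := by
    field_simp
    linear_combination -ha
  have hb : a ^ 2 / ε ≠ 0 := div_ne_zero (pow_ne_zero _ ha0) hε0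
  generalize a ^ 2 / ε = b at hb hb1 hb2
  refine ⟨a, b, mul_ne_zero ha0 hb, ![a ^ 2 * g 0 0, b ^ 2 * g 0 2, a ^ 2 * g 1 0, b ^ 2 * g 1 2],
    fun i => g i 5, ?_, ?_⟩
  · have h' : substDet ![a ^ 2 * g 0 0, b ^ 2 * g 0 2, a ^ 2 * g 1 0, b ^ 2 * g 1 2] =
        a ^ 2 * b ^ 2 * B / 4 := by
      rw [← h1]
      simp [substDet]
      ring
    rw [h']
    exact div_ne_zero (mul_ne_zero (mul_ne_zero (pow_ne_zero _ ha0) (pow_ne_zero _ hb)) hB)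
      (by norm_num)
  · ext i k
    fin_cases i <;> fin_cases k <;>
      simp [comp, leftComp, std, Conic.eval, hb0', hb1', e0, e1, d0, d1]
    all_goals grind

end ConicPair

/-! ### Affine maps in coordinates and the orbit of `f₁` -/

namespace QuadMap

open Conic ConicPair

lemma exists_coords (R : GA) : ∃ (m : Fin 4 → ℂ) (v : Fin 2 → ℂ), substDet m ≠ 0 ∧
    ∀ x, R x = ![m 0 * x 0 + m 1 * x 1 + v 0, m 2 * x 0 + m 3 * x 1 + v 1] := by
  let M := LinearMap.toMatrix' (R.linear : (Fin 2 → ℂ) →ₗ[ℂ] Fin 2 → ℂ)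
  refine ⟨![M 0 0, M 0 1, M 1 0, M 1 1], R 0, ?_, fun x => ?_⟩
  · have h : M.det ≠ 0 := by
      rw [LinearMap.det_toMatrix']
      exact (LinearEquiv.isUnit_det' R.linear).ne_zero
    rwa [Matrix.det_fin_two] at h
  · have h : R x = R.linear x + R 0 := by
      have := R.map_vadd 0 x
      simpa using this
    have h' : R.linear x = M.mulVec x := (LinearMap.toMatrix'_mulVec _ x).symm
    rw [h, h']
    ext i
    fin_cases i <;> simp

lemma exists_affineEquiv {m : Fin 4 → ℂ} (v : Fin 2 → ℂ) (hm : substDet m ≠ 0) :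
    ∃ R : GA, ∀ x, R x = ![m 0 * x 0 + m 1 * x 1 + v 0, m 2 * x 0 + m 3 * x 1 + v 1] := by
  let M : Matrix (Fin 2) (Fin 2) ℂ := !![m 0, m 1; m 2, m 3]
  have hM : IsUnit M.det := by
    rw [Matrix.det_fin_two]
    exact hm.isUnit
  let e := Matrix.toLinearEquiv' M ((Matrix.isUnit_iff_isUnit_det M).2 hM).invertible
  refine ⟨e.toAffineEquiv.trans (AffineEquiv.constVAdd ℂ _ v), fun x => ?_⟩
  have h : e x = M.mulVec x := rfl
  have h' : (e.toAffineEquiv.trans (AffineEquiv.constVAdd ℂ _ v)) x = v + e x := rfl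
  rw [h', h]
  ext i
  fin_cases i <;> simp [M, add_comm, Matrix.vecHead, Matrix.vecTail]

lemma mem_image_affineEquiv {e : GA} {S : Set (Fin 2 → ℂ)} {x : Fin 2 → ℂ} :
    x ∈ e '' S ↔ e.symm x ∈ S :=
  e.toEquiv.image_eq_preimage_symm S ▸ Iff.rfl

/-- The coefficients of the two components. -/
noncomputable def conicPair (f : QuadMap) : ConicPair := fun i k => (f.1 i).coeff (expo k)

lemma toPoly_conicPair (f : QuadMap) (i : Fin 2) : toPoly (f.conicPair i) = f.1 i :=
  toPoly_coeff (f.2 i)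

lemma toFun_apply (f : QuadMap) (x : Fin 2 → ℂ) (i : Fin 2) :
    f.toFun x i = Conic.eval (f.conicPair i) x := by
  rw [← eval_toPoly, toPoly_conicPair]
  rfl

lemma toFun_eq (f : QuadMap) (x : Fin 2 → ℂ) :
    f.toFun x = ![Conic.eval (f.conicPair 0) x, Conic.eval (f.conicPair 1) x] := by
  ext i
  fin_cases i <;> exact toFun_apply _ _ _

lemma det_jacobian (f : QuadMap) (x : Fin 2 → ℂ) :
    (f.jacobian x).det = Conic.eval (jac f.conicPair) x := by
  have h : ∀ i j, f.jacobian x i j =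
      MvPolynomial.eval x (MvPolynomial.pderiv j (toPoly (f.conicPair i))) := fun i j => by
    rw [toPoly_conicPair]
    rfl
  rw [Matrix.det_fin_two]
  simp only [h, toPoly_eq]
  simp [Conic.eval, jac, minor, MvPolynomial.pderiv_X]
  ring

lemma mem_critSet {f : QuadMap} {x : Fin 2 → ℂ} :
    x ∈ f.critSet ↔ Conic.eval (jac f.conicPair) x = 0 := by
  rw [← det_jacobian]
  rfl

/-- The coefficients as coordinates on the space of quadratic mappings. -/
noncomputable def homeomorphConicPair : QuadMap ≃ₜ ConicPair where
  toFun := conicPair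
  invFun q := ⟨fun i => toPoly (q i), fun i => totalDegree_toPoly _⟩
  left_inv f := Subtype.ext (funext fun i => toPoly_conicPair f i)
  right_inv q := funext fun i => funext fun k => coeff_expo_toPoly _ k
  continuous_toFun := continuous_pi fun i => continuous_pi fun k =>
    show Continuous ((fun p : CoeffIndex → ℂ => p ⟨i, expo k, degree_expo_le k⟩) ∘ coeffs) from
      (continuous_apply _).comp continuous_induced_dom
  continuous_invFun := by
    refine continuous_induced_rng.2 (continuous_pi fun ⟨i, d, hd⟩ => ?_)
    obtain ⟨k, rfl⟩ := exists_expo_eq hd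
    have : (fun q : ConicPair => (toPoly (q i)).coeff (expo k)) = fun q => q i k :=
      funext fun q => coeff_expo_toPoly _ k
    change Continuous fun q : ConicPair => (toPoly (q i)).coeff (expo k)
    rw [this]
    fun_prop

lemma conicPair_f₁ : f₁.conicPair = std := by
  have h : ∀ i, toPoly (std i) = f₁.1 i := by
    intro i
    fin_cases i <;> simp [toPoly_eq, std, f₁]
  ext i k
  rw [conicPair, ← h, coeff_expo_toPoly]

lemma mem_orbit_self (f : QuadMap) : f ∈ f.orbit :=
  ⟨AffineEquiv.refl ℂ _, AffineEquiv.refl ℂ _, rfl⟩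

lemma orbit_eq_of_mem {f g : QuadMap} (h : f ∈ g.orbit) : f.orbit = g.orbit := by
  obtain ⟨L, R, h⟩ := h
  ext k
  constructor
  · rintro ⟨L', R', h'⟩
    exact ⟨L.trans L', R'.trans R, by rw [h', h]; rfl⟩
  · rintro ⟨L', R', h'⟩
    refine ⟨L.symm.trans L', R'.trans R.symm, ?_⟩
    rw [h', h]
    ext1 x
    simp

/-- A conic is determined by its values, so an equality of maps becomes an equality of coefficients.
-/
lemma eq_leftComp_of_toFun_eq {f g : QuadMap} {L R : GA} (h : f.toFun = L ∘ g.toFun ∘ R) :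
    ∃ l t m v, substDet l ≠ 0 ∧ substDet m ≠ 0 ∧
      (∀ x, R x = ![m 0 * x 0 + m 1 * x 1 + v 0, m 2 * x 0 + m 3 * x 1 + v 1]) ∧
      f.conicPair = leftComp l t fun i => comp m v (g.conicPair i) := by
  obtain ⟨l, t, hl, hL⟩ := exists_coords L
  obtain ⟨m, v, hm, hR⟩ := exists_coords R
  refine ⟨l, t, m, v, hl, hm, hR, funext fun i => eval_injective (funext fun x => ?_)⟩
  have hx : f.toFun x i = L (g.toFun (R x)) i := by rw [h]; rfl
  rw [toFun_apply, hL, toFun_eq, hR, ← eval_comp, ← eval_comp] at hx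
  rw [hx]
  fin_cases i <;> simp [leftComp, Conic.eval] <;> ring

lemma conicPair_mem_regular {f : QuadMap} (h : f ∈ f₁.orbit) : f.conicPair ∈ regular := by
  obtain ⟨L, R, h⟩ := h
  obtain ⟨l, t, m, v, hl, hm, -, h⟩ := eq_leftComp_of_toFun_eq h
  rw [h, conicPair_f₁]
  exact leftComp_mem_regular t hl (comp_mem_regular v hm std_mem_regular)

lemma isHyperbola_critSet {f : QuadMap} (h : f ∈ f₁.orbit) : IsHyperbola f.critSet := by
  obtain ⟨L, R, h⟩ := h
  obtain ⟨l, t, m, v, hl, hm, hR, h⟩ := eq_leftComp_of_toFun_eq h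
  -- The critical set of `f₁` is `4xy = 1`; multiplying `x` by 4 turns it into `xy = 1`.
  obtain ⟨D, hD⟩ := exists_affineEquiv (m := ![4, 0, 0, 1]) 0 (by simp [substDet])
  refine ⟨R.trans D, ?_⟩
  ext y
  obtain ⟨x, rfl⟩ := (R.trans D).surjective y
  rw [mem_image_affineEquiv, AffineEquiv.symm_apply_apply, mem_critSet]
  have key : ∀ (c : ℂ) (q : Conic) (x : Fin 2 → ℂ), Conic.eval (c • q) x = c * Conic.eval q x :=
    fun c q x => by
      simp [Conic.eval]
      ring
  rw [h, jac_leftComp, jac_comp, key, key, eval_comp, ← hR, conicPair_f₁, jac_std,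
    mul_eq_zero_iff_left hl, mul_eq_zero_iff_left hm]
  simp [Conic.eval, hD]
  grind

lemma mem_orbit_of_comp_jac {f : QuadMap} {m : Fin 4 → ℂ} {v : Fin 2 → ℂ} {B F : ℂ}
    (hm : substDet m ≠ 0) (hB : B ≠ 0) (hF : F ≠ 0)
    (h : comp m v (jac f.conicPair) = ![0, B, 0, 0, 0, F]) : f ∈ f₁.orbit := by
  have hj : jac (fun i => comp m v (f.conicPair i)) =
      ![0, substDet m * B, 0, 0, 0, substDet m * F] := by
    rw [jac_comp, h]
    simp
  obtain ⟨a, b, hab, l, t, hl, h'⟩ :=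
    exists_eq_leftComp_of_jac (mul_ne_zero hm hB) (mul_ne_zero hm hF) hj
  obtain ⟨R, hR⟩ := exists_affineEquiv v hm
  obtain ⟨S, hS⟩ := exists_affineEquiv (m := ![a, 0, 0, b]) 0 (by simpa [substDet] using hab)
  obtain ⟨L, hL⟩ := exists_affineEquiv t hl
  have key : ∀ x, f.toFun (R (S x)) = L (f₁.toFun x) := by
    intro x
    ext i
    rw [toFun_apply, hR, ← eval_comp, hS, ← eval_comp, congrFun h' i, hL, toFun_eq, conicPair_f₁]
    fin_cases i <;> simp [leftComp, Conic.eval] <;> ring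
  refine ⟨L, (S.trans R).symm, funext fun x => ?_⟩
  have := key ((S.trans R).symm x)
  rw [Function.comp_apply, Function.comp_apply, ← this]
  congr 1
  exact ((S.trans R).apply_symm_apply x).symm

/-- Nonvanishing of the two relative invariants is necessary; it is sufficient since it lets the
critical conic be moved to `Bxy + F`, where the normal form of pairs applies. -/
lemma mem_orbit_f₁_iff {f : QuadMap} : f ∈ f₁.orbit ↔ f.conicPair ∈ regular := by
  refine ⟨conicPair_mem_regular, fun h => ?_⟩
  obtain ⟨m, v, hm, h1, h5, h⟩ := exists_comp_eq h.1 h.2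
  exact mem_orbit_of_comp_jac hm h1 h5 h

lemma mem_orbit_of_isHyperbola {f : QuadMap} (h : IsHyperbola f.critSet) : f ∈ f₁.orbit := by
  obtain ⟨e, he⟩ := h
  obtain ⟨m, v, hm, hR⟩ := exists_coords e.symm
  obtain ⟨h1, h⟩ := eq_of_eval_eq_zero_iff (q := comp m v (jac f.conicPair)) fun x => by
    rw [eval_comp, ← hR, ← mem_critSet, ← mem_image_affineEquiv, he, Set.mem_ofPred_eq]
  exact mem_orbit_of_comp_jac hm h1 (neg_ne_zero.2 h1) h

lemma hasEulerCharacteristic_orbit_f₁ : HasEulerCharacteristic f₁.orbit 0 := by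
  have e : f₁.orbit ≃ₜ regular := homeomorphConicPair.subtype fun _ => mem_orbit_f₁_iff
  exact ConicPair.hasEulerCharacteristic_regular_zero.of_homeomorph e.symm

/-! ### The stabilizer of `f₁` -/

lemma f₁_toFun (x : Fin 2 → ℂ) : f₁.toFun x = ![x 0 ^ 2 + x 1, x 1 ^ 2 + x 0] := by
  ext i
  fin_cases i <;> simp [toFun, f₁]

/-- The image of `f₁` contains the affinely independent points `(0, 0)`, `(1, 1)` and `(1, -1)`. -/
lemma eq_of_apply_f₁_eq {L L' : GA} (h : ∀ x, L (f₁.toFun x) = L' (f₁.toFun x)) : L = L' := by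
  obtain ⟨l, t, -, hL⟩ := exists_coords L
  obtain ⟨l', t', -, hL'⟩ := exists_coords L'
  have key : ∀ (a b : ℂ) (i : Fin 2), _ := fun a b i => congrFun (h ![a, b]) i
  simp only [f₁_toFun, hL, hL'] at key
  have h1 := key 0 0
  have h2 := key 1 0
  have h3 := key (-1) 0
  simp [Fin.forall_fin_two] at h1 h2 h3
  ext x i
  rw [hL, hL']
  fin_cases i <;> simp <;> grind

lemma symm_apply_of_mem_stab {f : QuadMap} {p : GA × GA} (hp : p ∈ f.stab) (x : Fin 2 → ℂ) :
    p.1.symm (f.toFun x) = f.toFun (p.2 x) := by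
  rw [AffineEquiv.symm_apply_eq]
  exact (congrFun hp x).symm

/-- Coefficients are compared in `f₁ ∘ R = L⁻¹ ∘ f₁`. The missing `xy`-terms make the linear part of
`R` diagonal or antidiagonal. On the right, the coefficients of `x²` and `y` agree, as do those of
`y²` and `x`; this kills the translation and gives `w⁴ = w`. -/
lemma exists_of_mem_stab {p : GA × GA} (hp : p ∈ f₁.stab) : ∃ w : ℂ, w ^ 3 = 1 ∧
    ((∀ x, p.2 x = ![w * x 0, w ^ 2 * x 1]) ∨ ∀ x, p.2 x = ![w * x 1, w ^ 2 * x 0]) := by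
  obtain ⟨l, t, -, hL⟩ := exists_coords p.1.symm
  obtain ⟨m, v, hm, hR⟩ := exists_coords p.2
  have key : ∀ i, comp m v (std i) = leftComp l t std i := fun i => by
    refine eval_injective (funext fun x => ?_)
    have hx := congrFun (symm_apply_of_mem_stab hp x) i
    rw [toFun_apply, hL, f₁_toFun, hR, ← eval_comp, conicPair_f₁] at hx
    rw [← hx]
    fin_cases i <;> simp [leftComp, Conic.eval, std] <;> ring
  have k0 := fun k => congrFun (key 0) k
  have k1 := fun k => congrFun (key 1) k
  simp [comp, std, leftComp, Conic.eval, Fin.forall_fin_succ] at k0 k1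
  obtain ⟨a1, a2, a3, a4, a5, -⟩ := k0
  obtain ⟨b1, b2, b3, b4, b5, -⟩ := k1
  simp only [substDet] at hm
  rcases a2 with h | h
  · have h1 : m 1 ≠ 0 := fun h' => hm (by rw [h, h']; ring)
    have h2 : m 2 ≠ 0 := fun h' => hm (by rw [h, h']; ring)
    have h3 : m 3 = 0 := b2.resolve_left h2
    have hv0 : v 0 = 0 := by
      have : v 0 * m 1 = 0 := by grind
      exact (mul_eq_zero_iff_right h1).1 this
    have hv1 : v 1 = 0 := by
      have : v 1 * m 2 = 0 := by grind
      exact (mul_eq_zero_iff_right h2).1 this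
    have h5 : m 2 = m 1 ^ 2 := by grind
    refine ⟨m 1, mul_left_cancel₀ h1 (by grind), Or.inr fun x => ?_⟩
    rw [hR, h, h3, hv0, hv1, h5]
    simp
  · have h1 : m 0 ≠ 0 := fun h' => hm (by rw [h, h']; ring)
    have h2 : m 3 ≠ 0 := fun h' => hm (by rw [h, h']; ring)
    have h3 : m 2 = 0 := b2.resolve_right h2
    have hv0 : v 0 = 0 := by
      have : v 0 * m 0 = 0 := by grind
      exact (mul_eq_zero_iff_right h1).1 this
    have hv1 : v 1 = 0 := by
      have : v 1 * m 3 = 0 := by grind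
      exact (mul_eq_zero_iff_right h2).1 this
    have h5 : m 3 = m 0 ^ 2 := by grind
    refine ⟨m 0, mul_left_cancel₀ h1 (by grind), Or.inl fun x => ?_⟩
    rw [hR, h, h3, hv0, hv1, h5]
    simp

lemma ncard_stab_f₁ : f₁.stab.ncard = 6 := by
  let mat : Fin 2 × rootsOfUnity 3 ℂ → Fin 4 → ℂ := fun k =>
    ![![k.2.1.1, 0, 0, k.2.1.1 ^ 2], ![0, k.2.1.1, k.2.1.1 ^ 2, 0]] k.1
  have hw : ∀ k : Fin 2 × rootsOfUnity 3 ℂ, (k.2.1.1 : ℂ) ^ 3 = 1 := fun k =>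
    (mem_rootsOfUnity' 3 k.2.1).1 k.2.2
  have hmat : ∀ k, substDet (mat k) ≠ 0 := fun ⟨i, w⟩ => by
    have := hw (i, w)
    fin_cases i <;> simp [mat, substDet]
  have hex : ∀ k, ∃ p : GA × GA, p ∈ f₁.stab ∧
      ∀ x, p.2 x = ![mat k 0 * x 0 + mat k 1 * x 1, mat k 2 * x 0 + mat k 3 * x 1] := by
    intro k
    obtain ⟨R, hR⟩ := exists_affineEquiv 0 (hmat k)
    -- Precomposition with `R` multiplies the components by `w²` and `w`, after exchanging them in
    -- the antidiagonal case. Since `w³ = 1`, the inverse is again some `mat`, with `w²` in place of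
    -- `w` when antidiagonal.
    obtain ⟨L, hL⟩ := exists_affineEquiv 0 (hmat (k.1, if k.1 = 0 then k.2 else k.2 ^ 2))
    refine ⟨(L, R), funext fun x => ?_, fun x => by simp [hR]⟩
    have := hw k
    obtain ⟨i, w, hw'⟩ := k
    ext j
    fin_cases i <;> fin_cases j <;> simp [f₁_toFun, hL, hR, mat] <;> simp at this <;> grind
  choose F hF hF' using hex
  have hinj : Function.Injective F := by
    intro k k' h
    have h1 : (F k).2 ![1, 0] = (F k').2 ![1, 0] := by rw [h]
    have h2 : (F k).2 ![0, 1] = (F k').2 ![0, 1] := by rw [h]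
    obtain ⟨i, w⟩ := k
    obtain ⟨j, w'⟩ := k'
    rw [hF', hF'] at h1 h2
    fin_cases i <;> fin_cases j <;> simp [mat] at h1 h2 ⊢
    · exact Subtype.ext (Units.ext h1)
    · exact Subtype.ext (Units.ext h2)
  have hrange : f₁.stab = Set.range F := by
    refine Set.Subset.antisymm (fun p hp => ?_) (Set.range_subset_iff.2 hF)
    obtain ⟨w, hw3, h⟩ := exists_of_mem_stab hp
    have hw' : IsUnit w := IsUnit.of_pow_eq_one hw3 (by norm_num)
    have hmem : hw'.unit ∈ rootsOfUnity 3 ℂ := (mem_rootsOfUnity' 3 _).2 hw3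
    obtain ⟨k, hk⟩ : ∃ k, p.2 = (F k).2 := by
      rcases h with h | h
      · refine ⟨(0, ⟨_, hmem⟩), ?_⟩
        ext x i
        rw [h, hF']
        simp [mat]
      · refine ⟨(1, ⟨_, hmem⟩), ?_⟩
        ext x i
        rw [h, hF']
        simp [mat]
    have hL : (F k).1.symm = p.1.symm := eq_of_apply_f₁_eq fun x => by
      rw [symm_apply_of_mem_stab (hF k), symm_apply_of_mem_stab hp, hk]
    exact ⟨k, Prod.ext (congrArg AffineEquiv.symm hL) hk.symm⟩
  rw [hrange, Set.ncard_range_of_injective hinj, Nat.card_prod, Nat.card_fin,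
    Complex.card_rootsOfUnity]

end QuadMap

/-! ### Openness and density of the orbit -/

/-- On the complex line from `x` to a point where `p` is nonzero, `p` restricts to a nonzero
polynomial in one variable; its zeros are finite, so `x` is a limit of nonzeros. -/
lemma MvPolynomial.dense_eval_ne_zero {σ : Type*} {p : MvPolynomial σ ℂ} (hp : p ≠ 0) :
    Dense {x : σ → ℂ | eval x p ≠ 0} := by
  obtain ⟨y, hy⟩ : ∃ y, eval y p ≠ 0 := by
    by_contra! h
    exact hp (MvPolynomial.funext fun x => by rw [h x, map_zero])
  intro x
  let q : Polynomial ℂ :=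
    aeval (fun i => Polynomial.C (x i) + Polynomial.X * Polynomial.C (y i - x i)) p
  have hq : ∀ t, q.eval t = eval (fun i => x i + t * (y i - x i)) p := fun t => by
    have : (Polynomial.evalRingHom t).comp (aeval fun i =>
        Polynomial.C (x i) + Polynomial.X * Polynomial.C (y i - x i) :
          MvPolynomial σ ℂ →ₐ[ℂ] Polynomial ℂ).toRingHom =
        eval fun i => x i + t * (y i - x i) := ringHom_ext (by simp) (by simp)
    exact congrArg (fun φ : MvPolynomial σ ℂ →+* ℂ => φ p) this
  have hq0 : q ≠ 0 := fun h => hy <| by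
    have := hq 1
    rw [h] at this
    simpa using this.symm
  have hfin : {t | q.eval t = 0}.Finite := by
    refine (Polynomial.rootSet_finite q ℂ).subset fun t ht => ?_
    rw [Polynomial.mem_rootSet]
    exact ⟨hq0, by simpa using ht⟩
  have h0 : (0 : ℂ) ∈ closure {t | q.eval t = 0}ᶜ := hfin.countable.dense_compl ℂ 0
  have hc : Continuous fun t : ℂ => fun i => x i + t * (y i - x i) := by fun_prop
  have := map_mem_closure hc h0 (t := {x : σ → ℂ | eval x p ≠ 0}) fun t ht => by
    rw [Set.mem_ofPred_eq, ← hq]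
    exact ht
  simpa using this

lemma dense_induced {X Y : Type*} [TopologicalSpace Y] {f : X → Y} {s : Set X}
    (h : ∀ x, f x ∈ closure (f '' s)) : @Dense X (TopologicalSpace.induced f inferInstance) s :=
  letI := TopologicalSpace.induced f inferInstance
  (Topology.IsInducing.mk (f := f) rfl).dense_iff.2 h

namespace QuadMap

open Conic ConicPair

lemma coeffs_surjective : Function.Surjective coeffs := by
  intro c
  refine ⟨homeomorphConicPair.symm fun i k => c ⟨i, expo k, degree_expo_le k⟩, ?_⟩
  ext ⟨i, d, hd⟩
  obtain ⟨k, rfl⟩ := exists_expo_eq hd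
  exact coeff_expo_toPoly _ _

/-- The coefficients of the generic quadratic mapping. -/
noncomputable def genericCoeff (i : Fin 2) (k : Fin 6) : MvPolynomial CoeffIndex ℂ :=
  MvPolynomial.X ⟨i, expo k, degree_expo_le k⟩

/-- The product of the discriminant and the determinant of the conic of critical points, as a
polynomial in the coefficients of the mapping. -/
noncomputable def regularPoly : MvPolynomial CoeffIndex ℂ :=
  let m i j := genericCoeff 0 i * genericCoeff 1 j - genericCoeff 1 i * genericCoeff 0 j
  let q := ![2 * m 0 1, 4 * m 0 2, 2 * m 1 2, 2 * m 0 4 + m 3 1, m 1 4 + 2 * m 3 2, m 3 4]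
  (q 1 ^ 2 - 4 * q 0 * q 2) *
    (4 * q 0 * q 2 * q 5 + q 1 * q 3 * q 4 - q 0 * q 4 ^ 2 - q 2 * q 3 ^ 2 - q 1 ^ 2 * q 5)

lemma eval_regularPoly (f : QuadMap) : MvPolynomial.eval f.coeffs regularPoly =
    disc (jac f.conicPair) * delta (jac f.conicPair) := by
  have h : ∀ i k, MvPolynomial.eval f.coeffs (genericCoeff i k) = f.conicPair i k := fun i k => by
    simp [genericCoeff, coeffs, conicPair]
  simp [regularPoly, disc, delta, jac, minor, h]

lemma mem_orbit_f₁_iff_eval {f : QuadMap} :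
    f ∈ f₁.orbit ↔ MvPolynomial.eval f.coeffs regularPoly ≠ 0 := by
  rw [mem_orbit_f₁_iff, eval_regularPoly, mul_ne_zero_iff]
  rfl

lemma regularPoly_ne_zero : regularPoly ≠ 0 := fun h => by
  have := mem_orbit_f₁_iff_eval.1 (mem_orbit_self f₁)
  simp [h] at this

lemma dense_orbit_f₁ : Dense f₁.orbit := by
  have hi : Topology.IsInducing coeffs := ⟨rfl⟩
  rw [hi.dense_iff]
  intro f
  have h : f₁.orbit = coeffs ⁻¹' {x | MvPolynomial.eval x regularPoly ≠ 0} :=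
    Set.ext fun f => mem_orbit_f₁_iff_eval
  rw [h, Set.image_preimage_eq _ coeffs_surjective]
  exact MvPolynomial.dense_eval_ne_zero regularPoly_ne_zero _

lemma isOpen_orbit_f₁ : IsOpen f₁.orbit := by
  have h : f₁.orbit = coeffs ⁻¹' {x | MvPolynomial.eval x regularPoly ≠ 0} :=
    Set.ext fun f => mem_orbit_f₁_iff_eval
  rw [h]
  exact (isOpen_ne_fun (MvPolynomial.continuous_eval _) continuous_const).preimage
    continuous_induced_dom

lemma mem_toPoint {f : QuadMap} {p : MvPolynomial CoeffIndex ℂ} :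
    p ∈ PrimeSpectrum.asIdeal f.toPoint ↔ MvPolynomial.eval f.coeffs p = 0 := by
  refine (MvPolynomial.mem_vanishingIdeal_singleton_iff f.coeffs p).trans ?_
  rw [MvPolynomial.aeval_eq_eval]

/-- The open subset of the affine space that corresponds to the orbit of `f₁`. -/
noncomputable def regularOpens : space.Opens := PrimeSpectrum.basicOpen regularPoly

lemma preimage_toPoint_regularOpens : toPoint ⁻¹' (regularOpens : Set space) = f₁.orbit :=
  Set.ext fun f => by
    rw [mem_orbit_f₁_iff_eval, ne_eq, ← mem_toPoint]
    rfl

lemma isOpen_zariski_orbit_f₁ : @IsOpen QuadMap zariski f₁.orbit :=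
  ⟨regularOpens, regularOpens.2, preimage_toPoint_regularOpens⟩

/-- A basic neighborhood is given by a nonzero polynomial `q`; the product `q * regularPoly` is
nonzero, hence nonzero at some point of `ℂ¹²`. -/
lemma dense_zariski_orbit_f₁ : @Dense QuadMap zariski f₁.orbit := by
  refine dense_induced fun f => ?_
  refine (PrimeSpectrum.isTopologicalBasis_basic_opens.mem_closure_iff).2 ?_
  rintro _ ⟨q, rfl⟩ hq
  have hq0 : q ≠ 0 := by
    rintro rfl
    exact hq (mem_toPoint.2 (map_zero _))
  obtain ⟨x, hx⟩ : ∃ x, MvPolynomial.eval x (q * regularPoly) ≠ 0 := by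
    by_contra! h
    exact mul_ne_zero hq0 regularPoly_ne_zero
      (MvPolynomial.funext fun x => by rw [h x, map_zero])
  obtain ⟨g, rfl⟩ := coeffs_surjective x
  rw [map_mul, mul_ne_zero_iff] at hx
  exact ⟨g.toPoint, fun h => hx.1 (mem_toPoint.1 h), g, mem_orbit_f₁_iff_eval.2 hx.2, rfl⟩

/-- An open orbit meets a dense one, and orbits that meet coincide. One argument serves both
topologies. -/
lemma mem_orbit_f₁_of_dense (t : TopologicalSpace QuadMap) (h₁ : @Dense QuadMap t f₁.orbit)
    {f : QuadMap} (h : @IsOpen QuadMap t f.orbit) : f ∈ f₁.orbit := by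
  obtain ⟨g, hg, hg₁⟩ := h₁.inter_open_nonempty _ h ⟨f, mem_orbit_self f⟩
  rw [← orbit_eq_of_mem hg₁, orbit_eq_of_mem hg]
  exact mem_orbit_self f

lemma tfae (f : QuadMap) : [IsHyperbola f.critSet,
    @IsOpen QuadMap zariski f.orbit ∧ @Dense QuadMap zariski f.orbit,
    IsOpen f.orbit ∧ Dense f.orbit, f.orbit = f₁.orbit, f ∈ f₁.orbit].TFAE := by
  tfae_have 1 → 5 := mem_orbit_of_isHyperbola
  tfae_have 5 → 1 := isHyperbola_critSet
  tfae_have 5 → 4 := orbit_eq_of_mem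
  tfae_have 4 → 5 := fun h => h ▸ mem_orbit_self f
  tfae_have 4 → 2 := fun h => h ▸ ⟨isOpen_zariski_orbit_f₁, dense_zariski_orbit_f₁⟩
  tfae_have 2 → 5 := fun h => mem_orbit_f₁_of_dense _ dense_zariski_orbit_f₁ h.1
  tfae_have 4 → 3 := fun h => h ▸ ⟨isOpen_orbit_f₁, dense_orbit_f₁⟩
  tfae_have 3 → 5 := fun h => mem_orbit_f₁_of_dense _ dense_orbit_f₁ h.1
  tfae_finish

end QuadMap

/-! ### Dimension and smoothness of the orbit -/

/-- A strictly increasing chain of specializations bounds the dimension from below. -/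
lemma le_topologicalKrullDim_of_specializes {X : Type*} [TopologicalSpace X] {n : ℕ}
    (x : Fin (n + 1) → X) (h : ∀ i : Fin n, x i.castSucc ⤳ x i.succ)
    (h' : ∀ i : Fin n, ¬ x i.succ ⤳ x i.castSucc) : n ≤ topologicalKrullDim X := by
  have hc : ∀ y, IsIrreducible (closure {y} : Set X) := fun y => isIrreducible_singleton.closure
  -- Closures shrink along specializations, hence the reversed index.
  let g : Fin (n + 1) → TopologicalSpace.IrreducibleCloseds X :=
    fun i => ⟨closure {x i.rev}, hc _, isClosed_closure⟩
  have hg : StrictMono g := Fin.strictMono_iff_lt_succ.2 fun i => by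
    rw [lt_iff_le_not_ge]
    change closure {x i.castSucc.rev} ⊆ closure {x i.succ.rev} ∧
      ¬ closure {x i.succ.rev} ⊆ closure {x i.castSucc.rev}
    rw [← specializes_iff_closure_subset, ← specializes_iff_closure_subset,
      Fin.rev_castSucc, Fin.rev_succ]
    exact ⟨h _, h' _⟩
  exact Order.LTSeries.length_le_krullDim (LTSeries.mk n g hg)

namespace MvPolynomial

variable {σ : Type*} {n : ℕ}

/-- The specialization of the first variables to the coordinates of a point. -/
noncomputable def specialize (e : σ ≃ Fin n) (a : σ → ℂ) (k : ℕ) :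
    MvPolynomial σ ℂ →ₐ[ℂ] MvPolynomial σ ℂ :=
  aeval fun i => if (e i : ℕ) < k then C (a i) else X i

lemma specialize_specialize (e : σ ≃ Fin n) (a : σ → ℂ) {k l : ℕ} (h : k ≤ l) (p : MvPolynomial σ ℂ) :
    specialize e a l (specialize e a k p) = specialize e a l p := by
  have : (specialize e a l).comp (specialize e a k) = specialize e a l := by
    refine algHom_ext fun i => ?_
    by_cases hi : (e i : ℕ) < k
    · simp [specialize, hi, hi.trans_le h]
    · simp [specialize, hi]
  exact congrArg (fun φ => φ p) this

lemma eval_specialize (e : σ ≃ Fin n) (a : σ → ℂ) (k : ℕ) (p : MvPolynomial σ ℂ) :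
    eval a (specialize e a k p) = eval a p := by
  have : (aeval a).comp (specialize e a k) = aeval a := by
    refine algHom_ext fun i => ?_
    by_cases hi : (e i : ℕ) < k <;> simp [specialize, hi]
  simpa using congrArg (fun φ => φ p) this

/-- A chain of points of a basic open subset of the affine space. -/
lemma exists_specializes_chain (e : σ ≃ Fin n) {p : MvPolynomial σ ℂ} (hp : p ≠ 0) :
    ∃ x : Fin (n + 1) → PrimeSpectrum (MvPolynomial σ ℂ),
      (∀ i, x i ∈ PrimeSpectrum.basicOpen p) ∧ (∀ i : Fin n, x i.castSucc ⤳ x i.succ) ∧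
      ∀ i : Fin n, ¬ x i.succ ⤳ x i.castSucc := by
  obtain ⟨a, ha⟩ : ∃ a, eval a p ≠ 0 := by
    by_contra! h
    exact hp (MvPolynomial.funext fun x => by rw [h x, map_zero])
  -- The `k`-th prime is generic on the linear subspace through `a` that fixes the first `k`
  -- coordinates; it stays in the basic open set because `p` does not vanish at `a`.
  refine ⟨fun k => ⟨RingHom.ker (specialize e a k), RingHom.ker_isPrime _⟩, fun k h => ha ?_,
    fun k => ?_, fun k h => ?_⟩
  · rw [← eval_specialize e a k, (h : specialize e a k p = 0), map_zero]
  · rw [← PrimeSpectrum.le_iff_specializes]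
    intro q (hq : specialize e a k q = 0)
    change specialize e a (k + 1) q = 0
    rw [← specialize_specialize e a k.1.le_succ, hq, map_zero]
  · rw [← PrimeSpectrum.le_iff_specializes] at h
    -- This linear polynomial lies in the next prime but not in the current one.
    have h1 : X (e.symm k) - C (a (e.symm k)) ∈ RingHom.ker (specialize e a (k + 1)) := by
      simp [specialize]
    have h2 : specialize e a k (X (e.symm k) - C (a (e.symm k))) = 0 := h h1
    have h3 : (X (e.symm k) - C (a (e.symm k)) : MvPolynomial σ ℂ) = 0 := by simpa [specialize] using h2
    have h4 := congrArg (eval fun i => a i + 1) h3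
    simp at h4

end MvPolynomial

namespace QuadMap

open Conic ConicPair

lemma card_coeffIndex : Nat.card CoeffIndex = 12 := by
  let g : Fin 2 × Fin 6 → CoeffIndex := fun k => ⟨k.1, expo k.2, degree_expo_le k.2⟩
  have hg : Function.Bijective g := by
    refine ⟨fun k l h => ?_, fun ⟨i, d, hd⟩ => ?_⟩
    · simp only [g, Prod.mk.injEq, Subtype.mk.injEq] at h
      exact Prod.ext h.1 (expo_injective h.2)
    · obtain ⟨k, rfl⟩ := exists_expo_eq hd
      exact ⟨(i, k), rfl⟩
  rw [← Nat.card_eq_of_bijective g hg]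
  simp

instance : Finite CoeffIndex := Nat.finite_of_card_ne_zero (by rw [card_coeffIndex]; norm_num)

/-- The ambient affine space bounds the dimension from above; a chain of specializations inside the
open set bounds it from below. -/
lemma topologicalKrullDim_regularOpens :
    topologicalKrullDim (regularOpens : AlgebraicGeometry.Scheme) = 12 := by
  have hi : Topology.IsInducing regularOpens.ι := regularOpens.ι.isOpenEmbedding.isInducing
  refine le_antisymm (hi.topologicalKrullDim_le.trans ?_) ?_
  · have : ringKrullDim (MvPolynomial CoeffIndex ℂ) = 12 := by
      rw [MvPolynomial.ringKrullDim_of_isNoetherianRing, card_coeffIndex]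
      simp
    rw [← this]
    exact (PrimeSpectrum.topologicalKrullDim_eq_ringKrullDim (MvPolynomial CoeffIndex ℂ)).le
  · let e : CoeffIndex ≃ Fin 12 := Finite.equivFinOfCardEq card_coeffIndex
    obtain ⟨x, hx, h, h'⟩ := MvPolynomial.exists_specializes_chain e regularPoly_ne_zero
    have hy : ∀ i, ∃ y, regularOpens.ι y = x i := fun i => by
      have : x i ∈ Set.range regularOpens.ι := by
        rw [Scheme.Opens.range_ι]
        exact hx i
      exact this
    choose y hy using hy
    refine le_topologicalKrullDim_of_specializes y (fun i => ?_) fun i => ?_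
    · rw [← hi.specializes_iff, hy, hy]
      exact h i
    · rw [← hi.specializes_iff, hy, hy]
      exact h' i

lemma isSmoothAffineVariety_regularOpens :
    IsSmoothAffineVariety (regularOpens.ι ≫ structureMap) := by
  -- An open subscheme of an integral scheme is integral only if it is nonempty.
  have : Nonempty (regularOpens : AlgebraicGeometry.Scheme) :=
    ⟨⟨f₁.toPoint, by
      have := mem_orbit_self f₁
      rw [← preimage_toPoint_regularOpens] at this
      exact this⟩⟩
  have : Smooth structureMap := by
    rw [HasRingHomProperty.Spec_iff (P := @Smooth)]
    exact RingHom.smooth_algebraMap.2 (⟨inferInstance, inferInstance⟩ :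
      Algebra.Smooth ℂ (MvPolynomial CoeffIndex ℂ))
  exact ⟨(IsAffineOpen.Spec_basicOpen (R := CommRingCat.of (MvPolynomial CoeffIndex ℂ))
    regularPoly), inferInstance, inferInstance⟩

end QuadMap

theorem mainTheorem1 :
    (∀ f : QuadMap,
      [ IsHyperbola f.critSet,
        @IsOpen QuadMap QuadMap.zariski f.orbit ∧ @Dense QuadMap QuadMap.zariski f.orbit,
        IsOpen f.orbit ∧ Dense f.orbit,
        f.orbit = QuadMap.f₁.orbit,
        f ∈ QuadMap.f₁.orbit ].TFAE) ∧
    (∃ U : QuadMap.space.Opens,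
      QuadMap.toPoint ⁻¹' (U : Set QuadMap.space) = QuadMap.f₁.orbit ∧
      IsSmoothAffineVariety (U.ι ≫ QuadMap.structureMap) ∧
      topologicalKrullDim (U : AlgebraicGeometry.Scheme) = 12) ∧
    HasEulerCharacteristic QuadMap.f₁.orbit 0 ∧
    QuadMap.f₁.stab.ncard = 6 :=
  ⟨QuadMap.tfae, ⟨QuadMap.regularOpens, QuadMap.preimage_toPoint_regularOpens,
    QuadMap.isSmoothAffineVariety_regularOpens, QuadMap.topologicalKrullDim_regularOpens⟩,
    QuadMap.hasEulerCharacteristic_orbit_f₁, QuadMap.ncard_stab_f₁⟩
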